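/- \textbf{Lemma (well-posedness of the weakly symmetric elliptic projection).} Let $\Omega\subset\mathbb R^2$ be a polygonal domain (bounded, open, connected, lying locally on one side of its boundary, which is a finite union of segments). Let $\Gamma^{u},\Gamma^{\sigma}\subset\partial\Omega$ be disjoint, relatively open and of positive length, with $\partial\Omega=\overline{\Gamma^{u}}\cup\overline{\Gamma^{\sigma}}$. Let $\mathcal T_h$ be a finite conforming mesh of $\Omega$ by simple polygons (every edge of an element lies on $\partial\Omega$ or is also an edge of another element; flat angles are allowed at vertices), such that every edge on $\partial\Omega$ lies in $\overline{\Gamma^{u}}$ or in $\overline{\Gamma^{\sigma}}$, and such that, for some $\eta_1,\eta_2>0$, each element $K$ of diameter $h_K$ is star-shaped with respect to a ball of radius greater than $\eta_1h_K$ and each edge of $K$ has length at least $\eta_2h_K$. Let $k\ge 1$ be an integer. Let $(\cdot,\cdot)$ denote the $L^2(\Omega)$ inner products of vector and tensor fields. The divergence and the (scalar) curl of a $2\times2$ tensor field are taken row by row, in the weak sense, so that both are vector fields. Put $$\mathbb S=\{\tau\in L^2(\Omega)^{2\times 2}:\operatorname{div}\tau\in L^2(\Omega)^2,\ \tau n=0\text{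 on }\Gamma^{\sigma}\},\quad V=L^2(\Omega)^2,\quad \mathbb K=\{\eta\in L^2(\Omega)^{2\times2}:\eta=-\eta^{T}\},$$ where $n$ is the outward unit normal. For $K\in\mathcal T_h$ let $\mathbb S(K)$ be the space of all $\tau\in L^2(K)^{2\times2}$ with $\operatorname{div}\tau\in P_k(K)^2$, $\operatorname{curl}\tau\in P_{k-1}(K)^2$ and $\tau n|_F\in P_k(F)^2$ for every edge $F$ of $K$, where $P_m$ denotes polynomials of total degree at most $m$. Let $$\mathbb S_h=\{\tau\in\mathbb S:\tau|_K\in\mathbb S(K)\ \forall K\in\mathcal T_h\},\quad V_h=\{v\in V:v|_K\in P_k(K)^2\ \forall K\in\mathcal T_h\},\quad \mathbb K_h=\{\eta\in\mathbb K:\eta|_K\in P_k(K)^{2\times2}\ \forall K\in\mathcal T_h\}.$$ Then for every $(\sigma_0,\sigma_1,u,r)\in\mathbb S\times\mathbb S\times V\times\mathbb K$ there is exactly one $(\sigma_{0,\pi},\sigma_{1,\pi},u_\pi,r_\pi)\in\mathbb S_h\times\mathbb S_h\times V_h\times\mathbb K_h$ such that $$\begin{aligned} (\sigma_{0,\pi}-\sigma_0,\tau_0)+(\operatorname{div}\tau_0,u_\pi-u)+(\tau_0,r_\pi-r)&=0&&\forall\,\tau_0\in\mathbb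 S_h,\\ (\sigma_{1,\pi}-\sigma_1,\tau_1)+(\operatorname{div}\tau_1,u_\pi-u)+(\tau_1,r_\pi-r)&=0&&\forall\,\tau_1\in\mathbb S_h,\\ (\operatorname{div}(\sigma_{0,\pi}+\sigma_{1,\pi}-\sigma_0-\sigma_1),w)&=0&&\forall\,w\in V_h,\\ (\sigma_{0,\pi}+\sigma_{1,\pi}-\sigma_0-\sigma_1,\eta)&=0&&\forall\,\eta\in\mathbb K_h. \end{aligned}$$ -/

import Mathlib

open MeasureTheory Set
open scoped ContDiff ENNReal

noncomputable section

namespace WeakSymVEM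

/-! ### Function spaces on subsets of the plane -/

/-- Points of the plane, and also vectors of the plane. -/
abbrev Pt : Type := EuclideanSpace ℝ (Fin 2)

/-- Real `2 × 2` tensors with the Frobenius inner product `σ : τ`. The entry in row `i` and
column `j` of `τ` is `τ (i, j)`. -/
abbrev Ten : Type := EuclideanSpace ℝ (Fin 2 × Fin 2)

/-- Vector fields in `L²(Ω)`; `inner ℝ u v` is `∫_Ω u · v`. -/
abbrev L2Vec (Ω : Set Pt) : Type := Lp Pt 2 (volume.restrict Ω)

/-- Tensor fields in `L²(Ω)`; `inner ℝ σ τ` is `∫_Ω σ : τ`. -/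
abbrev L2Ten (Ω : Set Pt) : Type := Lp Ten 2 (volume.restrict Ω)

/-- Smooth compactly supported real functions on the whole plane. -/
def IsTest (φ : Pt → ℝ) : Prop := ContDiff ℝ ∞ φ ∧ HasCompactSupport φ

/-- The partial derivative `∂φ/∂x_j`. -/
def pderiv (j : Fin 2) (φ : Pt → ℝ) (x : Pt) : ℝ := fderiv ℝ φ x (EuclideanSpace.single j 1)

/-- `f` is the row-wise weak divergence of `τ` in the open set `U`. -/
def IsWeakDiv (U : Set Pt) (τ : Pt → Ten) (f : Pt → Pt) : Prop :=
  ∀ φ : Pt → ℝ, IsTest φ → tsupport φ ⊆ U → ∀ i : Fin 2,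
    ∫ x in U, ∑ j : Fin 2, τ x (i, j) * pderiv j φ x = -∫ x in U, f x i * φ x

/-- `c` is the row-wise weak (scalar) curl of `τ` in the open set `U`: in the sense of
distributions, `c i = ∂ τ (i, 1) / ∂x_0 - ∂ τ (i, 0) / ∂x_1`. -/
def IsWeakCurl (U : Set Pt) (τ : Pt → Ten) (c : Pt → Pt) : Prop :=
  ∀ φ : Pt → ℝ, IsTest φ → tsupport φ ⊆ U → ∀ i : Fin 2,
    ∫ x in U, (τ x (i, 1) * pderiv 0 φ x - τ x (i, 0) * pderiv 1 φ x) = -∫ x in U, c x i * φ x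

/-- The boundary pairing `⟨(τ n)_i, φ⟩` over `∂U` of a tensor field `τ` whose weak divergence
is `f`, by Green's formula. -/
def normalPairing (U : Set Pt) (τ : Pt → Ten) (f : Pt → Pt) (φ : Pt → ℝ) (i : Fin 2) : ℝ :=
  ∫ x in U, (f x i * φ x + ∑ j : Fin 2, τ x (i, j) * pderiv j φ x)

/-- The space `H(div, Ω)` of tensor fields in `L²` with row-wise weak divergence in `L²`. -/
def HDiv (Ω : Set Pt) : Set (L2Ten Ω) := {τ | ∃ f : L2Vec Ω, IsWeakDiv Ω τ f}

open Classical in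
/-- The divergence of an element of `H(div, Ω)` (zero outside of this space). -/
def divergence {Ω : Set Pt} (τ : L2Ten Ω) : L2Vec Ω :=
  if h : ∃ f : L2Vec Ω, IsWeakDiv Ω τ f then h.choose else 0

theorem isWeakDiv_divergence {Ω : Set Pt} {τ : L2Ten Ω} (h : τ ∈ HDiv Ω) :
    IsWeakDiv Ω τ (divergence τ) := by
  have h' : ∃ f : L2Vec Ω, IsWeakDiv Ω τ f := h
  rw [divergence, dif_pos h']
  exact h'.choose_spec

/-- The weak divergence in `L²` of an open set is unique, so `divergence` does not depend on the
choice made in its definition. -/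
theorem divergence_eq {Ω : Set Pt} (hΩ : IsOpen Ω) {τ : L2Ten Ω} {f : L2Vec Ω}
    (h : IsWeakDiv Ω τ f) : divergence τ = f := by
  have h' := isWeakDiv_divergence (show τ ∈ HDiv Ω from ⟨f, h⟩)
  have key : ∀ i : Fin 2, ∀ᵐ x ∂(volume : Measure Pt), x ∈ Ω → divergence τ x i - f x i = 0 := by
    intro i
    have hd : ∀ g : L2Vec Ω, LocallyIntegrableOn (fun x => g x i) Ω := by
      intro g
      have h1 : LocallyIntegrable (fun x => g x) (volume.restrict Ω) :=
        (Lp.memLp g).locallyIntegrable (by norm_num)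
      have h2 : LocallyIntegrable (fun x => g x i) (volume.restrict Ω) := by
        intro x
        obtain ⟨s, hs, hi⟩ := h1 x
        exact ⟨s, hs, (EuclideanSpace.proj (𝕜 := ℝ) i).integrable_comp hi⟩
      exact locallyIntegrableOn_of_locallyIntegrable_restrict h2
    refine hΩ.ae_eq_zero_of_integral_contDiff_smul_eq_zero
      ((hd (divergence τ)).sub (hd f)) ?_
    intro φ h1 h2 h3
    have e1 := h φ ⟨h1, h2⟩ h3 i
    have e2 := h' φ ⟨h1, h2⟩ h3 i
    have hφ : ∀ g : L2Vec Ω, IntegrableOn (fun x => φ x * g x i) Ω := by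
      intro g
      have hs : IntegrableOn (fun x => φ x * g x i) (tsupport φ) := by
        have := (hd g).integrableOn_compact_subset h3 h2
        exact this.continuousOn_mul h1.continuous.continuousOn h2
      have := hs.integrable_of_forall_notMem_eq_zero (f := fun x => φ x * g x i) (by
        intro x hx
        rw [image_eq_zero_of_notMem_tsupport hx, zero_mul])
      exact this.integrableOn
    have e3 : ∫ x in Ω, φ x * divergence τ x i = ∫ x in Ω, φ x * f x i := by
      simp only [mul_comm (φ _)]
      linarith
    have e4 : ∫ x in Ω, φ x • (divergence τ x i - f x i) = 0 := by
      simp only [smul_eq_mul, mul_sub]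
      rw [integral_sub (hφ _) (hφ _), e3, sub_self]
    rw [← e4]
    symm
    apply setIntegral_eq_integral_of_forall_compl_eq_zero
    intro x hx
    rw [image_eq_zero_of_notMem_tsupport (fun hx' => hx (h3 hx')), zero_smul]
  apply Lp.ext
  filter_upwards [ae_restrict_of_ae (key 0), ae_restrict_of_ae (key 1),
    ae_restrict_mem hΩ.measurableSet] with x h0 h1 hx
  ext i
  fin_cases i
  · exact sub_eq_zero.1 (h0 hx)
  · exact sub_eq_zero.1 (h1 hx)

/-- The space of those `τ` in `H(div, Ω)` with `τ n = 0` on `Γσ`, a relatively open part of the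
boundary: the normal trace vanishes against all test functions whose support meets the
boundary only within `Γσ`. -/
def HDivStar (Ω Γσ : Set Pt) : Set (L2Ten Ω) :=
  {τ | τ ∈ HDiv Ω ∧ ∀ φ : Pt → ℝ, IsTest φ → tsupport φ ∩ frontier Ω ⊆ Γσ →
    ∀ i : Fin 2, normalPairing Ω τ (divergence τ) φ i = 0}

/-- The space of skew-symmetric tensor fields in `L²(Ω)`. -/
def L2Skew (Ω : Set Pt) : Set (L2Ten Ω) :=
  {η | ∀ᵐ x ∂(volume.restrict Ω), ∀ i j : Fin 2, η x (i, j) = -η x (j, i)}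

/-! ### Domains, polygons and meshes -/

/-- A polygonal domain (possibly with holes): a bounded, connected, nonempty open set bounded by
finitely many segments. The equality `interior (closure Ω) = Ω` says that the domain lies on one
side only of its boundary (no slits, no punctures). -/
structure IsPolygonalDomain (Ω : Set Pt) : Prop where
  isOpen : IsOpen Ω
  isConnected : IsConnected Ω
  isBounded : Bornology.IsBounded Ω
  interior_closure : interior (closure Ω) = Ω
  frontier_eq : ∃ s : Finset (Pt × Pt), frontier Ω = ⋃ p ∈ s, segment ℝ p.1 p.2

/-- `Γu` and `Γσ` are disjoint relatively open parts of `∂Ω` of positive length whose closures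
cover `∂Ω`. -/
structure IsBoundaryPartition (Ω Γu Γσ : Set Pt) : Prop where
  open_u : ∃ U : Set Pt, IsOpen U ∧ Γu = U ∩ frontier Ω
  open_σ : ∃ U : Set Pt, IsOpen U ∧ Γσ = U ∩ frontier Ω
  disjoint : Disjoint Γu Γσ
  cover : frontier Ω = closure Γu ∪ closure Γσ
  length_u : 0 < μH[1] Γu
  length_σ : 0 < μH[1] Γσ

/-- An (open) simple polygon with cyclically ordered vertices. Flat angles at vertices are allowed,
so that hanging nodes count as vertices. The interior `carrier` is determined by the vertices:
it is the bounded component of the complement of the closed polygonal curve. -/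
structure SimplePolygon where
  n : ℕ
  three_le : 3 ≤ n
  vertex : Fin n → Pt
  vertex_injective : Function.Injective vertex
  /-- Two different edges meet at most in common end points. -/
  simple : ∀ i j : Fin n, i ≠ j →
    segment ℝ (vertex i) (vertex (finRotate n i)) ∩ segment ℝ (vertex j) (vertex (finRotate n j)) ⊆
      {vertex i, vertex (finRotate n i)} ∩ {vertex j, vertex (finRotate n j)}
  carrier : Set Pt
  isOpen : IsOpen carrier
  isConnected : IsConnected carrier
  isBounded : Bornology.IsBounded carrier
  frontier_eq : frontier carrier = ⋃ i : Fin n, segment ℝ (vertex i) (vertex (finRotate n i))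

namespace SimplePolygon

/-- The `i`-th edge, a closed segment. -/
def edge (K : SimplePolygon) (i : Fin K.n) : Set Pt :=
  segment ℝ (K.vertex i) (K.vertex (finRotate K.n i))

/-- The length of the `i`-th edge. -/
def edgeLength (K : SimplePolygon) (i : Fin K.n) : ℝ :=
  dist (K.vertex i) (K.vertex (finRotate K.n i))

/-- The integral of `g` over the `i`-th edge with respect to arc length. -/
def edgeIntegral (K : SimplePolygon) (i : Fin K.n) (g : Pt → ℝ) : ℝ :=
  K.edgeLength i *
    ∫ t in (0 : ℝ)..1, g (AffineMap.lineMap (K.vertex i) (K.vertex (finRotate K.n i)) t)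

end SimplePolygon

/-- A polygonal mesh of `Ω`: finitely many disjoint polygons whose closures cover the closure
of `Ω`, such that every edge of an element lies on the boundary or is also an edge of
another element. -/
structure PolygonalMesh (Ω : Set Pt) where
  N : ℕ
  cell : Fin N → SimplePolygon
  subset : ∀ K, (cell K).carrier ⊆ Ω
  disjoint : ∀ K L, K ≠ L → Disjoint (cell K).carrier (cell L).carrier
  cover : closure Ω = ⋃ K, closure (cell K).carrier
  conforming : ∀ K i, (cell K).edge i ⊆ frontier Ω ∨
    ∃ L, L ≠ K ∧ ∃ j, (cell L).edge j = (cell K).edge i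

namespace PolygonalMesh

variable {Ω : Set Pt}

/-- Shape regularity: every element `K` is star-shaped with respect to (each point of) a ball of
radius greater than `η₁ h_K`, and its edges have length at least `η₂ h_K`, where `h_K` is the
diameter of `K`. -/
def ShapeRegular (T : PolygonalMesh Ω) (η₁ η₂ : ℝ) : Prop :=
  ∀ K, (∃ (c : Pt) (r : ℝ), η₁ * Metric.diam (T.cell K).carrier < r ∧
      ∀ y ∈ Metric.ball c r, StarConvex ℝ y (T.cell K).carrier) ∧
    ∀ i, η₂ * Metric.diam (T.cell K).carrier ≤ (T.cell K).edgeLength i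

/-- The mesh respects the boundary partition: every edge on `∂Ω` lies in the closure of one of
the two parts. -/
def Fits (T : PolygonalMesh Ω) (Γu Γσ : Set Pt) : Prop :=
  ∀ K i, (T.cell K).edge i ⊆ frontier Ω →
    (T.cell K).edge i ⊆ closure Γu ∨ (T.cell K).edge i ⊆ closure Γσ

end PolygonalMesh

/-! ### The discrete spaces -/

/-- The value at `x` of a polynomial in two variables. -/
def polyEval (p : MvPolynomial (Fin 2) ℝ) (x : Pt) : ℝ := MvPolynomial.eval (fun j => x j) p

/-- The vector field with polynomial components `p 0`, `p 1`. -/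
def polyField (p : Fin 2 → MvPolynomial (Fin 2) ℝ) (x : Pt) : Pt :=
  WithLp.toLp 2 fun i => polyEval (p i) x

/-- The local virtual space `S(K)` of order `k`: square integrable tensor fields on `K` with
divergence in `P_k(K)`, curl in `P_{k-1}(K)`, and normal trace `τ n` on `∂K` equal to
a polynomial (vector) of degree at most `k` on each edge. -/
def IsLocalStress (k : ℕ) (K : SimplePolygon) (τ : Pt → Ten) : Prop :=
  MemLp τ 2 (volume.restrict K.carrier) ∧
  (∃ c : Fin 2 → MvPolynomial (Fin 2) ℝ, (∀ i, (c i).totalDegree ≤ k - 1) ∧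
    IsWeakCurl K.carrier τ (polyField c)) ∧
  ∃ f : Fin 2 → MvPolynomial (Fin 2) ℝ, (∀ i, (f i).totalDegree ≤ k) ∧
    IsWeakDiv K.carrier τ (polyField f) ∧
    ∃ q : Fin K.n → Fin 2 → MvPolynomial (Fin 2) ℝ, (∀ e i, (q e i).totalDegree ≤ k) ∧
      ∀ φ : Pt → ℝ, IsTest φ → ∀ i : Fin 2,
        normalPairing K.carrier τ (polyField f) φ i =
          ∑ e : Fin K.n, K.edgeIntegral e (fun x => polyEval (q e i) x * φ x)

variable {Ω : Set Pt}

/-- The global virtual space `S_h`. -/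
def stressSpace (k : ℕ) (T : PolygonalMesh Ω) (Γσ : Set Pt) : Set (L2Ten Ω) :=
  {τ | τ ∈ HDivStar Ω Γσ ∧ ∀ K, IsLocalStress k (T.cell K) τ}

/-- The space `V_h` of piecewise polynomial vector fields of degree at most `k`. -/
def velocitySpace (k : ℕ) (T : PolygonalMesh Ω) : Set (L2Vec Ω) :=
  {v | ∀ K, ∃ p : Fin 2 → MvPolynomial (Fin 2) ℝ, (∀ i, (p i).totalDegree ≤ k) ∧
    ∀ᵐ x ∂(volume.restrict (T.cell K).carrier), ∀ i, v x i = polyEval (p i) x}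

/-- The space `K_h` of piecewise polynomial skew tensor fields of degree at most `k`. -/
def rotationSpace (k : ℕ) (T : PolygonalMesh Ω) : Set (L2Ten Ω) :=
  {η | η ∈ L2Skew Ω ∧
    ∀ K, ∃ p : Fin 2 × Fin 2 → MvPolynomial (Fin 2) ℝ, (∀ i, (p i).totalDegree ≤ k) ∧
      ∀ᵐ x ∂(volume.restrict (T.cell K).carrier), ∀ i, η x i = polyEval (p i) x}

/-- `(σ₀π, σ₁π, uπ, rπ)` solves the weakly symmetric elliptic projection system with data
`(σ₀, σ₁, u, r)`. -/
structure IsProjection (k : ℕ) (T : PolygonalMesh Ω) (Γσ : Set Pt)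
    (σ₀ σ₁ : L2Ten Ω) (u : L2Vec Ω) (r : L2Ten Ω)
    (σ₀π σ₁π : L2Ten Ω) (uπ : L2Vec Ω) (rπ : L2Ten Ω) : Prop where
  mem_stress₀ : σ₀π ∈ stressSpace k T Γσ
  mem_stress₁ : σ₁π ∈ stressSpace k T Γσ
  mem_velocity : uπ ∈ velocitySpace k T
  mem_rotation : rπ ∈ rotationSpace k T
  eq₀ : ∀ τ ∈ stressSpace k T Γσ,
    inner ℝ (σ₀π - σ₀) τ + inner ℝ (divergence τ) (uπ - u) + inner ℝ τ (rπ - r) = 0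
  eq₁ : ∀ τ ∈ stressSpace k T Γσ,
    inner ℝ (σ₁π - σ₁) τ + inner ℝ (divergence τ) (uπ - u) + inner ℝ τ (rπ - r) = 0
  eq_div : ∀ w ∈ velocitySpace k T, inner ℝ (divergence (σ₀π + σ₁π - σ₀ - σ₁)) w = 0
  eq_skew : ∀ η ∈ rotationSpace k T, inner ℝ (σ₀π + σ₁π - σ₀ - σ₁) η = 0

end WeakSymVEM

end

/-!
By the Riesz representation theorem on the closed space `S_h`, each of the two stress equations
expresses its stress through the multipliers `(u_π, r_π)`. Inserting this into the two constraints
leaves a square linear system for the multipliers, whose matrix is the Gram matrix of the map which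
sends a pair `(v, η)` in the finite-dimensional space `V_h × K_h` to the representative in `S_h` of
`τ ↦ (div τ, v) + (τ, η)`. So everything rests on the injectivity of this map.

Let `(div τ, v) + (τ, η) = 0` for all `τ` in `S_h`. On a cell, which is star-shaped with respect to
a ball, Poincaré and trace inequalities yield by duality fields with prescribed curl, with
prescribed divergence, and with prescribed normal traces. Testing first with divergence free fields
of vanishing normal trace and prescribed curl shows that the rotation `η` is constant on the cell,
then testing with fields of prescribed divergence shows that `v` is a rigid motion on the cell whose
rotation is `η`. Testing with normal traces on single edges shows that the rigid motions of
neighbouring cells agree on their common edge, hence everywhere, and vanish on the edges in the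
closure of `Γu`. Since the vertices of the mesh do not disconnect `Ω`, any two cells are joined by a
chain of neighbours, so `v` and `η` vanish.
-/

noncomputable section

namespace WeakSymVEM

/-! ### Gradients and rotated gradients of test functions -/

/-- The gradient `(∂φ/∂x_0, ∂φ/∂x_1)`. -/
def grad (φ : Pt → ℝ) (x : Pt) : Pt := WithLp.toLp 2 fun j => pderiv j φ x

/-- The rotated gradient `(-∂φ/∂x_1, ∂φ/∂x_0)`; pairing a row of a tensor field with it gives the
weak curl of that row, with the sign convention of `IsWeakCurl`. -/
def rot (φ : Pt → ℝ) (x : Pt) : Pt := !₂[-pderiv 1 φ x, pderiv 0 φ x]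

theorem inner_grad (v : Pt) (φ : Pt → ℝ) (x : Pt) :
    inner ℝ v (grad φ x) = ∑ j : Fin 2, v j * pderiv j φ x := by
  simp [grad, PiLp.inner_apply, mul_comm]

theorem inner_rot (v : Pt) (φ : Pt → ℝ) (x : Pt) :
    inner ℝ v (rot φ x) = v 1 * pderiv 0 φ x - v 0 * pderiv 1 φ x := by
  simp only [rot, PiLp.inner_apply, Fin.sum_univ_two, RCLike.inner_apply, conj_trivial,
    Matrix.cons_val_zero, Matrix.cons_val_one]
  ring

theorem inner_rot_grad (φ ψ : Pt → ℝ) (x : Pt) :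
    inner ℝ (rot φ x) (grad ψ x) = pderiv 0 φ x * pderiv 1 ψ x - pderiv 1 φ x * pderiv 0 ψ x := by
  rw [real_inner_comm, inner_rot]
  simp only [grad]
  ring

theorem inner_grad_left (v : Pt) (φ : Pt → ℝ) (x : Pt) :
    inner ℝ (grad φ x) v = fderiv ℝ φ x v := by
  have hv : v = ∑ j : Fin 2, v j • EuclideanSpace.single j (1 : ℝ) := by
    ext i; fin_cases i <;> simp [Fin.sum_univ_two]
  rw [real_inner_comm, inner_grad]
  conv_rhs => rw [hv]
  simp [pderiv]

theorem norm_grad (φ : Pt → ℝ) (x : Pt) : ‖grad φ x‖ = ‖fderiv ℝ φ x‖ := by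
  have hfderiv : fderiv ℝ φ x = innerSL ℝ (grad φ x) := by
    ext v; simp [inner_grad_left]
  rw [hfderiv, innerSL_apply_norm]

/-- The space of test functions on the plane. -/
def testSpace : Submodule ℝ (Pt → ℝ) where
  carrier := {φ | IsTest φ}
  add_mem' := fun h h' => ⟨h.1.add h'.1, h.2.add h'.2⟩
  zero_mem' := ⟨contDiff_const, HasCompactSupport.zero⟩
  smul_mem' := fun c φ h =>
    ⟨h.1.const_smul c, h.2.mono (Function.support_const_smul_subset c φ)⟩

/-- The space of test functions supported in `U`. -/
def testSpaceIn (U : Set Pt) : Submodule ℝ (Pt → ℝ) where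
  carrier := {φ | IsTest φ ∧ tsupport φ ⊆ U}
  add_mem' := fun h h' =>
    ⟨testSpace.add_mem h.1 h'.1, (tsupport_add _ _).trans (union_subset h.2 h'.2)⟩
  zero_mem' := ⟨testSpace.zero_mem, by simp⟩
  smul_mem' := fun c φ h => ⟨testSpace.smul_mem c h.1,
    (closure_mono (Function.support_const_smul_subset c φ)).trans h.2⟩

section Smooth

variable {φ ψ : Pt → ℝ}

theorem contDiff_pderiv (h : ContDiff ℝ ∞ φ) (j : Fin 2) : ContDiff ℝ ∞ (pderiv j φ) :=
  (h.fderiv_right (m := ∞) (by simp)).clm_apply contDiff_const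

theorem pderiv_add (h : ContDiff ℝ ∞ φ) (h' : ContDiff ℝ ∞ ψ) (j : Fin 2) (x : Pt) :
    pderiv j (φ + ψ) x = pderiv j φ x + pderiv j ψ x := by
  simp [pderiv, fderiv_add (h.differentiable (by simp) x) (h'.differentiable (by simp) x)]

theorem pderiv_const_smul (h : ContDiff ℝ ∞ φ) (c : ℝ) (j : Fin 2) (x : Pt) :
    pderiv j (c • φ) x = c * pderiv j φ x := by
  simp [pderiv, fderiv_const_smul (h.differentiable (by simp) x)]

theorem grad_add (h : ContDiff ℝ ∞ φ) (h' : ContDiff ℝ ∞ ψ) : grad (φ + ψ) = grad φ + grad ψ := by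
  ext x i; simp [grad, pderiv_add h h']

theorem grad_const_smul (h : ContDiff ℝ ∞ φ) (c : ℝ) : grad (c • φ) = c • grad φ := by
  ext x i; simp [grad, pderiv_const_smul h]

theorem rot_add (h : ContDiff ℝ ∞ φ) (h' : ContDiff ℝ ∞ ψ) : rot (φ + ψ) = rot φ + rot ψ := by
  ext x i
  fin_cases i
  · simp [rot, pderiv_add h h', add_comm]
  · simp [rot, pderiv_add h h']

theorem rot_const_smul (h : ContDiff ℝ ∞ φ) (c : ℝ) : rot (c • φ) = c • rot φ := by
  ext x i; fin_cases i <;> simp [rot, pderiv_const_smul h]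

theorem continuous_grad (h : ContDiff ℝ ∞ φ) : Continuous (grad φ) := by
  have hd := fun j => (contDiff_pderiv h j).continuous
  unfold grad
  fun_prop

theorem continuous_rot (h : ContDiff ℝ ∞ φ) : Continuous (rot φ) := by
  refine (PiLp.continuous_toLp 2 _).comp (continuous_pi fun i => ?_)
  fin_cases i
  · exact (contDiff_pderiv h 1).continuous.neg
  · exact (contDiff_pderiv h 0).continuous

theorem pderiv_eq_zero_of_notMem {x : Pt} (h : x ∉ tsupport φ) (j : Fin 2) :
    pderiv j φ x = 0 := by
  simp [pderiv, fderiv_of_notMem_tsupport ℝ h]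

theorem grad_eq_zero_of_notMem {x : Pt} (h : x ∉ tsupport φ) : grad φ x = 0 := by
  ext i; simp [grad, pderiv_eq_zero_of_notMem h]

theorem rot_eq_zero_of_notMem {x : Pt} (h : x ∉ tsupport φ) : rot φ x = 0 := by
  ext i; fin_cases i <;> simp [rot, pderiv_eq_zero_of_notMem h]

theorem pderiv_pderiv_comm (h : ContDiff ℝ ∞ φ) (i j : Fin 2) (x : Pt) :
    pderiv i (pderiv j φ) x = pderiv j (pderiv i φ) x := by
  have hfderiv : DifferentiableAt ℝ (fderiv ℝ φ) x :=
    (h.fderiv_right (m := ∞) (by simp)).differentiable (by simp) x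
  have hsecond : ∀ i j : Fin 2, pderiv i (pderiv j φ) x =
      fderiv ℝ (fderiv ℝ φ) x (EuclideanSpace.single i 1) (EuclideanSpace.single j 1) := by
    intro i j
    unfold pderiv
    rw [fderiv_clm_apply hfderiv (differentiableAt_const _)]
    simp
  rw [hsecond, hsecond]
  exact (h.contDiffAt.isSymmSndFDerivAt (by
    simpa using WithTop.coe_le_coe.2 (le_top : (2 : ℕ∞) ≤ ⊤))) _ _

namespace IsTest

theorem pderiv (h : IsTest φ) (j : Fin 2) : IsTest (pderiv j φ) :=
  ⟨contDiff_pderiv h.1 j, h.2.fderiv_apply (𝕜 := ℝ) (EuclideanSpace.single j 1)⟩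

theorem integrable_mul (h : IsTest φ) (hψ : Continuous ψ) : Integrable fun x => φ x * ψ x :=
  (h.1.continuous.mul hψ).integrable_of_hasCompactSupport h.2.mul_right

theorem memLp (h : IsTest φ) : MemLp φ 2 volume :=
  h.1.continuous.memLp_of_hasCompactSupport h.2

theorem memLp_grad (h : IsTest φ) : MemLp (grad φ) 2 volume :=
  (continuous_grad h.1).memLp_of_hasCompactSupport
    (h.2.mono' fun _ => not_imp_comm.1 grad_eq_zero_of_notMem)

theorem memLp_rot (h : IsTest φ) : MemLp (rot φ) 2 volume :=
  (continuous_rot h.1).memLp_of_hasCompactSupport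
    (h.2.mono' fun _ => not_imp_comm.1 rot_eq_zero_of_notMem)

end IsTest

theorem integral_mul_pderiv (hφ : IsTest φ) (hψ : ContDiff ℝ ∞ ψ) (j : Fin 2) :
    ∫ x, φ x * pderiv j ψ x = -∫ x, pderiv j φ x * ψ x :=
  integral_mul_fderiv_eq_neg_fderiv_mul_of_integrable
    ((hφ.pderiv j).integrable_mul hψ.continuous)
    (hφ.integrable_mul (contDiff_pderiv hψ j).continuous)
    (hφ.integrable_mul hψ.continuous)
    (fun x _ => hφ.1.differentiable (by simp) x) (fun x _ => hψ.differentiable (by simp) x)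

theorem integral_inner_rot_grad (hφ : IsTest φ) (hψ : ContDiff ℝ ∞ ψ) :
    ∫ x, inner ℝ (rot φ x) (grad ψ x) = 0 := by
  have hψ' := contDiff_pderiv hψ
  have h01 := integral_mul_pderiv hφ (hψ' 1) 0
  have h10 := integral_mul_pderiv hφ (hψ' 0) 1
  simp_rw [pderiv_pderiv_comm hψ 0 1] at h01
  simp_rw [inner_rot_grad]
  rw [integral_sub ((hφ.pderiv 0).integrable_mul (hψ' 1).continuous)
    ((hφ.pderiv 1).integrable_mul (hψ' 0).continuous)]
  linarith

theorem setIntegral_inner_rot_grad {U : Set Pt} (hφ : IsTest φ) (hU : tsupport φ ⊆ U)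
    (hψ : ContDiff ℝ ∞ ψ) : ∫ x in U, inner ℝ (rot φ x) (grad ψ x) = 0 := by
  rw [← integral_inner_rot_grad hφ hψ]
  refine setIntegral_eq_integral_of_forall_compl_eq_zero fun x hx => ?_
  rw [rot_eq_zero_of_notMem (fun h => hx (hU h)), inner_zero_left]

end Smooth

section Bounded

variable {X F : Type*} [PseudoMetricSpace X] [ProperSpace X] [MeasurableSpace X]
  [BorelSpace X] {μ : Measure X} [IsFiniteMeasureOnCompacts μ] [NormedAddCommGroup F] {K : Set X}
  {f : X → F}

theorem memLp_restrict_of_isBounded (hK : Bornology.IsBounded K) (h : Continuous f) (p : ℝ≥0∞) :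
    MemLp f p (μ.restrict K) := by
  have hc : IsCompact (closure K) := hK.isCompact_closure
  obtain ⟨C, hC⟩ := hc.exists_bound_of_continuousOn h.continuousOn
  have : IsFiniteMeasure (μ.restrict (closure K)) := ⟨by simpa using hc.measure_lt_top⟩
  have hcl : MemLp f p (μ.restrict (closure K)) :=
    MemLp.of_bound h.aestronglyMeasurable C
      ((ae_restrict_iff' isClosed_closure.measurableSet).2 (Filter.Eventually.of_forall hC))
  exact hcl.mono_measure (Measure.restrict_mono subset_closure le_rfl)

theorem integrableOn_of_isBounded (hK : Bornology.IsBounded K) (h : Continuous f) :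
    IntegrableOn f K μ :=
  memLp_one_iff_integrable.1 (memLp_restrict_of_isBounded hK h 1)

end Bounded

theorem inner_L2_eq_integral {α E : Type*} [MeasurableSpace α] {μ : Measure α}
    [NormedAddCommGroup E] [InnerProductSpace ℝ E] (f g : Lp E 2 μ) {f' g' : α → E}
    (hf : f =ᵐ[μ] f') (hg : g =ᵐ[μ] g') : inner ℝ f g = ∫ x, inner ℝ (f' x) (g' x) ∂μ := by
  rw [L2.inner_def]
  refine integral_congr_ae ?_
  filter_upwards [hf, hg] with x hfx hgx
  rw [hfx, hgx]

section L2

variable {U : Set Pt}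

/-- The gradients of test functions, as elements of `L²(U)`. -/
def gradL2 (U : Set Pt) : testSpace →ₗ[ℝ] L2Vec U where
  toFun φ := (φ.2.memLp_grad.restrict U).toLp
  map_add' φ ψ := by
    rw [← MemLp.toLp_add]; congr 1; exact grad_add φ.2.1 ψ.2.1
  map_smul' c φ := by
    rw [RingHom.id_apply, ← MemLp.toLp_const_smul]; congr 1; exact grad_const_smul φ.2.1 c

/-- The rotated gradients of test functions supported in `U`, as elements of `L²(U)`. -/
def rotL2 (U : Set Pt) : testSpaceIn U →ₗ[ℝ] L2Vec U where
  toFun φ := (φ.2.1.memLp_rot.restrict U).toLp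
  map_add' φ ψ := by
    rw [← MemLp.toLp_add]; congr 1; exact rot_add φ.2.1.1 ψ.2.1.1
  map_smul' c φ := by
    rw [RingHom.id_apply, ← MemLp.toLp_const_smul]; congr 1; exact rot_const_smul φ.2.1.1 c

theorem coeFn_gradL2 (φ : testSpace) : gradL2 U φ =ᵐ[volume.restrict U] grad φ :=
  (φ.2.memLp_grad.restrict U).coeFn_toLp

theorem coeFn_rotL2 (φ : testSpaceIn U) : rotL2 U φ =ᵐ[volume.restrict U] rot φ :=
  (φ.2.1.memLp_rot.restrict U).coeFn_toLp

theorem inner_gradL2 (t : L2Vec U) (φ : testSpace) :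
    inner ℝ t (gradL2 U φ) = ∫ x in U, inner ℝ (t x) (grad φ x) :=
  inner_L2_eq_integral _ _ (Filter.EventuallyEq.refl _ _) (coeFn_gradL2 φ)

theorem inner_rotL2 (t : L2Vec U) (φ : testSpaceIn U) :
    inner ℝ t (rotL2 U φ) = ∫ x in U, inner ℝ (t x) (rot φ x) :=
  inner_L2_eq_integral _ _ (Filter.EventuallyEq.refl _ _) (coeFn_rotL2 φ)

theorem inner_rotL2_gradL2 (φ : testSpaceIn U) (ψ : testSpace) :
    inner ℝ (rotL2 U φ) (gradL2 U ψ) = 0 := by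
  rw [← setIntegral_inner_rot_grad φ.2.1 φ.2.2 ψ.2.1]
  exact inner_L2_eq_integral _ _ (coeFn_rotL2 φ) (coeFn_gradL2 ψ)

end L2

/-! ### Fields with prescribed divergence or curl -/

theorem exists_mem_closure_range_inner_eq {V H : Type*} [AddCommGroup V] [Module ℝ V]
    [NormedAddCommGroup H] [InnerProductSpace ℝ H] [CompleteSpace H]
    (G : V →ₗ[ℝ] H) (L : V →ₗ[ℝ] ℝ) (C : ℝ) (hL : ∀ v, |L v| ≤ C * ‖G v‖) :
    ∃ t ∈ (LinearMap.range G).topologicalClosure, ∀ v, inner ℝ t (G v) = L v := by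
  set M := (LinearMap.range G).topologicalClosure
  have : CompleteSpace M := (LinearMap.range G).isClosed_topologicalClosure.completeSpace_coe
  obtain ⟨s, hs⟩ := G.rangeRestrict.exists_rightInverse_of_surjective G.range_rangeRestrict
  have hGs : ∀ y, G (s y) = y := fun y => congrArg Subtype.val (LinearMap.congr_fun hs y)
  let l : StrongDual ℝ (LinearMap.range G) := (L.comp s).mkContinuous C fun y =>
    (hL (s y)).trans_eq (by rw [hGs]; rfl)
  have hl : ∀ v, l ⟨G v, v, rfl⟩ = L v := by
    intro v
    have hbound := hL (s ⟨G v, v, rfl⟩ - v)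
    rw [map_sub, map_sub, hGs, sub_self, norm_zero, mul_zero] at hbound
    exact sub_eq_zero.1 (abs_nonpos_iff.1 hbound)
  obtain ⟨g, hg, -⟩ := exists_extension_norm_eq _ l
  refine ⟨(InnerProductSpace.toDual ℝ M).symm (g.comp M.subtypeL), SetLike.coe_mem _,
    fun v => ?_⟩
  have hGv : G v ∈ M := (LinearMap.range G).le_topologicalClosure ⟨v, rfl⟩
  have hriesz := InnerProductSpace.toDual_symm_apply (x := (⟨G v, hGv⟩ : M))
    (y := g.comp M.subtypeL)
  exact hriesz.trans ((hg ⟨G v, v, rfl⟩).trans (hl v))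

theorem inner_eq_zero_of_mem_closure_range {V H : Type*} [AddCommGroup V] [Module ℝ V]
    [NormedAddCommGroup H] [InnerProductSpace ℝ H] {G : V →ₗ[ℝ] H} {t w : H}
    (ht : t ∈ (LinearMap.range G).topologicalClosure) (h : ∀ v, inner ℝ (G v) w = 0) :
    inner ℝ t w = 0 := by
  have hle : (LinearMap.range G).topologicalClosure ≤ (ℝ ∙ w)ᗮ := by
    refine Submodule.topologicalClosure_minimal _ ?_ (Submodule.isClosed_orthogonal _)
    rintro _ ⟨v, rfl⟩
    exact Submodule.mem_orthogonal_singleton_iff_inner_left.2 (h v)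
  exact Submodule.mem_orthogonal_singleton_iff_inner_left.1 (hle ht)

theorem exists_curlFree_field {U : Set Pt} (L : testSpace →ₗ[ℝ] ℝ) (C : ℝ)
    (hL : ∀ φ, |L φ| ≤ C * ‖gradL2 U φ‖) :
    ∃ t : L2Vec U, (∀ φ : testSpace, ∫ x in U, inner ℝ (t x) (grad φ x) = L φ) ∧
      ∀ φ : testSpaceIn U, ∫ x in U, inner ℝ (t x) (rot φ x) = 0 := by
  obtain ⟨t, ht, hrepr⟩ := exists_mem_closure_range_inner_eq (gradL2 U) L C hL
  refine ⟨t, fun φ => by rw [← inner_gradL2, hrepr], fun φ => ?_⟩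
  rw [← inner_rotL2]
  refine inner_eq_zero_of_mem_closure_range ht fun ψ => ?_
  rw [real_inner_comm, inner_rotL2_gradL2]

/-- The field is the projection of `w` to the rotated gradients: it keeps the curl of `w`, and has
no divergence and no normal trace. -/
theorem exists_divFree_field {U : Set Pt} (w : L2Vec U) :
    ∃ t : L2Vec U, (∀ φ : testSpace, ∫ x in U, inner ℝ (t x) (grad φ x) = 0) ∧
      (∀ φ : testSpaceIn U,
        ∫ x in U, inner ℝ (t x) (rot φ x) = ∫ x in U, inner ℝ (w x) (rot φ x)) ∧
      inner ℝ t w = ‖t‖ ^ 2 := by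
  set M := (LinearMap.range (rotL2 U)).topologicalClosure
  have : CompleteSpace M :=
    (LinearMap.range (rotL2 U)).isClosed_topologicalClosure.completeSpace_coe
  have hproj : ∀ m ∈ M, inner ℝ w m = inner ℝ (M.starProjection w) m := fun m hm => by
    rw [← sub_eq_zero, ← inner_sub_left, Submodule.starProjection_inner_eq_zero w m hm]
  have ht := M.starProjection_apply_mem w
  refine ⟨M.starProjection w, fun φ => ?_, fun φ => ?_, ?_⟩
  · rw [← inner_gradL2]
    exact inner_eq_zero_of_mem_closure_range ht fun ψ => inner_rotL2_gradL2 ψ φ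
  · rw [← inner_rotL2, ← inner_rotL2]
    exact (hproj _ ((LinearMap.range (rotL2 U)).le_topologicalClosure ⟨φ, rfl⟩)).symm
  · rw [real_inner_comm, hproj _ ht, real_inner_self_eq_norm_sq]

/-! ### Star-shaped sets and their edges -/

/-- `K` is open and star-shaped with respect to each point of a ball with centre `c`: the part of
shape regularity on which the local arguments rest. The radius is not recorded. -/
structure IsStarAbout {E : Type*} [NormedAddCommGroup E] [NormedSpace ℝ E] (K : Set E) (c : E) :
    Prop where
  isOpen : IsOpen K
  exists_ball : ∃ r > 0, ∀ y ∈ Metric.ball c r, StarConvex ℝ y K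

theorem IsStarAbout.add_smul_sub_mem {E : Type*} [NormedAddCommGroup E] [NormedSpace ℝ E]
    {K : Set E} {c x : E} (h : IsStarAbout K c) (hx : x ∈ closure K) {s : ℝ} (h0 : 0 ≤ s)
    (h1 : s < 1) : c + s • (x - c) ∈ K := by
  obtain ⟨r, hr, hK⟩ := h.exists_ball
  have hs : 0 < 1 - s := sub_pos.2 h1
  obtain ⟨x', hx', hd⟩ := Metric.mem_closure_iff.1 hx (r * (1 - s)) (by positivity)
  -- The segment from a point of the ball to a nearby `x' ∈ K` passes through the given point.
  have hball : c + (s / (1 - s)) • (x - x') ∈ Metric.ball c r := by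
    rw [dist_eq_norm] at hd
    rw [mem_ball_iff_norm, add_sub_cancel_left, norm_smul, Real.norm_of_nonneg (by positivity),
      div_mul_eq_mul_div, div_lt_iff₀ hs]
    nlinarith [norm_nonneg (x - x')]
  convert hK _ hball hx' hs.le h0 (by ring) using 1
  rw [smul_add, smul_smul, mul_div_cancel₀ _ hs.ne']
  module

/-- The determinant of `Q - P` and `y - P`: twice the signed area of the triangle with vertices
`P`, `Q`, `y`. Its sign tells on which side of the line through `P` and `Q` the point `y` lies. -/
def side (P Q y : Pt) : ℝ := (Q 0 - P 0) * (y 1 - P 1) - (Q 1 - P 1) * (y 0 - P 0)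

/-- The coordinate along the line through `P` and `Q`, with `P` at `0` and `Q` at `1`, of the
orthogonal projection of `y`. -/
def lineCoord (P Q y : Pt) : ℝ :=
  ((y 0 - P 0) * (Q 0 - P 0) + (y 1 - P 1) * (Q 1 - P 1)) /
    ((Q 0 - P 0) ^ 2 + (Q 1 - P 1) ^ 2)

section Side

variable {P Q x y : Pt}

theorem continuous_side (P Q : Pt) : Continuous (side P Q) := by
  unfold side; fun_prop

theorem continuous_lineCoord (P Q : Pt) : Continuous (lineCoord P Q) := by
  unfold lineCoord; exact Continuous.div_const (by fun_prop) _

theorem lineMap_apply_coord (P Q : Pt) (t : ℝ) (i : Fin 2) :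
    AffineMap.lineMap P Q t i = P i + t * (Q i - P i) := by
  simp [AffineMap.lineMap_apply_module', add_comm]

theorem side_apply_lineMap (P Q x y : Pt) (t : ℝ) :
    side P Q (AffineMap.lineMap x y t) = (1 - t) * side P Q x + t * side P Q y := by
  simp only [side, lineMap_apply_coord]; ring

theorem side_lineMap (P Q : Pt) (t : ℝ) : side P Q (AffineMap.lineMap P Q t) = 0 := by
  simp only [side, lineMap_apply_coord]; ring

theorem sq_add_sq_ne_zero (h : P ≠ Q) : (Q 0 - P 0) ^ 2 + (Q 1 - P 1) ^ 2 ≠ 0 := by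
  have hnorm : ‖Q - P‖ ^ 2 ≠ 0 := pow_ne_zero 2 (norm_ne_zero_iff.2 (sub_ne_zero.2 h.symm))
  simpa [EuclideanSpace.norm_sq_eq, Fin.sum_univ_two] using hnorm

theorem lineCoord_lineMap (h : P ≠ Q) (t : ℝ) :
    lineCoord P Q (AffineMap.lineMap P Q t) = t := by
  have hpos := sq_add_sq_ne_zero h
  simp only [lineCoord, lineMap_apply_coord]
  field_simp
  ring

theorem lineMap_lineCoord (h : P ≠ Q) (hy : side P Q y = 0) :
    AffineMap.lineMap P Q (lineCoord P Q y) = y := by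
  have hpos := sq_add_sq_ne_zero h
  unfold side at hy
  ext i
  rw [lineMap_apply_coord, lineCoord]
  fin_cases i
  · simp only [Fin.zero_eta]
    field_simp
    linear_combination (Q 1 - P 1) * hy
  · simp only [Fin.mk_one]
    field_simp
    linear_combination (-(Q 0 - P 0)) * hy

theorem side_eq_zero_of_mem_segment (hx : x ∈ segment ℝ P Q) : side P Q x = 0 := by
  rw [segment_eq_image_lineMap] at hx
  obtain ⟨t, -, rfl⟩ := hx
  exact side_lineMap P Q t

open Filter Topology in
theorem eventually_mem_segment (h : P ≠ Q) (hx : x ∈ openSegment ℝ P Q) :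
    ∀ᶠ y in 𝓝 x, side P Q y = 0 → y ∈ segment ℝ P Q := by
  have hcoord : ∀ᶠ y in 𝓝 x, lineCoord P Q y ∈ Ioo (0 : ℝ) 1 := by
    rw [openSegment_eq_image_lineMap] at hx
    obtain ⟨t, ht, rfl⟩ := hx
    refine (continuous_lineCoord P Q).continuousAt.eventually_mem ?_
    rw [lineCoord_lineMap h]
    exact isOpen_Ioo.mem_nhds ht
  filter_upwards [hcoord] with y hy hside
  rw [← lineMap_lineCoord h hside, segment_eq_image_lineMap]
  exact ⟨_, Ioo_subset_Icc_self hy, rfl⟩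

theorem linearIndependent_of_side_ne_zero {c : Pt} (h : side P Q c ≠ 0) :
    LinearIndependent ℝ ![P - c, Q - c] := by
  rw [LinearIndependent.pair_iff]
  intro a b hab
  have h0 := congrArg (fun v : Pt => v 0) hab
  have h1 := congrArg (fun v : Pt => v 1) hab
  simp only [PiLp.add_apply, PiLp.smul_apply, PiLp.sub_apply, PiLp.zero_apply, smul_eq_mul]
    at h0 h1
  have ha : a * side P Q c = 0 := by
    unfold side; linear_combination (Q 1 - c 1) * h0 - (Q 0 - c 0) * h1
  have hb : b * side P Q c = 0 := by
    unfold side; linear_combination (P 0 - c 0) * h1 - (P 1 - c 1) * h0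
  exact ⟨(mul_eq_zero.1 ha).resolve_right h, (mul_eq_zero.1 hb).resolve_right h⟩

end Side

namespace IsStarAbout

open Filter Topology

variable {K L : Set Pt} {c c' P Q x : Pt}

theorem side_ne_zero (h : IsStarAbout K c) (hPQ : P ≠ Q) (he : segment ℝ P Q ⊆ frontier K) :
    side P Q c ≠ 0 := by
  intro h0
  have hnot : ∀ y ∈ segment ℝ P Q, y ∉ K := fun y hy hyK =>
    (h.isOpen.inter_frontier_eq ▸ (⟨hyK, he hy⟩ : y ∈ K ∩ frontier K) : y ∈ (∅ : Set Pt))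
  have hP := left_mem_segment ℝ P Q
  have hQ := right_mem_segment ℝ P Q
  obtain ⟨t, hc⟩ : ∃ t : ℝ, c = AffineMap.lineMap P Q t := ⟨_, (lineMap_lineCoord hPQ h0).symm⟩
  rcases lt_or_ge t 0 with ht | ht
  · have hpos : 0 < 1 - t := by linarith
    refine hnot P hP ?_
    convert h.add_smul_sub_mem (frontier_subset_closure (he hQ)) (s := -t / (1 - t))
      (div_nonneg (by linarith) hpos.le) ((div_lt_one hpos).2 (by linarith)) using 1
    ext i
    simp only [hc, PiLp.add_apply, PiLp.smul_apply, PiLp.sub_apply, lineMap_apply_coord,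
      smul_eq_mul]
    field_simp
    ring
  rcases le_or_gt t 1 with ht1 | ht1
  · refine hnot c (segment_eq_image_lineMap ℝ P Q ▸ ⟨t, ⟨ht, ht1⟩, hc.symm⟩) ?_
    simpa using h.add_smul_sub_mem (frontier_subset_closure (he hP)) le_rfl zero_lt_one
  · have hpos : 0 < t := by linarith
    refine hnot Q hQ ?_
    convert h.add_smul_sub_mem (frontier_subset_closure (he hP)) (s := (t - 1) / t)
      (div_nonneg (by linarith) hpos.le) ((div_lt_one hpos).2 (by linarith)) using 1
    ext i
    simp only [hc, PiLp.add_apply, PiLp.smul_apply, PiLp.sub_apply, lineMap_apply_coord,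
      smul_eq_mul]
    field_simp
    ring

theorem eventually_mem (h : IsStarAbout K c) (hPQ : P ≠ Q) (he : segment ℝ P Q ⊆ frontier K)
    (hx : x ∈ openSegment ℝ P Q) : ∀ᶠ y in 𝓝 x, 0 < side P Q y / side P Q c → y ∈ K := by
  have hδ := h.side_ne_zero hPQ he
  -- The line from `c` through `y` meets the line of the edge at `z y`, and `y = c + s y (z y - c)`.
  let s : Pt → ℝ := fun y => 1 - side P Q y / side P Q c
  let z : Pt → Pt := fun y => AffineMap.lineMap c y (s y)⁻¹
  have hsx : s x = 1 := by
    simp [s, side_eq_zero_of_mem_segment (openSegment_subset_segment ℝ P Q hx)]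
  have hs : ContinuousAt s x :=
    (continuous_const.sub ((continuous_side P Q).div_const _)).continuousAt
  have hz : ContinuousAt z x := by
    simp only [z, AffineMap.lineMap_apply_module']
    exact ((hs.inv₀ (by rw [hsx]; exact one_ne_zero)).smul
      (continuousAt_id.sub continuousAt_const)).add continuousAt_const
  have hzx : z x = x := by simp [z, hsx]
  have hs_pos : ∀ᶠ y in 𝓝 x, 0 < s y :=
    hs.eventually_mem (isOpen_Ioi.mem_nhds (by rw [hsx]; exact mem_Ioi.2 one_pos))
  have hz_mem := hz.tendsto.eventually (hzx.symm ▸ eventually_mem_segment hPQ hx)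
  filter_upwards [hs_pos, hz_mem] with y hy hzy hpos
  have hzside : side P Q (z y) = 0 := by
    have hsy : side P Q y = (1 - s y) * side P Q c := by simp only [s]; field_simp; ring
    rw [side_apply_lineMap, hsy]
    field_simp
    ring
  have hzK := frontier_subset_closure (he (hzy hzside))
  convert h.add_smul_sub_mem hzK hy.le (sub_lt_self _ hpos) using 1
  simp [z, AffineMap.lineMap_apply, smul_smul, mul_inv_cancel₀ hy.ne']

theorem side_div_side_neg (hK : IsStarAbout K c) (hL : IsStarAbout L c')
    (hd : Disjoint K L) (hPQ : P ≠ Q) (heK : segment ℝ P Q ⊆ frontier K)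
    (heL : segment ℝ P Q ⊆ frontier L) (hx : x ∈ openSegment ℝ P Q) :
    side P Q c / side P Q c' < 0 := by
  have hc := hK.side_ne_zero hPQ heK
  by_contra! hge
  have hsame : 0 < side P Q c / side P Q c' :=
    lt_of_le_of_ne hge (div_ne_zero hc (hL.side_ne_zero hPQ heL)).symm
  have htendsto : Tendsto (fun ε : ℝ => AffineMap.lineMap x c ε) (𝓝[>] 0) (𝓝 x) := by
    have hcont := (AffineMap.lineMap_continuous (p := x) (q := c) (R := ℝ)).tendsto 0
    rw [AffineMap.lineMap_apply_zero] at hcont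
    exact hcont.mono_left nhdsWithin_le_nhds
  obtain ⟨ε, hεK, hεL, hε⟩ := ((htendsto.eventually (hK.eventually_mem hPQ heK hx)).and
    ((htendsto.eventually (hL.eventually_mem hPQ heL hx)).and self_mem_nhdsWithin)).exists
  have hside : side P Q (AffineMap.lineMap x c ε) = ε * side P Q c := by
    rw [side_apply_lineMap,
      side_eq_zero_of_mem_segment (openSegment_subset_segment ℝ P Q hx), mul_zero, zero_add]
  rw [hside, mul_div_assoc] at hεK hεL
  rw [div_self hc, mul_one] at hεK
  exact disjoint_left.1 hd (hεK hε) (hεL (mul_pos hε hsame))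

theorem eventually_mem_closure_union (hK : IsStarAbout K c) (hL : IsStarAbout L c')
    (hd : Disjoint K L) (hPQ : P ≠ Q) (heK : segment ℝ P Q ⊆ frontier K)
    (heL : segment ℝ P Q ⊆ frontier L) (hx : x ∈ openSegment ℝ P Q) :
    ∀ᶠ y in 𝓝 x, y ∈ closure K ∪ closure L := by
  have hopp := hK.side_div_side_neg hL hd hPQ heK heL hx
  filter_upwards [hK.eventually_mem hPQ heK hx, hL.eventually_mem hPQ heL hx,
    eventually_mem_segment hPQ hx] with y hyK hyL hyPQ
  rcases lt_trichotomy (side P Q y / side P Q c) 0 with hneg | hzero | hpos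
  · refine Or.inr (subset_closure (hyL ?_))
    rw [← div_mul_div_cancel₀ (hK.side_ne_zero hPQ heK)]
    exact mul_pos_of_neg_of_neg hneg hopp
  · rw [div_eq_zero_iff, or_iff_left (hK.side_ne_zero hPQ heK)] at hzero
    exact Or.inl (frontier_subset_closure (heK (hyPQ hzero)))
  · exact Or.inl (subset_closure (hyK hpos))

end IsStarAbout

/-! ### Poincaré and trace inequalities on star-shaped sets -/

theorem setLIntegral_comp_add_smul_le {E : Type*} [NormedAddCommGroup E] [NormedSpace ℝ E]
    [FiniteDimensional ℝ E] [MeasurableSpace E] [BorelSpace E] (μ : Measure E)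
    [μ.IsAddHaarMeasure] {K A : Set E} (hK : MeasurableSet K) (hA : MeasurableSet A)
    {g : E → ℝ≥0∞} (hg : Measurable g) {v : E} {s : ℝ} (hs : 0 < s)
    (h : MapsTo (fun x => v + s • x) A K) :
    ∫⁻ x in A, g (v + s • x) ∂μ ≤
      ENNReal.ofReal (s ^ Module.finrank ℝ E)⁻¹ * ∫⁻ x in K, g x ∂μ :=
  calc ∫⁻ x in A, g (v + s • x) ∂μ ≤ ∫⁻ x in A, K.indicator g (v + s • x) ∂μ :=
        setLIntegral_mono' hA fun x hx => (indicator_of_mem (h hx) g).ge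
    _ ≤ ∫⁻ x, K.indicator g (v + s • x) ∂μ := setLIntegral_le_lintegral _ _
    _ = ∫⁻ x, K.indicator g (v + x) ∂(μ.map (s • ·)) := by
        rw [lintegral_map (f := fun x => K.indicator g (v + x))
          ((hg.indicator hK).comp (measurable_const_add v)) (measurable_const_smul s)]
    _ = ENNReal.ofReal (s ^ Module.finrank ℝ E)⁻¹ * ∫⁻ x in K, g x ∂μ := by
        rw [Measure.map_addHaar_smul _ hs.ne', lintegral_smul_measure, smul_eq_mul,
          lintegral_add_left_eq_self (fun x => K.indicator g x) v, lintegral_indicator hK,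
          abs_of_pos (by positivity)]

theorem setLIntegral_setLIntegral_segment_le {K B : Set Pt} (hK : MeasurableSet K)
    (hB : MeasurableSet B) (hstar : ∀ y ∈ B, StarConvex ℝ y K) {g : Pt → ℝ≥0∞}
    (hg : Continuous g) {t : ℝ} (ht : t ∈ Icc (0 : ℝ) 1) :
    ∫⁻ y in B, ∫⁻ x in K, g ((1 - t) • y + t • x) ≤
      4 * (volume B + volume K) * ∫⁻ x in K, g x := by
  have hmem : ∀ y ∈ B, ∀ x ∈ K, (1 - t) • y + t • x ∈ K := fun y hy x hx =>
    hstar y hy hx (sub_nonneg.2 ht.2) ht.1 (by ring)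
  have hconst : ∀ s : ℝ, 1 / 2 ≤ s → ENNReal.ofReal (s ^ Module.finrank ℝ Pt)⁻¹ ≤ 4 := by
    intro s hs
    rw [finrank_euclideanSpace_fin]
    refine ENNReal.ofReal_le_of_le_toReal ?_
    rw [ENNReal.toReal_ofNat, inv_le_comm₀ (by positivity) (by norm_num)]
    nlinarith
  -- Substitute in the variable whose coefficient is at least `1 / 2`.
  rcases le_total (1 / 2) t with hhalf | hhalf
  · calc ∫⁻ y in B, ∫⁻ x in K, g ((1 - t) • y + t • x)
        ≤ ∫⁻ _ in B, 4 * ∫⁻ x in K, g x := setLIntegral_mono' hB fun y hy =>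
          (setLIntegral_comp_add_smul_le volume hK hK hg.measurable (by linarith)
            (hmem y hy)).trans (by gcongr; exact hconst t hhalf)
      _ = 4 * volume B * ∫⁻ x in K, g x := by rw [setLIntegral_const]; ring
      _ ≤ _ := by gcongr; exact le_self_add
  · rw [lintegral_lintegral_swap
      (Continuous.measurable (by unfold Function.uncurry; fun_prop)).aemeasurable]
    calc ∫⁻ x in K, ∫⁻ y in B, g ((1 - t) • y + t • x)
        ≤ ∫⁻ _ in K, 4 * ∫⁻ x in K, g x := setLIntegral_mono' hK fun x hx => by
          simp_rw [add_comm _ (t • x)]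
          refine (setLIntegral_comp_add_smul_le volume hK hB hg.measurable (by linarith)
            fun y hy => ?_).trans (by gcongr; exact hconst (1 - t) (by linarith))
          change t • x + (1 - t) • y ∈ K
          rw [add_comm]
          exact hmem y hy x hx
      _ = 4 * volume K * ∫⁻ x in K, g x := by rw [setLIntegral_const]; ring
      _ ≤ _ := by gcongr; exact le_add_self

theorem hasDerivAt_comp_add_smul {φ : Pt → ℝ} (h : ContDiff ℝ ∞ φ) (z v : Pt) (t : ℝ) :
    HasDerivAt (fun t : ℝ => φ (z + t • v)) (inner ℝ (grad φ (z + t • v)) v) t := by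
  have hline : HasDerivAt (fun t : ℝ => z + t • v) v t := by
    simpa using ((hasDerivAt_id t).smul_const v).const_add z
  rw [inner_grad_left]
  exact ((h.differentiable (by simp)) _).hasFDerivAt.comp_hasDerivAt t hline

theorem enorm_inner_le_mul_enorm {E : Type*} [NormedAddCommGroup E] [InnerProductSpace ℝ E]
    (x y : E) : ‖(inner ℝ x y : ℝ)‖ₑ ≤ ‖x‖ₑ * ‖y‖ₑ := by
  simp only [← ofReal_norm, ← ENNReal.ofReal_mul (norm_nonneg x)]
  exact ENNReal.ofReal_le_ofReal (norm_inner_le_norm x y)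

theorem enorm_sub_le_lintegral_grad {φ : Pt → ℝ} (h : ContDiff ℝ ∞ φ) (x y : Pt) :
    ‖φ x - φ y‖ₑ ≤ ‖x - y‖ₑ * ∫⁻ t in Ioc (0 : ℝ) 1, ‖grad φ ((1 - t) • y + t • x)‖ₑ := by
  have hcont : Continuous fun t : ℝ => (inner ℝ (grad φ (y + t • (x - y))) (x - y) : ℝ) := by
    have := continuous_grad h
    fun_prop
  have hftc := intervalIntegral.integral_eq_sub_of_hasDerivAt (a := 0) (b := 1)
    (fun t _ => hasDerivAt_comp_add_smul h y (x - y) t) (hcont.intervalIntegrable _ _)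
  simp only [one_smul, add_sub_cancel, zero_smul, add_zero] at hftc
  rw [← hftc, intervalIntegral.integral_of_le zero_le_one,
    ← lintegral_const_mul' _ _ enorm_ne_top]
  refine (enorm_integral_le_lintegral_enorm _).trans (lintegral_mono fun t => ?_)
  rw [mul_comm, show (1 - t) • y + t • x = y + t • (x - y) by module]
  exact enorm_inner_le_mul_enorm _ _

theorem lintegral_lintegral_lintegral_rotate {α β γ : Type*} [MeasurableSpace α]
    [MeasurableSpace β] [MeasurableSpace γ] {μ : Measure α} {ν : Measure β} {ρ : Measure γ}
    [SFinite μ] [SFinite ν] [SFinite ρ] {f : (α × β) × γ → ℝ≥0∞} (hf : Measurable f) :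
    ∫⁻ a, ∫⁻ b, ∫⁻ c, f ((a, b), c) ∂ρ ∂ν ∂μ = ∫⁻ c, ∫⁻ a, ∫⁻ b, f ((a, b), c) ∂ν ∂μ ∂ρ := by
  rw [← lintegral_prod (f := fun p : α × β => ∫⁻ c, f (p, c) ∂ρ)
      hf.lintegral_prod_right'.aemeasurable,
    lintegral_lintegral_swap (f := fun p c => f (p, c)) hf.aemeasurable]
  exact lintegral_congr fun c =>
    lintegral_prod _ (hf.comp measurable_prodMk_right).aemeasurable

theorem setLIntegral_setLIntegral_enorm_sub_le {K B : Set Pt} (hK : MeasurableSet K)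
    (hb : Bornology.IsBounded K) (hB : MeasurableSet B) (hstar : ∀ y ∈ B, StarConvex ℝ y K)
    {φ : Pt → ℝ} (hφ : ContDiff ℝ ∞ φ) :
    ∫⁻ y in B, ∫⁻ x in K, ‖φ x - φ y‖ₑ ≤
      Metric.ediam K * (4 * (volume B + volume K) * ∫⁻ x in K, ‖grad φ x‖ₑ) := by
  have hgrad : Continuous fun x => ‖grad φ x‖ₑ := (continuous_grad hφ).enorm
  have hsegment : Measurable fun p : (Pt × Pt) × ℝ =>
      ‖grad φ ((1 - p.2) • p.1.1 + p.2 • p.1.2)‖ₑ :=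
    (hgrad.comp (f := fun p : (Pt × Pt) × ℝ => (1 - p.2) • p.1.1 + p.2 • p.1.2)
      (by fun_prop)).measurable
  have hdiam : Metric.ediam K ≠ ⊤ := Metric.isBounded_iff_ediam_ne_top.1 hb
  calc ∫⁻ y in B, ∫⁻ x in K, ‖φ x - φ y‖ₑ
      ≤ ∫⁻ y in B, ∫⁻ x in K, Metric.ediam K *
          ∫⁻ t in Ioc (0 : ℝ) 1, ‖grad φ ((1 - t) • y + t • x)‖ₑ := by
        refine setLIntegral_mono' hB fun y hy => setLIntegral_mono' hK fun x hx => ?_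
        refine (enorm_sub_le_lintegral_grad hφ x y).trans ?_
        gcongr
        rw [← edist_eq_enorm_sub]
        exact Metric.edist_le_ediam_of_mem hx ((hstar y hy).mem ⟨x, hx⟩)
    _ = Metric.ediam K * ∫⁻ y in B, ∫⁻ x in K,
          ∫⁻ t in Ioc (0 : ℝ) 1, ‖grad φ ((1 - t) • y + t • x)‖ₑ := by
        simp_rw [lintegral_const_mul' _ _ hdiam]
    _ = Metric.ediam K * ∫⁻ t in Ioc (0 : ℝ) 1, ∫⁻ y in B, ∫⁻ x in K,
          ‖grad φ ((1 - t) • y + t • x)‖ₑ := by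
        exact congrArg _ (lintegral_lintegral_lintegral_rotate hsegment)
    _ ≤ Metric.ediam K * ∫⁻ _ in Ioc (0 : ℝ) 1,
          4 * (volume B + volume K) * ∫⁻ x in K, ‖grad φ x‖ₑ := by
        refine mul_le_mul_right ?_ _
        exact setLIntegral_mono' measurableSet_Ioc fun t ht =>
          setLIntegral_setLIntegral_segment_le hK hB hstar hgrad (Ioc_subset_Icc_self ht)
    _ = _ := by simp

theorem IsStarAbout.exists_poincare_const {K : Set Pt} {c : Pt} (h : IsStarAbout K c)
    (hb : Bornology.IsBounded K) :
    ∃ C : ℝ≥0∞, C ≠ ⊤ ∧ ∀ φ : Pt → ℝ, ContDiff ℝ ∞ φ →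
      ∃ m : ℝ, ∫⁻ x in K, ‖φ x - m‖ₑ ≤ C * ∫⁻ x in K, ‖grad φ x‖ₑ := by
  obtain ⟨r, hr, hstar⟩ := h.exists_ball
  set B := Metric.ball c r
  have hB0 : volume B ≠ 0 := (Metric.measure_ball_pos _ _ hr).ne'
  have hBt : volume B ≠ ⊤ := measure_ball_lt_top.ne
  have hKt : volume K ≠ ⊤ := hb.measure_lt_top.ne
  have hdiam : Metric.ediam K ≠ ⊤ := Metric.isBounded_iff_ediam_ne_top.1 hb
  refine ⟨Metric.ediam K * (4 * (volume B + volume K)) / volume B,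
    (ENNReal.div_lt_top (by finiteness) hB0).ne, fun φ hφ => ?_⟩
  have hφc := hφ.continuous
  have hmeas : Measurable fun y => ∫⁻ x in K, ‖φ x - φ y‖ₑ :=
    Measurable.lintegral_prod_right' (f := fun p : Pt × Pt => ‖φ p.2 - φ p.1‖ₑ)
      (Continuous.measurable (by fun_prop))
  obtain ⟨y, -, hle⟩ := exists_le_setLAverage hB0 hBt hmeas.aemeasurable
  refine ⟨φ y, hle.trans ?_⟩
  rw [setLAverage_eq, ENNReal.mul_comm_div, ← mul_div_assoc]
  gcongr
  rw [mul_assoc]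
  exact setLIntegral_setLIntegral_enorm_sub_le h.isOpen.measurableSet hb measurableSet_ball
    hstar hφ

theorem IsStarAbout.add_smul_add_smul_mem {K : Set Pt} {c P Q : Pt} (h : IsStarAbout K c)
    (hPQ : segment ℝ P Q ⊆ closure K) {a b : ℝ} (ha : 0 ≤ a) (hb : 0 ≤ b) (hab : a + b < 1) :
    c + (a • (P - c) + b • (Q - c)) ∈ K := by
  rcases eq_or_lt_of_le (add_nonneg ha hb) with hzero | hpos
  · obtain ⟨rfl, rfl⟩ : a = 0 ∧ b = 0 := ⟨by linarith, by linarith⟩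
    simpa using h.add_smul_sub_mem (hPQ (left_mem_segment ℝ P Q)) le_rfl zero_lt_one
  · have hz : (a / (a + b)) • P + (b / (a + b)) • Q ∈ segment ℝ P Q :=
      ⟨_, _, by positivity, by positivity, by field_simp, rfl⟩
    convert h.add_smul_sub_mem (hPQ hz) hpos.le hab using 2
    rw [smul_sub (a + b), smul_add (a + b), smul_smul, smul_smul, mul_div_cancel₀ _ hpos.ne',
      mul_div_cancel₀ _ hpos.ne']
    module

theorem exists_lintegral_comp_add_smul_add_smul {v w : Pt} (h : LinearIndependent ℝ ![v, w])
    (c : Pt) : ∃ κ : NNReal, ∀ F : Pt → ℝ≥0∞, Measurable F →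
      ∫⁻ p : ℝ × ℝ, F (c + (p.1 • v + p.2 • w)) = κ * ∫⁻ x, F x := by
  let A₀ : ℝ × ℝ →ₗ[ℝ] Pt :=
    (LinearMap.toSpanSingleton ℝ Pt v).coprod (LinearMap.toSpanSingleton ℝ Pt w)
  have hA₀ : ∀ p : ℝ × ℝ, A₀ p = p.1 • v + p.2 • w := fun p => by simp [A₀]
  have hinj : Function.Injective A₀ := by
    rw [← LinearMap.ker_eq_bot, LinearMap.ker_eq_bot']
    intro p hp
    exact Prod.ext_iff.2 (LinearIndependent.pair_iff.1 h _ _ ((hA₀ p).symm.trans hp))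
  let A : (ℝ × ℝ) ≃L[ℝ] Pt :=
    (LinearEquiv.ofInjectiveOfFinrankEq A₀ hinj (by simp)).toContinuousLinearEquiv
  have := A.isAddHaarMeasure_map (volume : Measure (ℝ × ℝ))
  obtain ⟨κ, hκ⟩ : ∃ κ : NNReal, Measure.map A (volume : Measure (ℝ × ℝ)) = κ • volume :=
    ⟨_, Measure.isAddLeftInvariant_eq_smul _ _⟩
  refine ⟨κ, fun F hF => ?_⟩
  calc ∫⁻ p : ℝ × ℝ, F (c + (p.1 • v + p.2 • w)) = ∫⁻ p : ℝ × ℝ, F (c + A p) :=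
        lintegral_congr fun p => by rw [← hA₀]; rfl
    _ = ∫⁻ x, F (c + x) ∂(κ • volume) := by
        rw [← hκ, lintegral_map (f := fun x => F (c + x)) (hF.comp (measurable_const_add c))
          A.continuous.measurable]
    _ = κ * ∫⁻ x, F x := by
        rw [lintegral_smul_measure, lintegral_add_left_eq_self F c]; rfl

theorem enorm_mul_le_lintegral {φ : Pt → ℝ} (h : ContDiff ℝ ∞ φ) (z v : Pt) {s : ℝ} (h0 : 0 ≤ s)
    (h1 : s ≤ 1) :
    ‖s * φ (z + s • v)‖ₑ ≤ ∫⁻ a in Ioo 0 s, (‖φ (z + a • v)‖ₑ + ‖v‖ₑ * ‖grad φ (z + a • v)‖ₑ) := by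
  have hcont : Continuous fun t : ℝ =>
      1 * φ (z + t • v) + t * (inner ℝ (grad φ (z + t • v)) v : ℝ) := by
    have hgrad := continuous_grad h
    have hφ := h.continuous
    fun_prop
  have hftc := intervalIntegral.integral_eq_sub_of_hasDerivAt (a := 0) (b := s)
    (fun t _ => (hasDerivAt_id t).mul (hasDerivAt_comp_add_smul h z v t))
    (hcont.intervalIntegrable _ _)
  simp only [Pi.mul_apply, id, zero_mul, sub_zero, one_mul] at hftc
  rw [← hftc, intervalIntegral.integral_of_le h0, integral_Ioc_eq_integral_Ioo]
  refine (enorm_integral_le_lintegral_enorm _).trans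
    (setLIntegral_mono' measurableSet_Ioo fun t ht => (enorm_add_le _ _).trans ?_)
  have ht1 : ‖t‖ₑ ≤ 1 := by
    rw [Real.enorm_of_nonneg ht.1.le]
    exact ENNReal.ofReal_le_ofReal (ht.2.le.trans h1) |>.trans ENNReal.ofReal_one.le
  have hgrad : ‖t * inner ℝ (grad φ (z + t • v)) v‖ₑ ≤ ‖v‖ₑ * ‖grad φ (z + t • v)‖ₑ := by
    rw [enorm_mul, mul_comm ‖v‖ₑ]
    exact (mul_le_of_le_one_left' ht1).trans (enorm_inner_le_mul_enorm _ _)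
  exact add_le_add le_rfl hgrad

theorem IsStarAbout.enorm_mul_le_lintegral_indicator {K : Set Pt} {c P Q : Pt}
    (h : IsStarAbout K c) (hPQ : segment ℝ P Q ⊆ closure K) {φ : Pt → ℝ} (hφ : ContDiff ℝ ∞ φ)
    {D : ℝ≥0∞} (hD : ‖P - c‖ₑ ≤ D) {s t : ℝ} (hs : 0 ≤ s) (ht : 0 ≤ t) (hst : s + t = 1) :
    ‖s * φ (AffineMap.lineMap P Q t)‖ₑ ≤
      ∫⁻ a : ℝ, K.indicator (fun x => ‖φ x‖ₑ + D * ‖grad φ x‖ₑ)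
        (c + (a • (P - c) + t • (Q - c))) := by
  have hpoint : (AffineMap.lineMap P Q t : Pt) = (c + t • (Q - c)) + s • (P - c) := by
    rw [AffineMap.lineMap_apply_module, ← hst]
    obtain rfl : s = 1 - t := by linarith
    module
  rw [hpoint]
  refine (enorm_mul_le_lintegral hφ _ _ hs (by linarith)).trans
    (le_trans ?_ (setLIntegral_le_lintegral (Ioo 0 s) _))
  refine setLIntegral_mono' measurableSet_Ioo fun a ha => ?_
  rw [indicator_of_mem (h.add_smul_add_smul_mem hPQ ha.1.le ht (by linarith [ha.2])),
    add_comm (a • (P - c)), ← add_assoc]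
  gcongr

theorem IsStarAbout.enorm_lineMap_le_lintegral_add_lintegral {K : Set Pt} {c P Q : Pt}
    (h : IsStarAbout K c) (hPQ : segment ℝ P Q ⊆ closure K) {φ : Pt → ℝ} (hφ : ContDiff ℝ ∞ φ)
    {D : ℝ≥0∞} (hDP : ‖P - c‖ₑ ≤ D) (hDQ : ‖Q - c‖ₑ ≤ D) {t : ℝ} (h0 : 0 ≤ t) (h1 : t ≤ 1) :
    ‖φ (AffineMap.lineMap P Q t)‖ₑ ≤
      (∫⁻ a : ℝ, K.indicator (fun x => ‖φ x‖ₑ + D * ‖grad φ x‖ₑ)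
        (c + (a • (P - c) + t • (Q - c)))) +
      ∫⁻ b : ℝ, K.indicator (fun x => ‖φ x‖ₑ + D * ‖grad φ x‖ₑ)
        (c + ((1 - t) • (P - c) + b • (Q - c))) := by
  have hP := h.enorm_mul_le_lintegral_indicator hPQ hφ hDP (sub_nonneg.2 h1) h0 (by ring)
  have hQ := h.enorm_mul_le_lintegral_indicator (segment_symm ℝ P Q ▸ hPQ) hφ hDQ h0
    (sub_nonneg.2 h1) (by ring)
  rw [AffineMap.lineMap_apply_one_sub] at hQ
  simp_rw [add_comm (_ • (Q - c))] at hQ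
  calc ‖φ (AffineMap.lineMap P Q t)‖ₑ
      = ‖(1 - t) * φ (AffineMap.lineMap P Q t) + t * φ (AffineMap.lineMap P Q t)‖ₑ := by
        ring_nf
    _ ≤ _ := (enorm_add_le _ _).trans (add_le_add hP hQ)

theorem IsStarAbout.setLIntegral_lineMap_le {K : Set Pt} {c P Q : Pt} (h : IsStarAbout K c)
    (hPQ : segment ℝ P Q ⊆ closure K) {φ : Pt → ℝ} (hφ : ContDiff ℝ ∞ φ) {D : ℝ≥0∞}
    (hDP : ‖P - c‖ₑ ≤ D) (hDQ : ‖Q - c‖ₑ ≤ D) {κ : ℝ≥0∞}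
    (hκ : ∀ F : Pt → ℝ≥0∞, Measurable F →
      ∫⁻ p : ℝ × ℝ, F (c + (p.1 • (P - c) + p.2 • (Q - c))) = κ * ∫⁻ x, F x) :
    ∫⁻ t in Ioc (0 : ℝ) 1, ‖φ (AffineMap.lineMap P Q t)‖ₑ ≤
      2 * κ * ∫⁻ x in K, (‖φ x‖ₑ + D * ‖grad φ x‖ₑ) := by
  set F : Pt → ℝ≥0∞ := K.indicator fun x => ‖φ x‖ₑ + D * ‖grad φ x‖ₑ
  set v := P - c
  set w := Q - c
  have hF : Measurable F :=
    (hφ.continuous.enorm.measurable.add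
      ((continuous_grad hφ).enorm.measurable.const_mul D)).indicator h.isOpen.measurableSet
  have hFκ : ∫⁻ p : ℝ × ℝ, F (c + (p.1 • v + p.2 • w)) =
      κ * ∫⁻ x in K, (‖φ x‖ₑ + D * ‖grad φ x‖ₑ) := by
    rw [hκ F hF, lintegral_indicator h.isOpen.measurableSet]
  have hFvw : Measurable fun p : ℝ × ℝ => F (c + (p.1 • v + p.2 • w)) :=
    hF.comp (Continuous.measurable (by fun_prop))
  have hFwv : Measurable fun p : ℝ × ℝ => F (c + (p.2 • v + p.1 • w)) :=
    hF.comp (Continuous.measurable (by fun_prop))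
  have hfirst : ∫⁻ t : ℝ, ∫⁻ a : ℝ, F (c + (a • v + t • w)) =
      ∫⁻ p : ℝ × ℝ, F (c + (p.1 • v + p.2 • w)) := (lintegral_prod_symm' _ hFvw).symm
  have hsecond : ∫⁻ t : ℝ, ∫⁻ b : ℝ, F (c + ((1 - t) • v + b • w)) =
      ∫⁻ p : ℝ × ℝ, F (c + (p.1 • v + p.2 • w)) := by
    rw [lintegral_sub_left_eq_self (fun t => ∫⁻ b : ℝ, F (c + (t • v + b • w))) 1]
    exact (lintegral_prod _ hFvw.aemeasurable).symm
  calc ∫⁻ t in Ioc (0 : ℝ) 1, ‖φ (AffineMap.lineMap P Q t)‖ₑ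
      ≤ ∫⁻ t, ((∫⁻ a : ℝ, F (c + (a • v + t • w))) + ∫⁻ b : ℝ, F (c + ((1 - t) • v + b • w))) :=
        (setLIntegral_mono' measurableSet_Ioc fun t ht =>
          h.enorm_lineMap_le_lintegral_add_lintegral hPQ hφ hDP hDQ ht.1.le ht.2).trans
            (setLIntegral_le_lintegral _ _)
    _ = 2 * κ * ∫⁻ x in K, (‖φ x‖ₑ + D * ‖grad φ x‖ₑ) := by
        rw [lintegral_add_left (Measurable.lintegral_prod_right' hFwv), hfirst, hsecond, hFκ]
        ring

theorem IsStarAbout.exists_trace_const {K : Set Pt} {c P Q : Pt} (h : IsStarAbout K c)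
    (hPQ : segment ℝ P Q ⊆ closure K) (hc : side P Q c ≠ 0) :
    ∃ C : ℝ≥0∞, C ≠ ⊤ ∧ ∀ φ : Pt → ℝ, ContDiff ℝ ∞ φ →
      ∫⁻ t in Ioc (0 : ℝ) 1, ‖φ (AffineMap.lineMap P Q t)‖ₑ ≤
        C * ((∫⁻ x in K, ‖φ x‖ₑ) + ∫⁻ x in K, ‖grad φ x‖ₑ) := by
  obtain ⟨κ, hκ⟩ :=
    exists_lintegral_comp_add_smul_add_smul (linearIndependent_of_side_ne_zero hc) c
  set D : ℝ≥0∞ := 1 + ‖P - c‖ₑ + ‖Q - c‖ₑ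
  have hD : 1 ≤ D := by simp only [D, add_assoc]; exact le_self_add
  have hDP : ‖P - c‖ₑ ≤ D := le_add_self.trans le_self_add
  refine ⟨2 * κ * D, by finiteness, fun φ hφ => ?_⟩
  calc ∫⁻ t in Ioc (0 : ℝ) 1, ‖φ (AffineMap.lineMap P Q t)‖ₑ
      ≤ 2 * κ * ∫⁻ x in K, (‖φ x‖ₑ + D * ‖grad φ x‖ₑ) :=
        h.setLIntegral_lineMap_le hPQ hφ hDP le_add_self hκ
    _ = 2 * κ * ((∫⁻ x in K, ‖φ x‖ₑ) + D * ∫⁻ x in K, ‖grad φ x‖ₑ) := by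
        rw [lintegral_add_left hφ.continuous.enorm.measurable,
          lintegral_const_mul _ (continuous_grad hφ).enorm.measurable]
    _ ≤ 2 * κ * (D * (∫⁻ x in K, ‖φ x‖ₑ) + D * ∫⁻ x in K, ‖grad φ x‖ₑ) := by
        gcongr
        exact le_mul_of_one_le_left zero_le hD
    _ = _ := by ring

/-! ### Curl-free fields with prescribed divergence and normal trace -/

section EdgeFunctional

variable {K : Set Pt} {c P Q : Pt} {f q : Pt → ℝ}

theorem enorm_setIntegral_mul_le {α : Type*} [MeasurableSpace α] {μ : Measure α} {s : Set α}
    (hs : MeasurableSet s) {g φ : α → ℝ} {M : ℝ} (hM : ∀ x ∈ s, ‖g x‖ ≤ M) :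
    ‖∫ x in s, g x * φ x ∂μ‖ₑ ≤ ENNReal.ofReal M * ∫⁻ x in s, ‖φ x‖ₑ ∂μ := by
  rw [← lintegral_const_mul' _ _ ENNReal.ofReal_ne_top]
  refine (enorm_integral_le_lintegral_enorm _).trans (setLIntegral_mono' hs fun x hx => ?_)
  rw [enorm_mul, ← ofReal_norm]
  gcongr
  exact hM x hx

theorem integrableOn_inner_grad {U : Set Pt} (t : L2Vec U) {φ : Pt → ℝ} (hφ : IsTest φ) :
    IntegrableOn (fun x => inner ℝ (t x) (grad φ x)) U := by
  refine (L2.integrable_inner (𝕜 := ℝ) t (gradL2 U ⟨φ, hφ⟩)).congr ?_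
  filter_upwards [coeFn_gradL2 (U := U) ⟨φ, hφ⟩] with x hx
  rw [hx]

theorem setLIntegral_enorm_grad_le (φ : testSpace) :
    ∫⁻ x in K, ‖grad φ x‖ₑ ≤ ‖gradL2 K φ‖ₑ * volume K ^ (1 / 2 : ℝ) := by
  rw [← eLpNorm_one_eq_lintegral_enorm]
  refine (eLpNorm_le_eLpNorm_mul_rpow_measure_univ (p := 1) (q := 2) (by norm_num)
    (φ.2.memLp_grad.restrict K).1).trans (le_of_eq ?_)
  rw [Measure.restrict_apply_univ, Lp.enorm_def, eLpNorm_congr_ae (coeFn_gradL2 φ)]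
  norm_num

/-- The functional `φ ↦ ∫₀¹ q φ - ∫_K f φ`, the first integral being over the segment from `P` to
`Q` in its affine parametrization. A field whose pairing with gradients is this functional has
divergence `f` in `K` and normal trace `q` on the segment. -/
def edgeFunctional (K : Set Pt) (P Q : Pt) (f q φ : Pt → ℝ) : ℝ :=
  (∫ s in (0 : ℝ)..1, q (AffineMap.lineMap P Q s) * φ (AffineMap.lineMap P Q s)) -
    ∫ x in K, f x * φ x

theorem intervalIntegrable_mul_lineMap {q φ : Pt → ℝ} (hq : Continuous q) (hφ : Continuous φ)
    (P Q : Pt) : IntervalIntegrable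
      (fun s : ℝ => q (AffineMap.lineMap P Q s) * φ (AffineMap.lineMap P Q s)) volume 0 1 :=
  Continuous.intervalIntegrable ((hq.mul hφ).comp AffineMap.lineMap_continuous) _ _

theorem integrableOn_mul_of_isBounded (hb : Bornology.IsBounded K) {f φ : Pt → ℝ}
    (hf : Continuous f) (hφ : Continuous φ) : IntegrableOn (fun x => f x * φ x) K :=
  integrableOn_of_isBounded hb (hf.mul hφ)

theorem edgeFunctional_add (hb : Bornology.IsBounded K) (hf : Continuous f) (hq : Continuous q)
    {φ ψ : Pt → ℝ} (hφ : Continuous φ) (hψ : Continuous ψ) :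
    edgeFunctional K P Q f q (φ + ψ) =
      edgeFunctional K P Q f q φ + edgeFunctional K P Q f q ψ := by
  simp only [edgeFunctional, Pi.add_apply, mul_add]
  rw [intervalIntegral.integral_add (intervalIntegrable_mul_lineMap hq hφ P Q)
      (intervalIntegrable_mul_lineMap hq hψ P Q),
    integral_add (integrableOn_mul_of_isBounded hb hf hφ)
      (integrableOn_mul_of_isBounded hb hf hψ)]
  ring

theorem edgeFunctional_const_smul (a : ℝ) (φ : Pt → ℝ) :
    edgeFunctional K P Q f q (a • φ) = a * edgeFunctional K P Q f q φ := by
  simp only [edgeFunctional, Pi.smul_apply, smul_eq_mul, mul_left_comm _ a,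
    intervalIntegral.integral_const_mul, integral_const_mul, mul_sub]

theorem edgeFunctional_const (m : ℝ)
    (hfq : ∫ x in K, f x = ∫ s in (0 : ℝ)..1, q (AffineMap.lineMap P Q s)) :
    edgeFunctional K P Q f q (fun _ => m) = 0 := by
  simp only [edgeFunctional, intervalIntegral.integral_mul_const, integral_mul_const, hfq, sub_self]

theorem IsStarAbout.exists_enorm_edgeFunctional_le (h : IsStarAbout K c)
    (hb : Bornology.IsBounded K) (hPQ : segment ℝ P Q ⊆ closure K) (hc : side P Q c ≠ 0)
    (hf : Continuous f) (hq : Continuous q) :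
    ∃ C : ℝ≥0∞, C ≠ ⊤ ∧ ∀ φ : Pt → ℝ, ContDiff ℝ ∞ φ → ‖edgeFunctional K P Q f q φ‖ₑ ≤
      C * ((∫⁻ x in K, ‖φ x‖ₑ) + ∫⁻ x in K, ‖grad φ x‖ₑ) := by
  obtain ⟨C, hC, htrace⟩ := h.exists_trace_const hPQ hc
  obtain ⟨M, hM⟩ := hb.isCompact_closure.exists_bound_of_continuousOn hf.continuousOn
  obtain ⟨N, hN⟩ := (isCompact_Icc (a := (0 : ℝ)) (b := 1)).exists_bound_of_continuousOn
    (hq.comp (AffineMap.lineMap_continuous (p := P) (q := Q))).continuousOn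
  refine ⟨ENNReal.ofReal N * C + ENNReal.ofReal M, by finiteness, fun φ hφ => ?_⟩
  have hedge : ‖∫ s in (0 : ℝ)..1, q (AffineMap.lineMap P Q s) * φ (AffineMap.lineMap P Q s)‖ₑ ≤
      ENNReal.ofReal N * ∫⁻ s in Ioc (0 : ℝ) 1, ‖φ (AffineMap.lineMap P Q s)‖ₑ := by
    rw [intervalIntegral.integral_of_le zero_le_one]
    exact enorm_setIntegral_mul_le measurableSet_Ioc fun s hs => hN s (Ioc_subset_Icc_self hs)
  have hcell : ‖∫ x in K, f x * φ x‖ₑ ≤ ENNReal.ofReal M * ∫⁻ x in K, ‖φ x‖ₑ :=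
    enorm_setIntegral_mul_le h.isOpen.measurableSet fun x hx => hM x (subset_closure hx)
  calc ‖edgeFunctional K P Q f q φ‖ₑ
      ≤ ENNReal.ofReal N * (C * ((∫⁻ x in K, ‖φ x‖ₑ) + ∫⁻ x in K, ‖grad φ x‖ₑ)) +
          ENNReal.ofReal M * ((∫⁻ x in K, ‖φ x‖ₑ) + ∫⁻ x in K, ‖grad φ x‖ₑ) := by
        refine enorm_sub_le.trans (add_le_add (hedge.trans ?_) (hcell.trans ?_))
        · gcongr
          exact htrace φ hφ
        · gcongr
          exact le_self_add
    _ = _ := by ring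

/-- The compatibility condition `hfq` makes the functional vanish on constants, so that Poincaré's
inequality applies. -/
theorem IsStarAbout.exists_enorm_edgeFunctional_le_grad (h : IsStarAbout K c)
    (hb : Bornology.IsBounded K) (hPQ : segment ℝ P Q ⊆ closure K) (hc : side P Q c ≠ 0)
    (hf : Continuous f) (hq : Continuous q)
    (hfq : ∫ x in K, f x = ∫ s in (0 : ℝ)..1, q (AffineMap.lineMap P Q s)) :
    ∃ C : ℝ≥0∞, C ≠ ⊤ ∧ ∀ φ : Pt → ℝ, ContDiff ℝ ∞ φ →
      ‖edgeFunctional K P Q f q φ‖ₑ ≤ C * ∫⁻ x in K, ‖grad φ x‖ₑ := by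
  obtain ⟨C, hC, hbound⟩ := h.exists_enorm_edgeFunctional_le hb hPQ hc hf hq
  obtain ⟨C', hC', hpoincare⟩ := h.exists_poincare_const hb
  refine ⟨C * (C' + 1), by finiteness, fun φ hφ => ?_⟩
  obtain ⟨m, hm⟩ := hpoincare φ hφ
  have hshift : edgeFunctional K P Q f q φ = edgeFunctional K P Q f q (fun x => φ x - m) := by
    have hsum : φ = (fun x => φ x - m) + fun _ => m := by ext x; simp
    have hsub : Continuous fun x => φ x - m := hφ.continuous.sub continuous_const
    conv_lhs => rw [hsum, edgeFunctional_add hb hf hq hsub continuous_const,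
      edgeFunctional_const m hfq, add_zero]
  have hgrad : grad (fun x => φ x - m) = grad φ := by
    ext x j
    simp only [grad, pderiv, fderiv_sub_const]
  calc ‖edgeFunctional K P Q f q φ‖ₑ
      ≤ C * ((∫⁻ x in K, ‖φ x - m‖ₑ) + ∫⁻ x in K, ‖grad φ x‖ₑ) := by
        rw [hshift, ← hgrad]
        exact hbound _ (hφ.sub contDiff_const)
    _ ≤ C * (C' * (∫⁻ x in K, ‖grad φ x‖ₑ) + ∫⁻ x in K, ‖grad φ x‖ₑ) := by gcongr
    _ = _ := by ring

theorem IsStarAbout.exists_field_div_normal (h : IsStarAbout K c) (hb : Bornology.IsBounded K)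
    (hPQ : segment ℝ P Q ⊆ closure K) (hc : side P Q c ≠ 0) (hf : Continuous f)
    (hq : Continuous q) (hfq : ∫ x in K, f x = ∫ s in (0 : ℝ)..1, q (AffineMap.lineMap P Q s)) :
    ∃ t : L2Vec K,
      (∀ φ, IsTest φ → ∫ x in K, (f x * φ x + inner ℝ (t x) (grad φ x)) =
        ∫ s in (0 : ℝ)..1, q (AffineMap.lineMap P Q s) * φ (AffineMap.lineMap P Q s)) ∧
      ∀ φ, IsTest φ → tsupport φ ⊆ K → ∫ x in K, inner ℝ (t x) (rot φ x) = 0 := by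
  obtain ⟨C, hC, hbound⟩ := h.exists_enorm_edgeFunctional_le_grad hb hPQ hc hf hq hfq
  let L : testSpace →ₗ[ℝ] ℝ :=
    { toFun := fun φ => edgeFunctional K P Q f q φ
      map_add' := fun φ ψ => edgeFunctional_add hb hf hq φ.2.1.continuous ψ.2.1.continuous
      map_smul' := fun a φ => edgeFunctional_const_smul a φ.1 }
  have hL : ∀ φ : testSpace, ‖L φ‖ₑ ≤ C * volume K ^ (1 / 2 : ℝ) * ‖gradL2 K φ‖ₑ := fun φ =>
    calc ‖L φ‖ₑ ≤ C * ∫⁻ x in K, ‖grad φ x‖ₑ := hbound φ φ.2.1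
      _ ≤ C * (‖gradL2 K φ‖ₑ * volume K ^ (1 / 2 : ℝ)) := by
        gcongr
        exact setLIntegral_enorm_grad_le φ
      _ = _ := by ring
  have hfinite : C * volume K ^ (1 / 2 : ℝ) ≠ ⊤ := ENNReal.mul_ne_top hC
    (ENNReal.rpow_ne_top_of_nonneg (by norm_num) hb.measure_lt_top.ne)
  obtain ⟨t, ht, hcurl⟩ := exists_curlFree_field (U := K) L (C * volume K ^ (1 / 2 : ℝ)).toReal
    fun φ => by simpa using ENNReal.toReal_mono (by finiteness) (hL φ)
  refine ⟨t, fun φ hφ => ?_, fun φ hφ hs => hcurl ⟨φ, hφ, hs⟩⟩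
  rw [integral_add (integrableOn_mul_of_isBounded hb hf hφ.1.continuous)
    (integrableOn_inner_grad t hφ), ht ⟨φ, hφ⟩]
  exact add_sub_cancel _ _

end EdgeFunctional

/-! ### Mesh geometry -/

theorem isPreconnected_ball_diff_of_countable {E : Type*} [NormedAddCommGroup E] [NormedSpace ℝ E]
    (hE : 1 < Module.rank ℝ E) (c : E) {r : ℝ} (hr : 0 < r) {S : Set E} (hS : S.Countable) :
    IsPreconnected (Metric.ball c r \ S) := by
  set e := OpenPartialHomeomorph.univBall c r
  have hsource : ∀ x, x ∈ e.source := by simp [e]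
  have htarget : e.target = Metric.ball c r := OpenPartialHomeomorph.univBall_target c hr
  have hinj : Function.Injective e := fun x y h => e.injOn (hsource x) (hsource y) h
  have himage : Metric.ball c r \ S = e '' (e ⁻¹' S)ᶜ := by
    ext y
    constructor
    · rintro ⟨hy, hyS⟩
      rw [← htarget] at hy
      exact ⟨e.symm y, by rwa [mem_compl_iff, mem_preimage, e.right_inv hy], e.right_inv hy⟩
    · rintro ⟨x, hx, rfl⟩
      exact ⟨htarget ▸ e.map_source (hsource x), hx⟩
  rw [himage]
  exact ((hS.preimage hinj).isConnected_compl_of_one_lt_rank hE).isPreconnected.image _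
    (OpenPartialHomeomorph.continuous_univBall c r).continuousOn

theorem subset_or_subset_of_countable_inter {E : Type*} [NormedAddCommGroup E] [NormedSpace ℝ E]
    (hE : 1 < Module.rank ℝ E) {Ω F G : Set E} (hΩ : IsOpen Ω) (hc : IsPreconnected Ω)
    (hF : IsClosed F) (hG : IsClosed G) (hcover : Ω ⊆ F ∪ G) (hFG : (Ω ∩ (F ∩ G)).Countable) :
    Ω ⊆ F ∨ Ω ⊆ G := by
  have : Nontrivial E := rank_pos_iff_nontrivial.1 (zero_lt_one.trans hE)
  have hdense := hFG.dense_compl ℝ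
  have hlocal : Ω ⊆ interior F ∪ interior G := by
    intro x hx
    obtain ⟨ε, hε, hball⟩ := Metric.isOpen_iff.1 hΩ x hx
    have hint : ∀ B, IsClosed B → Metric.ball x ε \ (Ω ∩ (F ∩ G)) ⊆ B → x ∈ interior B :=
      fun B hB hsub => mem_interior.2 ⟨Metric.ball x ε,
        (hdense.open_subset_closure_inter Metric.isOpen_ball).trans (hB.closure_subset_iff.2 hsub),
        Metric.isOpen_ball, Metric.mem_ball_self hε⟩
    exact (isPreconnected_iff_subset_of_disjoint_closed.1
      (isPreconnected_ball_diff_of_countable hE x hε hFG) F G hF hG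
      (fun y hy => hcover (hball hy.1))
      (eq_empty_of_forall_notMem fun y hy => hy.1.2 ⟨hball hy.1.1, hy.2⟩)).imp
      (hint F hF) (hint G hG)
  have hempty : Ω ∩ (interior F ∩ interior G) = ∅ :=
    interior_eq_empty_iff_dense_compl.2 hdense ▸ subset_antisymm
      (interior_maximal (by gcongr <;> exact interior_subset)
        (hΩ.inter (isOpen_interior.inter isOpen_interior)))
      (by simp [interior_eq_empty_iff_dense_compl.2 hdense])
  exact (isPreconnected_iff_subset_of_disjoint.1 hc _ _ isOpen_interior isOpen_interior hlocal
    hempty).imp (·.trans interior_subset) (·.trans interior_subset)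

theorem volume_segment (P Q : Pt) : volume (segment ℝ P Q) = 0 := by
  have hline : segment ℝ P Q ⊆ (line[ℝ, P, Q] : AffineSubspace ℝ Pt) := by
    rw [segment_eq_image_lineMap]
    rintro _ ⟨t, -, rfl⟩
    exact AffineMap.lineMap_mem_affineSpan_pair t P Q
  refine measure_mono_null hline (Measure.addHaar_affineSubspace _ _ fun htop => ?_)
  have hrank := (collinear_pair ℝ P Q).finrank_le_one
  rw [← direction_affineSpan, htop, AffineSubspace.direction_top, finrank_top] at hrank
  simp at hrank

namespace SimplePolygon

variable (K : SimplePolygon) (i : Fin K.n)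

theorem vertex_ne : K.vertex i ≠ K.vertex (finRotate K.n i) := by
  have hi : i ∈ (finRotate K.n).support := by
    rw [support_finRotate_of_le (le_of_add_le_right K.three_le)]
    exact Finset.mem_univ i
  exact K.vertex_injective.ne (Equiv.Perm.mem_support.1 hi).symm

theorem edge_subset_frontier : K.edge i ⊆ frontier K.carrier := by
  rw [K.frontier_eq]
  exact subset_iUnion (fun i => segment ℝ (K.vertex i) (K.vertex (finRotate K.n i))) i

theorem volume_frontier : volume (frontier K.carrier) = 0 := by
  rw [K.frontier_eq, measure_iUnion_null_iff]
  exact fun i => volume_segment _ _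

variable {K}

theorem exists_mem_edge {x : Pt} (hx : x ∈ closure K.carrier) (h : x ∉ K.carrier) :
    ∃ i, x ∈ K.edge i := by
  have hfr : x ∈ frontier K.carrier := K.isOpen.frontier_eq ▸ ⟨hx, h⟩
  rw [K.frontier_eq] at hfr
  exact mem_iUnion.1 hfr

end SimplePolygon

namespace PolygonalMesh

variable {Ω : Set Pt} {T : PolygonalMesh Ω}

/-- Every cell is star-shaped with respect to a ball: shape regularity without its constants. -/
def IsStarMesh (T : PolygonalMesh Ω) : Prop := ∀ K, ∃ c, IsStarAbout (T.cell K).carrier c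

theorem ShapeRegular.isStarMesh {η₁ η₂ : ℝ} (hη₁ : 0 < η₁) (h : T.ShapeRegular η₁ η₂) :
    T.IsStarMesh := fun K =>
  let ⟨c, r, hr, hstar⟩ := (h K).1
  ⟨c, (T.cell K).isOpen, r, (mul_nonneg hη₁.le Metric.diam_nonneg).trans_lt hr, hstar⟩

/-- The set of all vertices of the mesh. -/
def vertices (T : PolygonalMesh Ω) : Set Pt := ⋃ K, range (T.cell K).vertex

theorem finite_vertices (T : PolygonalMesh Ω) : T.vertices.Finite :=
  finite_iUnion fun _ => finite_range _

theorem mem_openSegment_of_notMem_vertices {K : Fin T.N} {i : Fin (T.cell K).n} {x : Pt}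
    (hx : x ∈ (T.cell K).edge i) (hv : x ∉ T.vertices) :
    x ∈ openSegment ℝ ((T.cell K).vertex i) ((T.cell K).vertex (finRotate _ i)) := by
  rw [SimplePolygon.edge, ← insert_endpoints_openSegment] at hx
  rcases hx with rfl | rfl | h
  · exact absurd (mem_iUnion_of_mem K (mem_range_self i)) hv
  · exact absurd (mem_iUnion_of_mem K (mem_range_self _)) hv
  · exact h

theorem notMem_of_mem_closure {K L : Fin T.N} (h : K ≠ L) {x : Pt}
    (hx : x ∈ closure (T.cell L).carrier) : x ∉ (T.cell K).carrier := fun hK =>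
  disjoint_left.1 ((T.disjoint K L h).closure_right (T.cell K).isOpen) hK hx

theorem exists_mem_closure_cell (T : PolygonalMesh Ω) {x : Pt} (hx : x ∈ closure Ω) :
    ∃ K, x ∈ closure (T.cell K).carrier :=
  mem_iUnion.1 (T.cover ▸ hx)

open Topology in
theorem IsStarMesh.eventually_mem_closure_union (hT : T.IsStarMesh) {K L : Fin T.N} (hKL : L ≠ K)
    {i : Fin (T.cell K).n} {j : Fin (T.cell L).n} (he : (T.cell L).edge j = (T.cell K).edge i)
    {x : Pt} (hx : x ∈ openSegment ℝ ((T.cell K).vertex i) ((T.cell K).vertex (finRotate _ i))) :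
    ∀ᶠ y in 𝓝 x, y ∈ closure (T.cell K).carrier ∪ closure (T.cell L).carrier := by
  obtain ⟨c, hc⟩ := hT K
  obtain ⟨c', hc'⟩ := hT L
  exact hc.eventually_mem_closure_union hc' (T.disjoint K L hKL.symm)
    ((T.cell K).vertex_ne i) ((T.cell K).edge_subset_frontier i)
    (he.symm.trans_subset ((T.cell L).edge_subset_frontier j)) hx

/-- The union of the closed cells with index in `A`. -/
def closedUnion (T : PolygonalMesh Ω) (A : Set (Fin T.N)) : Set Pt :=
  ⋃ K ∈ A, closure (T.cell K).carrier

theorem isClosed_closedUnion (A : Set (Fin T.N)) : IsClosed (T.closedUnion A) :=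
  A.toFinite.isClosed_biUnion fun _ _ => isClosed_closure

theorem subset_closedUnion_union_compl (A : Set (Fin T.N)) :
    Ω ⊆ T.closedUnion A ∪ T.closedUnion Aᶜ := fun x hx => by
  obtain ⟨K, hK⟩ := T.exists_mem_closure_cell (subset_closure hx)
  by_cases hKA : K ∈ A
  · exact Or.inl (mem_biUnion hKA hK)
  · exact Or.inr (mem_biUnion (s := Aᶜ) hKA hK)

theorem mem_of_subset_closedUnion {A : Set (Fin T.N)} (h : Ω ⊆ T.closedUnion A) (K : Fin T.N) :
    K ∈ A := by
  obtain ⟨x, hx⟩ := (T.cell K).isConnected.nonempty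
  obtain ⟨L, hL, hxL⟩ := mem_iUnion₂.1 (h (T.subset K hx))
  by_contra hK
  exact notMem_of_mem_closure (fun h : K = L => hK (h ▸ hL)) hxL hx

/-- A set of cells is closed under passing to a neighbour across a common edge. -/
def IsClosedUnderNeighbours (T : PolygonalMesh Ω) (A : Set (Fin T.N)) : Prop :=
  ∀ K ∈ A, ∀ L, L ≠ K → ∀ i j, (T.cell L).edge j = (T.cell K).edge i → L ∈ A

theorem IsStarMesh.closedUnion_inter_closedUnion_compl_subset (hT : T.IsStarMesh) (hΩ : IsOpen Ω)
    {A : Set (Fin T.N)} (hA : T.IsClosedUnderNeighbours A) :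
    Ω ∩ (T.closedUnion A ∩ T.closedUnion Aᶜ) ⊆ T.vertices := by
  rintro x ⟨hx, hxA, hxAc⟩
  by_contra hv
  obtain ⟨K, hK, hxK⟩ := mem_iUnion₂.1 hxA
  obtain ⟨L, hL, hxL⟩ := mem_iUnion₂.1 hxAc
  have hKL : K ≠ L := fun h => hL (h ▸ hK)
  obtain ⟨i, hi⟩ := SimplePolygon.exists_mem_edge hxK (notMem_of_mem_closure hKL hxL)
  rcases T.conforming K i with h | ⟨M, hM, j, hj⟩
  · exact (hΩ.frontier_eq ▸ h hi).2 hx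
  · have hML : M ≠ L := fun h => hL (h ▸ hA K hK M hM i j hj)
    obtain ⟨y, hy | hy, hyL⟩ := mem_closure_iff_nhds.1 hxL _
      (hT.eventually_mem_closure_union hM hj (mem_openSegment_of_notMem_vertices hi hv))
    · exact notMem_of_mem_closure hKL.symm hy hyL
    · exact notMem_of_mem_closure hML.symm hy hyL

theorem IsStarMesh.eq_univ_of_isClosedUnderNeighbours (hT : T.IsStarMesh) (hΩ : IsOpen Ω)
    (hc : IsPreconnected Ω) {A : Set (Fin T.N)} (hne : A.Nonempty)
    (hA : T.IsClosedUnderNeighbours A) : A = univ := by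
  have hrank : 1 < Module.rank ℝ Pt := Module.one_lt_rank_of_one_lt_finrank (by simp)
  obtain ⟨K, hK⟩ := hne
  rcases subset_or_subset_of_countable_inter hrank hΩ hc (isClosed_closedUnion A)
    (isClosed_closedUnion Aᶜ) (subset_closedUnion_union_compl A)
    (T.finite_vertices.subset (hT.closedUnion_inter_closedUnion_compl_subset hΩ hA)).countable
    with h | h
  · exact eq_univ_of_forall (mem_of_subset_closedUnion h)
  · exact absurd hK (mem_of_subset_closedUnion h K)

end PolygonalMesh

theorem disjoint_closure_of_isOpen_inter {X : Type*} [TopologicalSpace X] {A B S : Set X}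
    (hA : ∃ U, IsOpen U ∧ A = U ∩ S) (hB : B ⊆ S) (hd : Disjoint A B) :
    Disjoint A (closure B) := by
  obtain ⟨U, hU, rfl⟩ := hA
  have hUB : Disjoint U B := disjoint_left.2 fun x hx hxB => disjoint_left.1 hd ⟨hx, hB hxB⟩ hxB
  exact (hUB.closure_right hU).mono_left inter_subset_left

namespace IsBoundaryPartition

variable {Ω Γu Γσ : Set Pt}

theorem subset_frontier_u (h : IsBoundaryPartition Ω Γu Γσ) : Γu ⊆ frontier Ω := by
  obtain ⟨U, -, rfl⟩ := h.open_u
  exact inter_subset_right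

theorem subset_frontier_σ (h : IsBoundaryPartition Ω Γu Γσ) : Γσ ⊆ frontier Ω := by
  obtain ⟨U, -, rfl⟩ := h.open_σ
  exact inter_subset_right

theorem disjoint_closure_σ (h : IsBoundaryPartition Ω Γu Γσ) : Disjoint Γu (closure Γσ) :=
  disjoint_closure_of_isOpen_inter h.open_u h.subset_frontier_σ h.disjoint

theorem disjoint_closure_u (h : IsBoundaryPartition Ω Γu Γσ) : Disjoint Γσ (closure Γu) :=
  disjoint_closure_of_isOpen_inter h.open_σ h.subset_frontier_u h.disjoint.symm

end IsBoundaryPartition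

theorem PolygonalMesh.IsStarMesh.exists_edge_subset {Ω Γu Γσ : Set Pt} {T : PolygonalMesh Ω}
    (hT : T.IsStarMesh) (hΩ : interior (closure Ω) = Ω) (hΓ : IsBoundaryPartition Ω Γu Γσ)
    (hF : T.Fits Γu Γσ) : ∃ K i, (T.cell K).edge i ⊆ closure Γu := by
  obtain ⟨x, hx, hxv⟩ : ∃ x ∈ Γu, x ∉ T.vertices := by
    by_contra! h
    have := Measure.nullSingletonClass_hausdorff Pt (zero_lt_one (α := ℝ))
    exact hΓ.length_u.ne' ((T.finite_vertices.subset h).measure_zero _)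
  have hxf := hΓ.subset_frontier_u hx
  have hopen : IsOpen Ω := hΩ ▸ isOpen_interior
  have hxΩ : x ∉ Ω := (hopen.frontier_eq ▸ hxf).2
  obtain ⟨K, hK⟩ := T.exists_mem_closure_cell (frontier_subset_closure hxf)
  obtain ⟨i, hi⟩ := SimplePolygon.exists_mem_edge hK fun h => hxΩ (T.subset K h)
  refine ⟨K, i, ?_⟩
  rcases T.conforming K i with h | ⟨M, hM, j, hj⟩
  · exact (hF K i h).resolve_right fun hσ => disjoint_left.1 hΓ.disjoint_closure_σ hx (hσ hi)
  · have hint : x ∈ interior (closure Ω) := mem_interior_iff_mem_nhds.2 <| Filter.mem_of_superset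
      (hT.eventually_mem_closure_union hM hj (mem_openSegment_of_notMem_vertices hi hxv))
      (union_subset (closure_mono (T.subset K)) (closure_mono (T.subset M)))
    exact absurd (hΩ ▸ hint) hxΩ

/-! ### Piecewise polynomial fields -/

theorem polyEval_add (p q : MvPolynomial (Fin 2) ℝ) (x : Pt) :
    polyEval (p + q) x = polyEval p x + polyEval q x := by simp [polyEval]

theorem polyEval_sub (p q : MvPolynomial (Fin 2) ℝ) (x : Pt) :
    polyEval (p - q) x = polyEval p x - polyEval q x := by simp [polyEval]

theorem polyEval_smul (a : ℝ) (p : MvPolynomial (Fin 2) ℝ) (x : Pt) :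
    polyEval (a • p) x = a * polyEval p x := by simp [polyEval, MvPolynomial.smul_eval]

theorem polyEval_mul (p q : MvPolynomial (Fin 2) ℝ) (x : Pt) :
    polyEval (p * q) x = polyEval p x * polyEval q x := by simp [polyEval]

theorem polyEval_zero (x : Pt) : polyEval 0 x = 0 := by simp [polyEval]

theorem polyEval_C (a : ℝ) (x : Pt) : polyEval (MvPolynomial.C a) x = a := by simp [polyEval]

theorem polyEval_X (j : Fin 2) (x : Pt) : polyEval (MvPolynomial.X j) x = x j := by simp [polyEval]

theorem polyField_apply (p : Fin 2 → MvPolynomial (Fin 2) ℝ) (x : Pt) (i : Fin 2) :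
    polyField p x i = polyEval (p i) x := rfl

theorem contDiff_polyEval (p : MvPolynomial (Fin 2) ℝ) : ContDiff ℝ ∞ (polyEval p) := by
  induction p using MvPolynomial.induction_on with
  | C a =>
    rw [funext (polyEval_C a)]
    exact contDiff_const
  | add p q hp hq =>
    rw [funext (polyEval_add p q)]
    exact hp.add hq
  | mul_X p j hp =>
    simp_rw [funext (polyEval_mul p _), polyEval_X]
    exact hp.mul (by fun_prop)

theorem continuous_polyEval (p : MvPolynomial (Fin 2) ℝ) : Continuous (polyEval p) :=
  (contDiff_polyEval p).continuous

theorem hasFDerivAt_polyEval (p : MvPolynomial (Fin 2) ℝ) (x : Pt) :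
    HasFDerivAt (polyEval p) (fderiv ℝ (polyEval p) x) x :=
  ((contDiff_polyEval p).differentiable (by simp) x).hasFDerivAt

theorem pderiv_polyEval (j : Fin 2) (p : MvPolynomial (Fin 2) ℝ) (x : Pt) :
    pderiv j (polyEval p) x = polyEval (MvPolynomial.pderiv j p) x := by
  induction p using MvPolynomial.induction_on with
  | C a => simp [funext (polyEval_C a), pderiv, polyEval]
  | add p q hp hq =>
    have hadd : polyEval (p + q) = polyEval p + polyEval q := funext (polyEval_add p q)
    rw [hadd, pderiv_add (contDiff_polyEval p) (contDiff_polyEval q), hp, hq, map_add,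
      polyEval_add]
  | mul_X p l hp =>
    have hX : HasFDerivAt (fun x : Pt => x l) (EuclideanSpace.proj (𝕜 := ℝ) l : Pt →L[ℝ] ℝ) x :=
      (EuclideanSpace.proj (𝕜 := ℝ) l : Pt →L[ℝ] ℝ).hasFDerivAt
    have hmul : polyEval (p * MvPolynomial.X l) = polyEval p * fun x => x l := by
      ext x
      rw [polyEval_mul, polyEval_X, Pi.mul_apply]
    unfold pderiv at hp ⊢
    rw [hmul, ((hasFDerivAt_polyEval p x).mul hX).fderiv]
    rcases eq_or_ne j l with rfl | hjl
    · simp [hp, polyEval]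
    · simp [hp, polyEval, hjl.symm]

theorem totalDegree_pderiv_le {σ R : Type*} [CommSemiring R] {p : MvPolynomial σ R} {k : ℕ}
    (h : p.totalDegree ≤ k) (j : σ) : (MvPolynomial.pderiv j p).totalDegree ≤ k - 1 := by
  classical
  conv_lhs => rw [p.as_sum, map_sum]
  refine (MvPolynomial.totalDegree_finsetSum _ _).trans (Finset.sup_le fun s hs => ?_)
  rw [MvPolynomial.pderiv_monomial]
  by_cases hsj : s j = 0
  · simp [hsj]
  have hdegree : s.degree ≤ k := (MvPolynomial.le_totalDegree hs).trans h
  have hs' : s - Finsupp.single j 1 + Finsupp.single j 1 = s :=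
    tsub_add_cancel_of_le (Finsupp.single_le_iff.2 (Nat.one_le_iff_ne_zero.2 hsj))
  rw [← hs', map_add, Finsupp.degree_single] at hdegree
  exact (MvPolynomial.totalDegree_monomial_le _ _).trans (Nat.le_sub_of_add_le hdegree)

/-- The polynomials of total degree at most `k` in the coordinates of the plane. -/
abbrev Poly (k : ℕ) : Submodule ℝ (MvPolynomial (Fin 2) ℝ) :=
  MvPolynomial.restrictTotalDegree (Fin 2) ℝ k

theorem mem_Poly_iff {k : ℕ} {p : MvPolynomial (Fin 2) ℝ} : p ∈ Poly k ↔ p.totalDegree ≤ k :=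
  MvPolynomial.mem_restrictTotalDegree _ _ _

namespace SimplePolygon

variable (K : SimplePolygon)

theorem measurableSet : MeasurableSet K.carrier := K.isOpen.measurableSet

theorem memLp_polyEval {ι : Type*} [Fintype ι] (p : ι → MvPolynomial (Fin 2) ℝ) :
    MemLp (fun x => (WithLp.toLp 2 fun i => polyEval (p i) x : EuclideanSpace ℝ ι)) 2
      (volume.restrict K.carrier) :=
  memLp_restrict_of_isBounded K.isBounded
    ((PiLp.continuous_toLp 2 _).comp (continuous_pi fun i => continuous_polyEval (p i))) 2

end SimplePolygon

namespace PolygonalMesh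

variable {Ω : Set Pt} (T : PolygonalMesh Ω)

theorem iUnion_ae_eq : (⋃ K, (T.cell K).carrier) =ᵐ[volume] Ω := by
  refine (LE.le.eventuallyLE (iUnion_subset T.subset)).antisymm (ae_le_set.2 ?_)
  refine measure_mono_null (fun x hx => ?_)
    (measure_iUnion_null fun K => (T.cell K).volume_frontier)
  obtain ⟨K, hK⟩ := T.exists_mem_closure_cell (subset_closure hx.1)
  refine mem_iUnion.2 ⟨K, ?_⟩
  rw [(T.cell K).isOpen.frontier_eq]
  exact ⟨hK, fun h => hx.2 (mem_iUnion_of_mem K h)⟩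

theorem ae_restrict_iff (p : Pt → Prop) : (∀ᵐ x ∂(volume.restrict Ω), p x) ↔
    ∀ K, ∀ᵐ x ∂(volume.restrict (T.cell K).carrier), p x := by
  rw [← Measure.restrict_congr_set T.iUnion_ae_eq, ae_restrict_iUnion_iff]

theorem setIntegral_eq_sum {f : Pt → ℝ} (hf : ∀ K, IntegrableOn f (T.cell K).carrier) :
    ∫ x in Ω, f x = ∑ K, ∫ x in (T.cell K).carrier, f x := by
  rw [← setIntegral_congr_set T.iUnion_ae_eq]
  exact integral_iUnion_fintype (fun K => (T.cell K).measurableSet) T.disjoint hf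

theorem restrict_cell_le (K : Fin T.N) :
    volume.restrict (T.cell K).carrier ≤ volume.restrict Ω :=
  Measure.restrict_mono (T.subset K) le_rfl

section Glue

variable {E : Type*} [NormedAddCommGroup E]

theorem ext_of_cells {f g : Lp E 2 (volume.restrict Ω)}
    (h : ∀ K, f =ᵐ[volume.restrict (T.cell K).carrier] g) : f = g :=
  Lp.ext ((T.ae_restrict_iff _).2 h)

theorem memLp_sum_indicator {g : Fin T.N → Pt → E}
    (hg : ∀ K, MemLp (g K) 2 (volume.restrict (T.cell K).carrier)) :
    MemLp (fun x => ∑ K, (T.cell K).carrier.indicator (g K) x) 2 (volume.restrict Ω) :=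
  (memLp_finsetSum _ fun K _ =>
    (memLp_indicator_iff_restrict (T.cell K).measurableSet).2 (hg K)).restrict Ω

/-- The field on `Ω` which is equal to `g K` on the cell `K`. -/
def glue (g : Fin T.N → Pt → E) (hg : ∀ K, MemLp (g K) 2 (volume.restrict (T.cell K).carrier)) :
    Lp E 2 (volume.restrict Ω) :=
  (T.memLp_sum_indicator hg).toLp

theorem glue_ae_eq (g : Fin T.N → Pt → E)
    (hg : ∀ K, MemLp (g K) 2 (volume.restrict (T.cell K).carrier)) (K : Fin T.N) :
    T.glue g hg =ᵐ[volume.restrict (T.cell K).carrier] g K := by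
  filter_upwards [ae_mono (T.restrict_cell_le K) (T.memLp_sum_indicator hg).coeFn_toLp,
    ae_restrict_mem (T.cell K).measurableSet] with x hx hxK
  refine hx.trans ?_
  rw [Finset.sum_eq_single K, indicator_of_mem hxK]
  · exact fun L _ hL => indicator_of_notMem (disjoint_right.1 (T.disjoint L K hL) hxK) _
  · simp

end Glue

section PiecewisePoly

variable {k : ℕ} {ι : Type} [Fintype ι]

theorem memLp_polyEval_cell (p : Fin T.N → ι → Poly k) (K : Fin T.N) :
    MemLp (fun x => (WithLp.toLp 2 fun i => polyEval (p K i) x : EuclideanSpace ℝ ι)) 2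
      (volume.restrict (T.cell K).carrier) :=
  (T.cell K).memLp_polyEval fun i => p K i

variable (k ι) in
/-- The field whose components on each cell are given polynomials. -/
def gluePoly : (Fin T.N → ι → Poly k) →ₗ[ℝ] Lp (EuclideanSpace ℝ ι) 2 (volume.restrict Ω) where
  toFun p := T.glue _ (T.memLp_polyEval_cell p)
  map_add' p q := T.ext_of_cells fun K => by
    filter_upwards [T.glue_ae_eq _ (T.memLp_polyEval_cell p) K,
      T.glue_ae_eq _ (T.memLp_polyEval_cell q) K,
      T.glue_ae_eq _ (T.memLp_polyEval_cell (p + q)) K, ae_mono (T.restrict_cell_le K)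
        (Lp.coeFn_add (E := EuclideanSpace ℝ ι) _ _)] with x hp hq hpq hadd
    rw [hadd, Pi.add_apply, hp, hq, hpq]
    ext i
    exact polyEval_add _ _ x
  map_smul' a p := T.ext_of_cells fun K => by
    filter_upwards [T.glue_ae_eq _ (T.memLp_polyEval_cell p) K,
      T.glue_ae_eq _ (T.memLp_polyEval_cell (a • p)) K, ae_mono (T.restrict_cell_le K)
        (Lp.coeFn_smul (E := EuclideanSpace ℝ ι) a _)] with x hp hap hsmul
    rw [RingHom.id_apply, hsmul, Pi.smul_apply, hp, hap]
    ext i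
    exact polyEval_smul _ _ x

variable (k ι) in
/-- The fields with polynomial components of degree at most `k` on each cell. -/
def piecewisePoly : Submodule ℝ (Lp (EuclideanSpace ℝ ι) 2 (volume.restrict Ω)) :=
  LinearMap.range (T.gluePoly k ι)

instance finiteDimensional_piecewisePoly : FiniteDimensional ℝ (T.piecewisePoly k ι) :=
  LinearMap.finiteDimensional_range _

theorem mem_piecewisePoly_iff {v : Lp (EuclideanSpace ℝ ι) 2 (volume.restrict Ω)} :
    v ∈ T.piecewisePoly k ι ↔
      ∀ K, ∃ p : ι → MvPolynomial (Fin 2) ℝ, (∀ i, (p i).totalDegree ≤ k) ∧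
        ∀ᵐ x ∂(volume.restrict (T.cell K).carrier), ∀ i, v x i = polyEval (p i) x := by
  constructor
  · rintro ⟨p, rfl⟩ K
    refine ⟨fun i => p K i, fun i => mem_Poly_iff.1 (p K i).2, ?_⟩
    filter_upwards [T.glue_ae_eq _ (T.memLp_polyEval_cell p) K]
      with x hx i
    exact congrArg (· i) hx
  · intro h
    choose p hp hv using h
    refine ⟨fun K i => ⟨p K i, mem_Poly_iff.2 (hp K i)⟩, T.ext_of_cells fun K => ?_⟩
    filter_upwards [T.glue_ae_eq _ (fun K => (T.cell K).memLp_polyEval (p K)) K, hv K]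
      with x hx hvx
    exact hx.trans (PiLp.ext fun i => (hvx i).symm)

end PiecewisePoly

end PolygonalMesh

/-! ### Weak derivatives of tensor fields -/

section Rows

variable {Ω U : Set Pt} {φ : Pt → ℝ}

/-- The `i`-th row of a tensor, a vector: weak divergence, weak curl and normal trace all act on
the rows separately. -/
def row (i : Fin 2) : Ten →L[ℝ] Pt :=
  (EuclideanSpace.equiv (Fin 2) ℝ).symm.toContinuousLinearMap ∘L
    ContinuousLinearMap.pi fun j => EuclideanSpace.proj (i, j)

theorem row_apply (i j : Fin 2) (a : Ten) : row i a j = a (i, j) := rfl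

theorem normalPairing_eq (U : Set Pt) (τ : Pt → Ten) (f : Pt → Pt) (φ : Pt → ℝ) (i : Fin 2) :
    normalPairing U τ f φ i = ∫ x in U, (f x i * φ x + inner ℝ (row i (τ x)) (grad φ x)) := by
  simp only [normalPairing, inner_grad, row_apply]

theorem isWeakCurl_iff {τ : Pt → Ten} {c : Pt → Pt} :
    IsWeakCurl U τ c ↔ ∀ φ ∈ testSpaceIn U, ∀ i : Fin 2,
      ∫ x in U, inner ℝ (row i (τ x)) (rot φ x) = -∫ x in U, c x i * φ x := by
  simp only [inner_rot, row_apply]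
  exact ⟨fun h φ hφ => h φ hφ.1 hφ.2, fun h φ h₁ h₂ => h φ ⟨h₁, h₂⟩⟩

/-- The linear functional `τ ↦ ∫_U τᵢ · w` on `L²(Ω)`, where `τᵢ` is the `i`-th row of `τ`. -/
def rowPairing (Ω : Set Pt) (i : Fin 2) (hU : MeasurableSet U) {w : Pt → Pt}
    (hw : MemLp w 2 volume) : L2Ten Ω →L[ℝ] ℝ :=
  innerSL ℝ (((hw.indicator hU).restrict Ω).toLp) ∘L (row i).compLpL 2 (volume.restrict Ω)

theorem rowPairing_apply (hUΩ : U ⊆ Ω) (i : Fin 2) (hU : MeasurableSet U) {w : Pt → Pt}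
    (hw : MemLp w 2 volume) (τ : L2Ten Ω) :
    rowPairing Ω i hU hw τ = ∫ x in U, inner ℝ (row i (τ x)) (w x) := by
  have hind : ∀ x, inner ℝ (U.indicator w x) (row i (τ x)) =
      U.indicator (fun x => inner ℝ (row i (τ x)) (w x)) x := fun x => by
    by_cases hx : x ∈ U
    · rw [indicator_of_mem hx, indicator_of_mem hx, real_inner_comm]
    · rw [indicator_of_notMem hx, indicator_of_notMem hx, inner_zero_left]
  change inner ℝ _ ((row i).compLp τ) = _
  rw [inner_L2_eq_integral _ _ (MemLp.coeFn_toLp _) ((row i).coeFn_compLp τ)]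
  simp only [hind]
  rw [setIntegral_indicator hU, inter_eq_self_of_subset_right hUΩ]

theorem integrableOn_inner_row_grad (hUΩ : U ⊆ Ω) (hφ : IsTest φ) (τ : L2Ten Ω) (i : Fin 2) :
    IntegrableOn (fun x => inner ℝ (row i (τ x)) (grad φ x)) U := by
  refine IntegrableOn.mono_set ?_ hUΩ
  refine (integrableOn_inner_grad ((row i).compLp τ) hφ).congr ?_
  filter_upwards [(row i).coeFn_compLp τ] with x hx
  rw [hx]

theorem integrableOn_apply_mul (hφ : IsTest φ) (f : L2Vec Ω) (i : Fin 2) :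
    IntegrableOn (fun x => f x i * φ x) Ω := by
  have hf : MemLp (fun x => f x i) 2 (volume.restrict Ω) := (Lp.memLp f).eval_piLp i
  exact hf.integrable_mul (hφ.memLp.restrict Ω)

theorem normalPairing_eq_add (hUΩ : U ⊆ Ω) (hφ : IsTest φ) (τ : L2Ten Ω) {f : Pt → Pt}
    {i : Fin 2} (hf : IntegrableOn (fun x => f x i * φ x) U) :
    normalPairing U τ f φ i =
      (∫ x in U, f x i * φ x) + ∫ x in U, inner ℝ (row i (τ x)) (grad φ x) := by
  rw [normalPairing_eq, integral_add hf (integrableOn_inner_row_grad hUΩ hφ τ i)]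

theorem isWeakDiv_iff_normalPairing (hUΩ : U ⊆ Ω) (τ : L2Ten Ω) {f : Pt → Pt}
    (hf : ∀ φ, IsTest φ → ∀ i, IntegrableOn (fun x => f x i * φ x) U) :
    IsWeakDiv U τ f ↔
      ∀ φ, IsTest φ → tsupport φ ⊆ U → ∀ i : Fin 2, normalPairing U τ f φ i = 0 := by
  refine forall₄_congr fun φ hφ _ i => ?_
  rw [normalPairing_eq_add hUΩ hφ τ (hf φ hφ i), add_comm, add_eq_zero_iff_eq_neg]
  simp only [inner_grad, row_apply]

theorem IsWeakDiv.congr {τ τ' : Pt → Ten} {f f' : Pt → Pt} (h : IsWeakDiv U τ f)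
    (hτ : τ =ᵐ[volume.restrict U] τ') (hf : f =ᵐ[volume.restrict U] f') : IsWeakDiv U τ' f' := by
  intro φ hφ hU i
  have hleft : ∫ x in U, ∑ j : Fin 2, τ' x (i, j) * pderiv j φ x =
      ∫ x in U, ∑ j : Fin 2, τ x (i, j) * pderiv j φ x := integral_congr_ae <| by
    filter_upwards [hτ] with x hx
    rw [hx]
  have hright : ∫ x in U, f' x i * φ x = ∫ x in U, f x i * φ x := integral_congr_ae <| by
    filter_upwards [hf] with x hx
    rw [hx]
  rw [hleft, hright]
  exact h φ hφ hU i

theorem IsWeakDiv.ae_eq (hU : IsOpen U) {τ : Pt → Ten} {f g : Pt → Pt}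
    (hf : IsWeakDiv U τ f) (hg : IsWeakDiv U τ g) (hτ : MemLp τ 2 (volume.restrict U))
    (hf2 : MemLp f 2 (volume.restrict U)) (hg2 : MemLp g 2 (volume.restrict U)) :
    f =ᵐ[volume.restrict U] g :=
  (MemLp.toLp_eq_toLp_iff hf2 hg2).1 <|
    (divergence_eq hU (hf.congr hτ.coeFn_toLp.symm hf2.coeFn_toLp.symm)).symm.trans
      (divergence_eq hU (hg.congr hτ.coeFn_toLp.symm hg2.coeFn_toLp.symm))

theorem IsWeakDiv.mono {W : Set Pt} (hUW : U ⊆ W) {τ : Pt → Ten} {f : Pt → Pt}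
    (h : IsWeakDiv W τ f) : IsWeakDiv U τ f := by
  intro φ hφ hU i
  have hint : ∀ g : Pt → ℝ, (∀ x ∉ tsupport φ, g x = 0) → ∫ x in U, g x = ∫ x in W, g x :=
    fun g hg => by
      rw [setIntegral_eq_integral_of_forall_compl_eq_zero fun x hx => hg x fun h => hx (hU h),
        setIntegral_eq_integral_of_forall_compl_eq_zero fun x hx => hg x fun h =>
          hx (hUW (hU h))]
  rw [hint _ fun x hx => by simp [pderiv_eq_zero_of_notMem hx],
    hint _ fun x hx => by rw [image_eq_zero_of_notMem_tsupport hx, mul_zero]]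
  exact h φ hφ (hU.trans hUW) i

end Rows

/-! ### The discrete stress space -/

namespace SimplePolygon

variable {K : SimplePolygon}

theorem edge_subset_closure (e : Fin K.n) : K.edge e ⊆ closure K.carrier :=
  (K.edge_subset_frontier e).trans frontier_subset_closure

theorem edgeIntegral_congr {e : Fin K.n} {g g' : Pt → ℝ} (h : EqOn g g' (K.edge e)) :
    K.edgeIntegral e g = K.edgeIntegral e g' := by
  unfold edgeIntegral
  congr 1
  refine intervalIntegral.integral_congr fun t ht => h ?_
  rw [edge, segment_eq_image_lineMap]
  exact mem_image_of_mem _ (uIcc_of_le (zero_le_one (α := ℝ)) ▸ ht)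

theorem edgeIntegral_zero (e : Fin K.n) : K.edgeIntegral e (fun _ => 0) = 0 := by
  simp [edgeIntegral]

variable (K) in
/-- The integral over a polygon of the product of a polynomial with `φ`. -/
def cellPairing {φ : Pt → ℝ} (hφ : Continuous φ) : MvPolynomial (Fin 2) ℝ →ₗ[ℝ] ℝ where
  toFun p := ∫ x in K.carrier, polyEval p x * φ x
  map_add' p q := by
    simp_rw [polyEval_add, add_mul]
    exact integral_add (integrableOn_mul_of_isBounded K.isBounded (continuous_polyEval p) hφ)
      (integrableOn_mul_of_isBounded K.isBounded (continuous_polyEval q) hφ)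
  map_smul' a p := by
    simp_rw [polyEval_smul, mul_assoc]
    exact integral_const_mul _ _

/-- The integral over an edge of the product of a polynomial with `φ`. -/
def edgePairing (e : Fin K.n) {φ : Pt → ℝ} (hφ : Continuous φ) :
    MvPolynomial (Fin 2) ℝ →ₗ[ℝ] ℝ where
  toFun p := K.edgeIntegral e fun x => polyEval p x * φ x
  map_add' p q := by
    simp_rw [edgeIntegral, polyEval_add, add_mul]
    rw [intervalIntegral.integral_add
      (intervalIntegrable_mul_lineMap (continuous_polyEval p) hφ _ _)
      (intervalIntegrable_mul_lineMap (continuous_polyEval q) hφ _ _), mul_add]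
  map_smul' a p := by
    simp_rw [edgeIntegral, polyEval_smul, mul_assoc, intervalIntegral.integral_const_mul]
    exact mul_left_comm _ _ _

end SimplePolygon

/-- Test functions whose support meets the boundary of `Ω` only within `Γσ`. -/
def IsStarTest (Ω Γσ : Set Pt) (φ : Pt → ℝ) : Prop := IsTest φ ∧ tsupport φ ∩ frontier Ω ⊆ Γσ

theorem IsTest.isStarTest {Ω : Set Pt} (hΩ : IsOpen Ω) {φ : Pt → ℝ} (hφ : IsTest φ)
    (hs : tsupport φ ⊆ Ω) (Γσ : Set Pt) : IsStarTest Ω Γσ φ :=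
  ⟨hφ, fun _ hx => absurd (hs hx.1) (hΩ.frontier_eq ▸ hx.2).2⟩

section StressSpace

variable {Ω Γσ : Set Pt} {k : ℕ} {T : PolygonalMesh Ω}

/-- The polynomials which describe a discrete stress: its curl and its divergence on every cell, and
its normal trace on every edge of every cell. -/
abbrev StressData (k : ℕ) (T : PolygonalMesh Ω) : Type :=
  (Fin T.N → Fin 2 → Poly (k - 1)) × (Fin T.N → Fin 2 → Poly k) ×
    ((K : Fin T.N) → Fin (T.cell K).n → Fin 2 → Poly k)

namespace StressData

/-- The curl on the cell `K`. -/
abbrev curl (d : StressData k T) (K : Fin T.N) (i : Fin 2) : MvPolynomial (Fin 2) ℝ := d.1 K i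

/-- The divergence on the cell `K`. -/
abbrev div (d : StressData k T) (K : Fin T.N) (i : Fin 2) : MvPolynomial (Fin 2) ℝ := d.2.1 K i

/-- The normal trace on the edge `e` of the cell `K`, from inside of `K`. -/
abbrev trace (d : StressData k T) (K : Fin T.N) (e : Fin (T.cell K).n) (i : Fin 2) :
    MvPolynomial (Fin 2) ℝ := d.2.2 K e i

/-- The sum over all cells `K` of the boundary integrals of the normal trace times `φ K`. -/
def traceSum {φ : Fin T.N → Pt → ℝ} (hφ : ∀ K, Continuous (φ K)) (i : Fin 2) :
    StressData k T →ₗ[ℝ] ℝ where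
  toFun d := ∑ K, ∑ e, (T.cell K).edgePairing e (hφ K) (d.trace K e i)
  map_add' d d' := by
    simp only [← Finset.sum_add_distrib]
    exact Finset.sum_congr rfl fun K _ => Finset.sum_congr rfl fun e _ => map_add _ _ _
  map_smul' a d := by
    simp only [Finset.smul_sum]
    exact Finset.sum_congr rfl fun K _ => Finset.sum_congr rfl fun e _ => map_smul _ _ _

/-- The data whose normal traces cancel between neighbouring cells and vanish on `Γσ`, in the
weak form. -/
def conforming (k : ℕ) (T : PolygonalMesh Ω) (Γσ : Set Pt) : Submodule ℝ (StressData k T) where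
  carrier := {d | ∀ φ (hφ : IsStarTest Ω Γσ φ) i,
    traceSum (fun _ => hφ.1.1.continuous) i d = 0}
  add_mem' hd hd' φ hφ i := by rw [map_add, hd φ hφ i, hd' φ hφ i, add_zero]
  zero_mem' _ _ _ := map_zero _
  smul_mem' a d hd φ hφ i := by rw [map_smul, hd φ hφ i, smul_zero]

end StressData

/-- The data `d` are the curl, the divergence and the normal trace of `τ` on every cell. -/
structure HasData (d : StressData k T) (τ : L2Ten Ω) : Prop where
  curl : ∀ K, ∀ φ ∈ testSpaceIn (T.cell K).carrier, ∀ i,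
    ∫ x in (T.cell K).carrier, inner ℝ (row i (τ x)) (rot φ x) =
      -∫ x in (T.cell K).carrier, polyEval (d.curl K i) x * φ x
  normal : ∀ K, ∀ φ, IsTest φ → ∀ i,
    ∫ x in (T.cell K).carrier,
        (polyEval (d.div K i) x * φ x + inner ℝ (row i (τ x)) (grad φ x)) =
      ∑ e, (T.cell K).edgeIntegral e (fun x => polyEval (d.trace K e i) x * φ x)

namespace HasData

variable {d : StressData k T} {τ : L2Ten Ω}

theorem isWeakDiv_cell (h : HasData d τ) (K : Fin T.N) :
    IsWeakDiv (T.cell K).carrier τ (polyField (d.div K)) := by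
  rw [isWeakDiv_iff_normalPairing (T.subset K) τ fun φ hφ i =>
    integrableOn_mul_of_isBounded (T.cell K).isBounded (continuous_polyEval _) hφ.1.continuous]
  intro φ hφ hs i
  rw [normalPairing_eq]
  refine (h.normal K φ hφ i).trans (Finset.sum_eq_zero fun e _ => ?_)
  rw [SimplePolygon.edgeIntegral_congr (g' := fun _ => 0) fun x hx => ?_,
    SimplePolygon.edgeIntegral_zero]
  have hx' := (T.cell K).edge_subset_frontier e hx
  rw [(T.cell K).isOpen.frontier_eq] at hx'
  simp [image_eq_zero_of_notMem_tsupport fun h => hx'.2 (hs h)]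

theorem isLocalStress (h : HasData d τ) (K : Fin T.N) : IsLocalStress k (T.cell K) τ :=
  ⟨(Lp.memLp τ).mono_measure (T.restrict_cell_le K),
    ⟨d.curl K, fun i => mem_Poly_iff.1 (d.1 K i).2, isWeakCurl_iff.2 (h.curl K)⟩,
    d.div K, fun i => mem_Poly_iff.1 (d.2.1 K i).2, h.isWeakDiv_cell K,
    d.trace K, fun e i => mem_Poly_iff.1 (d.2.2 K e i).2, fun φ hφ i =>
      (normalPairing_eq _ _ _ _ _).trans (h.normal K φ hφ i)⟩

theorem normalPairing_eq_sum (h : HasData d τ) {f : L2Vec Ω}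
    (hf : ∀ K, f =ᵐ[volume.restrict (T.cell K).carrier] polyField (d.div K)) {φ : Pt → ℝ}
    (hφ : IsTest φ) (i : Fin 2) : normalPairing Ω τ f φ i =
      ∑ K, ∑ e, (T.cell K).edgeIntegral e (fun x => polyEval (d.trace K e i) x * φ x) := by
  have hint : IntegrableOn (fun x => f x i * φ x + inner ℝ (row i (τ x)) (grad φ x)) Ω :=
    (integrableOn_apply_mul hφ f i).add (integrableOn_inner_row_grad subset_rfl hφ τ i)
  rw [normalPairing_eq, T.setIntegral_eq_sum fun K => hint.mono_set (T.subset K)]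
  refine Finset.sum_congr rfl fun K _ => ?_
  rw [← h.normal K φ hφ i]
  refine integral_congr_ae ?_
  filter_upwards [hf K] with x hx
  rw [hx, polyField_apply]

theorem exists_isWeakDiv (h : HasData d τ) (hΩ : IsOpen Ω)
    (hd : d ∈ StressData.conforming k T Γσ) :
    ∃ f : L2Vec Ω, IsWeakDiv Ω τ f ∧
      ∀ K, f =ᵐ[volume.restrict (T.cell K).carrier] polyField (d.div K) := by
  have hf := T.glue_ae_eq _ fun K => (T.cell K).memLp_polyEval (d.div K)
  refine ⟨_, (isWeakDiv_iff_normalPairing subset_rfl τ fun φ hφ i =>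
    integrableOn_apply_mul hφ _ i).2 fun φ hφ hs i => ?_, hf⟩
  exact (h.normalPairing_eq_sum hf hφ i).trans (hd φ (hφ.isStarTest hΩ hs Γσ) i)

theorem divergence_ae_eq (h : HasData d τ) (hΩ : IsOpen Ω)
    (hd : d ∈ StressData.conforming k T Γσ) (K : Fin T.N) :
    divergence τ =ᵐ[volume.restrict (T.cell K).carrier] polyField (d.div K) := by
  obtain ⟨f, hf, hcell⟩ := h.exists_isWeakDiv hΩ hd
  rw [divergence_eq hΩ hf]
  exact hcell K

theorem mem_stressSpace (h : HasData d τ) (hΩ : IsOpen Ω)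
    (hd : d ∈ StressData.conforming k T Γσ) : τ ∈ stressSpace k T Γσ := by
  obtain ⟨f, hf, -⟩ := h.exists_isWeakDiv hΩ hd
  exact ⟨⟨⟨f, hf⟩, fun φ hφ hs i =>
    (h.normalPairing_eq_sum (h.divergence_ae_eq hΩ hd) hφ i).trans (hd φ ⟨hφ, hs⟩ i)⟩,
    h.isLocalStress⟩

end HasData

theorem mem_stressSpace_iff (hΩ : IsOpen Ω) {τ : L2Ten Ω} :
    τ ∈ stressSpace k T Γσ ↔ ∃ d ∈ StressData.conforming k T Γσ, HasData d τ := by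
  refine ⟨fun ⟨⟨hdiv, hstar⟩, hlocal⟩ => ?_, fun ⟨d, hd, h⟩ => h.mem_stressSpace hΩ hd⟩
  simp only [IsLocalStress] at hlocal
  choose hL hcurl f hf hwd q hq hnormal using hlocal
  choose c hc hcurl using hcurl
  let d : StressData k T := ⟨fun K i => ⟨c K i, mem_Poly_iff.2 (hc K i)⟩,
    fun K i => ⟨f K i, mem_Poly_iff.2 (hf K i)⟩, fun K e i => ⟨q K e i, mem_Poly_iff.2 (hq K e i)⟩⟩
  have hd : HasData d τ := ⟨fun K => isWeakCurl_iff.1 (hcurl K), fun K φ hφ i =>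
    (normalPairing_eq _ _ _ _ _).symm.trans (hnormal K φ hφ i)⟩
  have hcell : ∀ K, divergence τ =ᵐ[volume.restrict (T.cell K).carrier] polyField (f K) :=
    fun K => ((isWeakDiv_divergence hdiv).mono (T.subset K)).ae_eq (T.cell K).isOpen (hwd K)
      (hL K) ((Lp.memLp _).mono_measure (T.restrict_cell_le K)) ((T.cell K).memLp_polyEval (f K))
  exact ⟨d, fun φ hφ i => (hd.normalPairing_eq_sum hcell hφ.1 i).symm.trans
    (hstar φ hφ.1 hφ.2 i), hd⟩

/-- The values of the functionals which determine curl, divergence and normal trace on the cells. -/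
abbrev TestValues (T : PolygonalMesh Ω) : Type :=
  ((K : Fin T.N) → testSpaceIn (T.cell K).carrier → Fin 2 → ℝ) ×
    (Fin T.N → testSpace → Fin 2 → ℝ)

/-- The integrals of the rows of a tensor field against `rot φ` and `grad φ` on the cells. -/
def fieldValues (T : PolygonalMesh Ω) : L2Ten Ω →L[ℝ] TestValues T :=
  (ContinuousLinearMap.pi fun K => ContinuousLinearMap.pi fun φ => ContinuousLinearMap.pi fun i =>
    rowPairing Ω i (T.cell K).measurableSet φ.2.1.memLp_rot).prod
  (ContinuousLinearMap.pi fun K => ContinuousLinearMap.pi fun φ => ContinuousLinearMap.pi fun i =>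
    rowPairing Ω i (T.cell K).measurableSet (IsTest.memLp_grad φ.2))

/-- The values which `fieldValues` takes on a field with given curl, divergence and normal trace. -/
def dataValues (k : ℕ) (T : PolygonalMesh Ω) : StressData k T →ₗ[ℝ] TestValues T where
  toFun d := ⟨fun K φ i => -(T.cell K).cellPairing φ.2.1.1.continuous (d.curl K i),
    fun K φ i => (∑ e, (T.cell K).edgePairing e φ.2.1.continuous (d.trace K e i)) -
      (T.cell K).cellPairing φ.2.1.continuous (d.div K i)⟩
  map_add' d d' := by
    refine Prod.ext ?_ ?_
    · funext K φ i
      exact (congrArg Neg.neg (map_add _ _ _)).trans (neg_add _ _)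
    · funext K φ i
      refine (congrArg₂ (· - ·) (Finset.sum_congr rfl fun e _ => map_add _ _ _)
        (map_add _ _ _)).trans ?_
      simp only [Finset.sum_add_distrib]
      exact add_sub_add_comm _ _ _ _
  map_smul' a d := by
    refine Prod.ext ?_ ?_
    · funext K φ i
      exact (congrArg Neg.neg (map_smul _ _ _)).trans (smul_neg _ _).symm
    · funext K φ i
      refine (congrArg₂ (· - ·) (Finset.sum_congr rfl fun e _ => map_smul _ _ _)
        (map_smul _ _ _)).trans ?_
      simp only [← Finset.smul_sum]
      exact (smul_sub _ _ _).symm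

theorem fieldValues_eq_dataValues_iff {d : StressData k T} {τ : L2Ten Ω} :
    fieldValues T τ = dataValues k T d ↔ HasData d τ := by
  have hcurl : (fieldValues T τ).1 = (dataValues k T d).1 ↔
      ∀ K, ∀ φ ∈ testSpaceIn (T.cell K).carrier, ∀ i,
        ∫ x in (T.cell K).carrier, inner ℝ (row i (τ x)) (rot φ x) =
          -∫ x in (T.cell K).carrier, polyEval (d.curl K i) x * φ x := by
    simp only [funext_iff, Subtype.forall]
    refine forall₄_congr fun K φ hφ i => ?_
    rw [← rowPairing_apply (T.subset K) i (T.cell K).measurableSet hφ.1.memLp_rot]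
    rfl
  have hnormal : (fieldValues T τ).2 = (dataValues k T d).2 ↔ ∀ K, ∀ φ, IsTest φ → ∀ i,
      ∫ x in (T.cell K).carrier,
          (polyEval (d.div K i) x * φ x + inner ℝ (row i (τ x)) (grad φ x)) =
        ∑ e, (T.cell K).edgeIntegral e (fun x => polyEval (d.trace K e i) x * φ x) := by
    simp only [funext_iff, Subtype.forall]
    refine forall₄_congr fun K φ hφ i => ?_
    rw [integral_add (integrableOn_mul_of_isBounded (T.cell K).isBounded (continuous_polyEval _)
      hφ.1.continuous) (integrableOn_inner_row_grad (T.subset K) hφ τ i), add_comm,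
      ← eq_sub_iff_add_eq,
      ← rowPairing_apply (T.subset K) i (T.cell K).measurableSet (IsTest.memLp_grad hφ)]
    rfl
  rw [Prod.ext_iff, hcurl, hnormal]
  exact ⟨fun h => ⟨h.1, h.2⟩, fun h => ⟨h.curl, h.normal⟩⟩

/-- The space `S_h` as a subspace of `L²(Ω)`. -/
def stressSubmodule (k : ℕ) (T : PolygonalMesh Ω) (Γσ : Set Pt) : Submodule ℝ (L2Ten Ω) :=
  ((StressData.conforming k T Γσ).map (dataValues k T)).comap (fieldValues T).toLinearMap

theorem isClosed_stressSubmodule (k : ℕ) (T : PolygonalMesh Ω) (Γσ : Set Pt) :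
    IsClosed (stressSubmodule k T Γσ : Set (L2Ten Ω)) :=
  ((StressData.conforming k T Γσ).map (dataValues k T)).closed_of_finiteDimensional.preimage
    (fieldValues T).continuous

theorem mem_stressSubmodule_iff (hΩ : IsOpen Ω) {τ : L2Ten Ω} :
    τ ∈ stressSubmodule k T Γσ ↔ τ ∈ stressSpace k T Γσ := by
  rw [mem_stressSpace_iff hΩ]
  exact exists_congr fun d => and_congr_right fun _ =>
    eq_comm.trans fieldValues_eq_dataValues_iff

theorem exists_mem_stressSpace (hΩ : IsOpen Ω) {d : StressData k T}
    (hd : d ∈ StressData.conforming k T Γσ) (t : (K : Fin T.N) → Fin 2 → L2Vec (T.cell K).carrier)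
    (hcurl : ∀ K, ∀ φ ∈ testSpaceIn (T.cell K).carrier, ∀ i,
      ∫ x in (T.cell K).carrier, inner ℝ (t K i x) (rot φ x) =
        -∫ x in (T.cell K).carrier, polyEval (d.curl K i) x * φ x)
    (hnormal : ∀ K, ∀ φ, IsTest φ → ∀ i,
      ∫ x in (T.cell K).carrier, (polyEval (d.div K i) x * φ x + inner ℝ (t K i x) (grad φ x)) =
        ∑ e, (T.cell K).edgeIntegral e (fun x => polyEval (d.trace K e i) x * φ x)) :
    ∃ τ ∈ stressSpace k T Γσ, ∀ K,
      (∀ᵐ x ∂(volume.restrict (T.cell K).carrier), ∀ i, row i (τ x) = t K i x) ∧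
      divergence τ =ᵐ[volume.restrict (T.cell K).carrier] polyField (d.div K) := by
  have hmem : ∀ K, MemLp (fun x => (WithLp.toLp 2 fun p => t K p.1 x p.2 : Ten)) 2
      (volume.restrict (T.cell K).carrier) := fun K =>
    memLp_piLp_iff.2 fun p => (Lp.memLp (t K p.1)).eval_piLp p.2
  set τ : L2Ten Ω := T.glue _ hmem
  have hrow : ∀ K, ∀ᵐ x ∂(volume.restrict (T.cell K).carrier), ∀ i, row i (τ x) = t K i x := by
    intro K
    filter_upwards [T.glue_ae_eq _ hmem K] with x hx i
    rw [hx]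
    rfl
  have hdata : HasData d τ := by
    refine ⟨fun K φ hφ i => ?_, fun K φ hφ i => ?_⟩
    · rw [← hcurl K φ hφ i]
      refine integral_congr_ae ?_
      filter_upwards [hrow K] with x hx
      rw [hx]
    · rw [← hnormal K φ hφ i]
      refine integral_congr_ae ?_
      filter_upwards [hrow K] with x hx
      rw [hx]
  exact ⟨τ, hdata.mem_stressSpace hΩ hd, fun K => ⟨hrow K, hdata.divergence_ae_eq hΩ hd K⟩⟩

end StressSpace

/-! ### Integrals over edges -/

theorem segment_eq_segment {E : Type*} [AddCommGroup E] [Module ℝ E] {P Q P' Q' : E} (h : P ≠ Q)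
    (he : segment ℝ P' Q' = segment ℝ P Q) : (P' = P ∧ Q' = Q) ∨ (P' = Q ∧ Q' = P) := by
  set f : ℝ →ᵃ[ℝ] E := AffineMap.lineMap P Q
  have h0 : f 0 = P := AffineMap.lineMap_apply_zero P Q
  have h1 : f 1 = Q := AffineMap.lineMap_apply_one P Q
  have hP' : P' ∈ segment ℝ P Q := he ▸ left_mem_segment ℝ P' Q'
  have hQ' : Q' ∈ segment ℝ P Q := he ▸ right_mem_segment ℝ P' Q'
  rw [segment_eq_image_lineMap] at hP' hQ'
  obtain ⟨α, -, rfl⟩ := hP'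
  obtain ⟨β, -, rfl⟩ := hQ'
  have hIcc : Icc (α ⊓ β) (α ⊔ β) = Icc 0 1 := by
    refine (AffineMap.lineMap_injective ℝ h).image_injective ?_
    change f '' uIcc α β = f '' Icc 0 1
    rw [← uIcc_of_le zero_le_one, ← segment_eq_uIcc, ← segment_eq_uIcc, image_segment,
      image_segment, h0, h1]
    exact he
  have hinf := congrArg sInf hIcc
  have hsup := congrArg sSup hIcc
  rw [csInf_Icc inf_le_sup, csInf_Icc zero_le_one] at hinf
  rw [csSup_Icc inf_le_sup, csSup_Icc zero_le_one] at hsup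
  rcases le_total α β with hαβ | hβα
  · rw [inf_eq_left.2 hαβ] at hinf
    rw [sup_eq_right.2 hαβ] at hsup
    exact Or.inl ⟨hinf ▸ h0, hsup ▸ h1⟩
  · rw [inf_eq_right.2 hβα] at hinf
    rw [sup_eq_left.2 hβα] at hsup
    exact Or.inr ⟨hsup ▸ h1, hinf ▸ h0⟩

namespace SimplePolygon

variable {K L : SimplePolygon}

theorem edgeIntegral_eq_of_edge_eq {i : Fin K.n} {j : Fin L.n} (h : L.edge j = K.edge i)
    (g : Pt → ℝ) : L.edgeIntegral j g = K.edgeIntegral i g := by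
  unfold edgeIntegral edgeLength
  rcases segment_eq_segment (K.vertex_ne i) h with ⟨h₁, h₂⟩ | ⟨h₁, h₂⟩
  · rw [h₁, h₂]
  · simp_rw [h₁, h₂, dist_comm (K.vertex (finRotate K.n i)),
      ← AffineMap.lineMap_apply_one_sub (K.vertex i)]
    congr 1
    rw [intervalIntegral.integral_comp_sub_left fun s =>
      g (AffineMap.lineMap (K.vertex i) (K.vertex (finRotate K.n i)) s), sub_self, sub_zero]

variable {e : Fin K.n} {g : Pt → ℝ}

theorem edgeIntegral_nonneg (h : ∀ x, 0 ≤ g x) : 0 ≤ K.edgeIntegral e g :=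
  mul_nonneg dist_nonneg (intervalIntegral.integral_nonneg zero_le_one fun _ _ => h _)

theorem eqOn_zero_of_edgeIntegral_sq_eq_zero (hg : Continuous g)
    (h : K.edgeIntegral e (fun x => g x * g x) = 0) : EqOn g 0 (K.edge e) := by
  set f : ℝ → ℝ := fun t => g (AffineMap.lineMap (K.vertex e) (K.vertex (finRotate K.n e)) t)
  have hf : Continuous fun t => f t * f t :=
    (hg.mul hg).comp AffineMap.lineMap_continuous
  have hint : ∫ t in (0 : ℝ)..1, f t * f t = 0 :=
    (mul_eq_zero.1 h).resolve_left (dist_ne_zero.2 (K.vertex_ne e))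
  have hae := (intervalIntegral.integral_eq_zero_iff_of_le_of_nonneg_ae zero_le_one
    (Filter.Eventually.of_forall fun t => mul_self_nonneg (f t)) (hf.intervalIntegrable _ _)).1 hint
  rw [← restrict_Ioo_eq_restrict_Ioc] at hae
  have hIcc := (Measure.eqOn_open_of_ae_eq hae isOpen_Ioo hf.continuousOn
    continuousOn_const).closure hf continuous_const
  rw [closure_Ioo zero_ne_one] at hIcc
  intro x hx
  rw [edge, segment_eq_image_lineMap] at hx
  obtain ⟨t, ht, rfl⟩ := hx
  exact mul_self_eq_zero.1 (hIcc ht)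

end SimplePolygon

/-! ### Fields with given normal trace -/

theorem exists_isTest_eqOn {K : Set Pt} (hKo : IsOpen K) (hK : Bornology.IsBounded K) {ψ : Pt → ℝ}
    (hψ : ContDiff ℝ ∞ ψ) : ∃ φ, IsTest φ ∧ EqOn φ ψ (closure K) ∧ EqOn (grad φ) (grad ψ) K := by
  obtain ⟨R, hR⟩ := hK.subset_closedBall (0 : Pt)
  let b : ContDiffBump (0 : Pt) := ⟨max R 1, max R 1 + 1, by positivity, by linarith⟩
  have hclosure : closure K ⊆ Metric.closedBall 0 b.rIn :=
    closure_minimal (hR.trans (Metric.closedBall_subset_closedBall (le_max_left R 1)))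
      Metric.isClosed_closedBall
  have hb : EqOn (fun x => b x * ψ x) ψ (closure K) := fun x hx => by
    simp only [b.one_of_mem_closedBall (hclosure hx), one_mul]
  refine ⟨fun x => b x * ψ x, ⟨b.contDiff.mul hψ, b.hasCompactSupport.mul_right⟩, hb,
    fun x hx => ?_⟩
  have hnear := Filter.eventuallyEq_of_mem (hKo.mem_nhds hx) (hb.mono subset_closure)
  ext j
  simp [grad, pderiv, hnear.fderiv_eq]

namespace SimplePolygon

variable {K : SimplePolygon} {c : Pt}

theorem integral_mul_add_inner_grad {f : Pt → ℝ} {t : L2Vec K.carrier} {q : Fin K.n → Pt → ℝ}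
    (h : ∀ φ, IsTest φ → ∫ x in K.carrier, (f x * φ x + inner ℝ (t x) (grad φ x)) =
      ∑ e, K.edgeIntegral e (fun x => q e x * φ x)) {ψ : Pt → ℝ} (hψ : ContDiff ℝ ∞ ψ) :
    ∫ x in K.carrier, (f x * ψ x + inner ℝ (t x) (grad ψ x)) =
      ∑ e, K.edgeIntegral e (fun x => q e x * ψ x) := by
  obtain ⟨φ, hφ, heq, hgrad⟩ := exists_isTest_eqOn K.isOpen K.isBounded hψ
  have hcell : ∫ x in K.carrier, (f x * ψ x + inner ℝ (t x) (grad ψ x)) =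
      ∫ x in K.carrier, (f x * φ x + inner ℝ (t x) (grad φ x)) :=
    setIntegral_congr_fun K.measurableSet fun x hx => by
      simp only [heq (subset_closure hx), hgrad hx]
  rw [hcell, h φ hφ]
  exact Finset.sum_congr rfl fun e _ => edgeIntegral_congr fun x hx => by
    simp only [heq (edge_subset_closure e hx)]

theorem exists_field_edge (hK : IsStarAbout K.carrier c) (e : Fin K.n) {f q : Pt → ℝ}
    (hf : Continuous f) (hq : Continuous q) (hfq : ∫ x in K.carrier, f x = K.edgeIntegral e q) :
    ∃ t : L2Vec K.carrier,
      (∀ φ, IsTest φ → ∫ x in K.carrier, (f x * φ x + inner ℝ (t x) (grad φ x)) =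
        K.edgeIntegral e (fun x => q x * φ x)) ∧
      ∀ φ, IsTest φ → tsupport φ ⊆ K.carrier → ∫ x in K.carrier, inner ℝ (t x) (rot φ x) = 0 := by
  have hscale : ∀ g : Pt → ℝ, K.edgeIntegral e g = ∫ s in (0 : ℝ)..1, K.edgeLength e *
      g (AffineMap.lineMap (K.vertex e) (K.vertex (finRotate K.n e)) s) := fun g =>
    (intervalIntegral.integral_const_mul _ _).symm
  obtain ⟨t, hnormal, hcurl⟩ := hK.exists_field_div_normal K.isBounded (edge_subset_closure e)
    (hK.side_ne_zero (K.vertex_ne e) (K.edge_subset_frontier e)) hf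
    (continuous_const.mul hq) (hfq.trans (hscale q))
  refine ⟨t, fun φ hφ => ?_, hcurl⟩
  rw [hnormal φ hφ, hscale]
  exact intervalIntegral.integral_congr fun s _ => mul_assoc _ _ _

theorem volume_real_ne_zero (K : SimplePolygon) : volume.real K.carrier ≠ 0 :=
  (ENNReal.toReal_pos (K.isOpen.measure_pos volume K.isConnected.nonempty).ne'
    K.isBounded.measure_lt_top.ne).ne'

theorem exists_field_edges (hK : IsStarAbout K.carrier c) {q : Fin K.n → Pt → ℝ}
    (hq : ∀ e, Continuous (q e)) : ∃ (m : ℝ) (t : L2Vec K.carrier),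
      (∀ φ, IsTest φ → ∫ x in K.carrier, (m * φ x + inner ℝ (t x) (grad φ x)) =
        ∑ e, K.edgeIntegral e (fun x => q e x * φ x)) ∧
      ∀ φ, IsTest φ → tsupport φ ⊆ K.carrier → ∫ x in K.carrier, inner ℝ (t x) (rot φ x) = 0 := by
  set m : Fin K.n → ℝ := fun e => K.edgeIntegral e (q e) / volume.real K.carrier
  have hm : ∀ e, ∫ _ in K.carrier, m e = K.edgeIntegral e (q e) := fun e => by
    rw [setIntegral_const, smul_eq_mul, mul_div_cancel₀ _ K.volume_real_ne_zero]
  choose t hnormal hcurl using fun e => exists_field_edge hK e continuous_const (hq e) (hm e)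
  refine ⟨∑ e, m e, ∑ e, t e, fun φ hφ => ?_, fun φ hφ hs => ?_⟩
  · have hsplit : ∀ (a : ℝ) (s : L2Vec K.carrier),
        ∫ x in K.carrier, (a * φ x + inner ℝ (s x) (grad φ x)) =
          a * (∫ x in K.carrier, φ x) + inner ℝ s (gradL2 K.carrier ⟨φ, hφ⟩) := fun a s => by
      rw [integral_add (integrableOn_mul_of_isBounded K.isBounded continuous_const
        hφ.1.continuous) (integrableOn_inner_grad _ hφ), integral_const_mul, inner_gradL2]
    rw [hsplit, sum_inner, Finset.sum_mul, ← Finset.sum_add_distrib]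
    exact Finset.sum_congr rfl fun e _ => (hsplit _ _).symm.trans (hnormal e φ hφ)
  · rw [← inner_rotL2 _ ⟨φ, hφ, hs⟩, sum_inner]
    refine Finset.sum_eq_zero fun e _ => ?_
    rw [inner_rotL2, hcurl e φ hφ hs]

theorem exists_field_meanZero (hK : IsStarAbout K.carrier c) {f : Pt → ℝ}
    (hf : Continuous f) (hf0 : ∫ x in K.carrier, f x = 0) : ∃ t : L2Vec K.carrier,
      (∀ φ, IsTest φ → ∫ x in K.carrier, (f x * φ x + inner ℝ (t x) (grad φ x)) = 0) ∧
      ∀ φ, IsTest φ → tsupport φ ⊆ K.carrier → ∫ x in K.carrier, inner ℝ (t x) (rot φ x) = 0 := by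
  obtain ⟨t, hnormal, hcurl⟩ := exists_field_edge hK ⟨0, by linarith [K.three_le]⟩
    (q := fun _ => 0) hf continuous_const (by rw [hf0, edgeIntegral_zero])
  refine ⟨t, fun φ hφ => ?_, hcurl⟩
  rw [hnormal φ hφ]
  simp_rw [zero_mul]
  exact edgeIntegral_zero _

end SimplePolygon

/-! ### Rotations and rigid motions -/

/-- The rows of the skew tensor with upper right entry `a`: the space of skew tensors is identified
with `ℝ` in this way. -/
def skewRow (a : ℝ) : Fin 2 → Pt := ![!₂[0, a], !₂[-a, 0]]

/-- The components of the rigid motion with translation `m` whose gradient is the skew tensor with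
upper right entry `a`. -/
def rigid (a : ℝ) (m : Fin 2 → ℝ) : Fin 2 → MvPolynomial (Fin 2) ℝ :=
  ![MvPolynomial.C a * MvPolynomial.X 1 + MvPolynomial.C (m 0),
    -(MvPolynomial.C a * MvPolynomial.X 0) + MvPolynomial.C (m 1)]

section Rigid

variable {a : ℝ} {m : Fin 2 → ℝ}

theorem rigid_sub (a a' : ℝ) (m m' : Fin 2 → ℝ) (i : Fin 2) :
    rigid a m i - rigid a' m' i = rigid (a - a') (m - m') i := by
  fin_cases i <;> simp only [rigid, Pi.sub_apply, MvPolynomial.C_sub, Fin.zero_eta, Fin.mk_one,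
    Matrix.cons_val_zero, Matrix.cons_val_one] <;> ring

theorem rigid_mem_Poly {k : ℕ} (hk : 1 ≤ k) (a : ℝ) (m : Fin 2 → ℝ) (i : Fin 2) :
    rigid a m i ∈ Poly k := by
  have hX : ∀ j : Fin 2, MvPolynomial.C a * MvPolynomial.X j ∈ Poly k := fun j =>
    mem_Poly_iff.2 <| (MvPolynomial.totalDegree_mul _ _).trans (by simpa using hk)
  have hC : ∀ b : ℝ, MvPolynomial.C b ∈ Poly k := fun b => mem_Poly_iff.2 (by simp)
  fin_cases i
  · exact add_mem (hX 1) (hC _)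
  · exact add_mem (neg_mem (hX 0)) (hC _)

theorem polyEval_rigid (a : ℝ) (m : Fin 2 → ℝ) (i : Fin 2) (x : Pt) :
    polyEval (rigid a m i) x = ![a * x 1 + m 0, -(a * x 0) + m 1] i := by
  fin_cases i <;> simp [rigid, polyEval]

theorem grad_rigid (a : ℝ) (m : Fin 2 → ℝ) (i : Fin 2) (x : Pt) :
    grad (polyEval (rigid a m i)) x = skewRow a i := by
  ext j
  simp only [grad, pderiv_polyEval]
  fin_cases i <;> fin_cases j <;> simp [rigid, skewRow, polyEval, MvPolynomial.pderiv_X]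

theorem rigid_eq_zero_of_two_points {P Q : Pt} (h : P ≠ Q)
    (hP : ∀ i, polyEval (rigid a m i) P = 0) (hQ : ∀ i, polyEval (rigid a m i) Q = 0) :
    a = 0 ∧ m = 0 := by
  simp only [polyEval_rigid, Fin.forall_fin_two, Matrix.cons_val_zero, Matrix.cons_val_one]
    at hP hQ
  have ha : a = 0 := by
    by_contra ha
    refine h (PiLp.ext (Fin.forall_fin_two.2 ⟨mul_left_cancel₀ ha ?_, mul_left_cancel₀ ha ?_⟩))
    · linarith [hP.2, hQ.2]
    · linarith [hP.1, hQ.1]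
  subst ha
  exact ⟨rfl, funext (Fin.forall_fin_two.2 ⟨by simpa using hP.1, by simpa using hP.2⟩)⟩

theorem SimplePolygon.rigid_eq_zero_of_sum_edgeIntegral_sq {K : SimplePolygon} {e : Fin K.n}
    (h : ∑ i, K.edgeIntegral e (fun x => polyEval (rigid a m i) x * polyEval (rigid a m i) x) = 0) :
    a = 0 ∧ m = 0 := by
  have hzero : ∀ i, EqOn (polyEval (rigid a m i)) 0 (K.edge e) := fun i =>
    eqOn_zero_of_edgeIntegral_sq_eq_zero (continuous_polyEval _)
      ((Finset.sum_eq_zero_iff_of_nonneg fun _ _ =>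
        edgeIntegral_nonneg fun _ => mul_self_nonneg _).1 h i (Finset.mem_univ i))
  exact rigid_eq_zero_of_two_points (K.vertex_ne e) (fun i => hzero i (left_mem_segment _ _ _))
    fun i => hzero i (right_mem_segment _ _ _)

theorem inner_skewRow_rot (a : ℝ) (i : Fin 2) (φ : Pt → ℝ) (x : Pt) :
    inner ℝ (skewRow a i) (rot φ x) = a * pderiv i φ x := by
  rw [inner_rot]
  fin_cases i <;> simp [skewRow]

theorem continuous_skewRow (i : Fin 2) : Continuous fun a => skewRow a i := by
  refine (PiLp.continuous_toLp 2 fun _ : Fin 2 => ℝ).comp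
    (g := fun v => WithLp.toLp 2 v) (f := fun a => (skewRow a i).ofLp) (continuous_pi fun j => ?_)
  fin_cases i <;> fin_cases j
  exacts [continuous_const, continuous_id, continuous_neg, continuous_const]

end Rigid

theorem setIntegral_polyEval_mul_pderiv {U : Set Pt} (ρ : MvPolynomial (Fin 2) ℝ) (i : Fin 2)
    {φ : Pt → ℝ} (hφ : IsTest φ) (hU : tsupport φ ⊆ U) :
    ∫ x in U, polyEval ρ x * pderiv i φ x =
      -∫ x in U, polyEval (MvPolynomial.pderiv i ρ) x * φ x := by
  rw [setIntegral_eq_integral_of_forall_compl_eq_zero fun x hx => by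
      rw [pderiv_eq_zero_of_notMem (fun h => hx (hU h)), mul_zero],
    setIntegral_eq_integral_of_forall_compl_eq_zero fun x hx => by
      rw [image_eq_zero_of_notMem_tsupport (fun h => hx (hU h)), mul_zero]]
  simp_rw [← pderiv_polyEval, mul_comm (polyEval ρ _), mul_comm _ (φ _)]
  rw [integral_mul_pderiv hφ (contDiff_polyEval ρ), neg_neg]

theorem SimplePolygon.exists_polyEval_eq_const (K : SimplePolygon) (ρ : MvPolynomial (Fin 2) ℝ)
    (h : ∀ i, ∀ φ, IsTest φ → tsupport φ ⊆ K.carrier →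
      ∫ x in K.carrier, polyEval ρ x * pderiv i φ x = 0) :
    ∃ a, ∀ x ∈ K.carrier, polyEval ρ x = a := by
  have hpderiv : ∀ i, EqOn (polyEval (MvPolynomial.pderiv i ρ)) 0 K.carrier := by
    intro i
    have hc := continuous_polyEval (MvPolynomial.pderiv i ρ)
    refine Measure.eqOn_open_of_ae_eq (μ := volume) ?_ K.isOpen hc.continuousOn continuousOn_const
    rw [Filter.EventuallyEq, ae_restrict_iff' K.measurableSet]
    refine K.isOpen.ae_eq_zero_of_integral_contDiff_smul_eq_zero
      (hc.locallyIntegrable.locallyIntegrableOn _) fun φ hφ hφc hs => ?_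
    have hparts := setIntegral_polyEval_mul_pderiv ρ i ⟨hφ, hφc⟩ hs
    rw [h i φ ⟨hφ, hφc⟩ hs, zero_eq_neg, setIntegral_eq_integral_of_forall_compl_eq_zero
      fun x hx => by
        rw [image_eq_zero_of_notMem_tsupport (fun h => hx (hs h)), mul_zero]] at hparts
    simpa only [smul_eq_mul, mul_comm (φ _)] using hparts
  have hd : Differentiable ℝ (polyEval ρ) := (contDiff_polyEval ρ).differentiable (by simp)
  refine K.isOpen.exists_is_const_of_fderiv_eq_zero K.isConnected.isPreconnected
    hd.differentiableOn fun x hx => ?_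
  have hgrad : grad (polyEval ρ) x = 0 := by
    ext i
    exact (pderiv_polyEval i ρ x).trans (hpderiv i hx)
  exact norm_eq_zero.1 ((norm_grad (polyEval ρ) x).symm.trans (by rw [hgrad, norm_zero]))

/-! ### Pairs orthogonal to the discrete stresses -/

theorem inner_eq_sum_inner_row (a b : Ten) :
    inner ℝ a b = ∑ i, inner ℝ (row i a) (row i b) := by
  simp only [PiLp.inner_apply, row_apply, Fintype.sum_prod_type]

namespace SimplePolygon

variable {K : SimplePolygon}

theorem memLp_skewRow (K : SimplePolygon) (ρ : MvPolynomial (Fin 2) ℝ) (i : Fin 2) :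
    MemLp (fun x => skewRow (polyEval ρ x) i) 2 (volume.restrict K.carrier) :=
  memLp_restrict_of_isBounded K.isBounded
    ((continuous_skewRow i).comp (continuous_polyEval ρ)) 2

theorem integrableOn_inner_skewRow (t : L2Vec K.carrier) (ρ : MvPolynomial (Fin 2) ℝ)
    (i : Fin 2) : IntegrableOn (fun x => inner ℝ (t x) (skewRow (polyEval ρ x) i)) K.carrier := by
  refine (L2.integrable_inner (𝕜 := ℝ) t (K.memLp_skewRow ρ i).toLp).congr ?_
  filter_upwards [(K.memLp_skewRow ρ i).coeFn_toLp] with x hx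
  rw [hx]

theorem exists_divFree_field_skewRow (K : SimplePolygon) (ρ : MvPolynomial (Fin 2) ℝ)
    (i : Fin 2) : ∃ t : L2Vec K.carrier,
      (∀ φ, IsTest φ → ∫ x in K.carrier, inner ℝ (t x) (grad φ x) = 0) ∧
      (∀ φ ∈ testSpaceIn K.carrier, ∫ x in K.carrier, inner ℝ (t x) (rot φ x) =
        ∫ x in K.carrier, polyEval ρ x * pderiv i φ x) ∧
      ∫ x in K.carrier, inner ℝ (t x) (skewRow (polyEval ρ x) i) = ‖t‖ ^ 2 := by
  have hw := (K.memLp_skewRow ρ i).coeFn_toLp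
  obtain ⟨t, hgrad, hrot, hnorm⟩ := exists_divFree_field (K.memLp_skewRow ρ i).toLp
  refine ⟨t, fun φ hφ => hgrad ⟨φ, hφ⟩, fun φ hφ => ?_, ?_⟩
  · rw [hrot ⟨φ, hφ⟩]
    refine integral_congr_ae ?_
    filter_upwards [hw] with x hx
    rw [hx, inner_skewRow_rot]
  · rw [← hnorm, inner_L2_eq_integral t _ (Filter.EventuallyEq.refl _ _) hw]

theorem exists_integral_sub_rigid_eq_zero (K : SimplePolygon)
    (p : Fin 2 → MvPolynomial (Fin 2) ℝ) (a : ℝ) :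
    ∃ m : Fin 2 → ℝ, ∀ i, ∫ x in K.carrier, polyEval (p i - rigid a m i) x = 0 := by
  set g : Fin 2 → MvPolynomial (Fin 2) ℝ := fun i => p i - rigid a 0 i
  set m : Fin 2 → ℝ := fun i => (∫ x in K.carrier, polyEval (g i) x) / volume.real K.carrier
  have hsplit : ∀ i x, polyEval (p i - rigid a m i) x = polyEval (g i) x - m i := by
    intro i x
    simp only [g, polyEval_sub, polyEval_rigid]
    fin_cases i <;> simp only [Fin.zero_eta, Fin.mk_one, Matrix.cons_val_zero,
      Matrix.cons_val_one, Pi.zero_apply] <;> ring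
  refine ⟨m, fun i => ?_⟩
  simp only [hsplit]
  rw [integral_sub (integrableOn_of_isBounded K.isBounded (continuous_polyEval _))
    (integrableOn_of_isBounded K.isBounded continuous_const), setIntegral_const, smul_eq_mul,
    mul_div_cancel₀ _ K.volume_real_ne_zero, sub_self]

theorem eqOn_zero_of_integral_sq_eq_zero {g : Pt → ℝ} (hg : Continuous g)
    (h : ∫ x in K.carrier, g x * g x = 0) : EqOn g 0 K.carrier := by
  have hae := (setIntegral_eq_zero_iff_of_nonneg_ae
    (Filter.Eventually.of_forall fun x => mul_self_nonneg (g x))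
    (integrableOn_mul_of_isBounded K.isBounded hg hg)).1 h
  exact fun x hx => mul_self_eq_zero.1 (Measure.eqOn_open_of_ae_eq hae K.isOpen
    (hg.mul hg).continuousOn continuousOn_const hx)

theorem integral_mul_rigid_add_inner_skewRow {f : Pt → ℝ} {t : L2Vec K.carrier}
    {q : Fin K.n → Pt → ℝ} (h : ∀ φ, IsTest φ →
      ∫ x in K.carrier, (f x * φ x + inner ℝ (t x) (grad φ x)) =
        ∑ e, K.edgeIntegral e (fun x => q e x * φ x)) (a : ℝ) (m : Fin 2 → ℝ) (i : Fin 2) :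
    ∫ x in K.carrier, (f x * polyEval (rigid a m i) x + inner ℝ (t x) (skewRow a i)) =
      ∑ e, K.edgeIntegral e (fun x => q e x * polyEval (rigid a m i) x) := by
  rw [← integral_mul_add_inner_grad h (contDiff_polyEval _)]
  simp only [grad_rigid]

theorem integral_sub_rigid_mul_add_inner_skewRow
    {p : MvPolynomial (Fin 2) ℝ} {a : ℝ} {m : Fin 2 → ℝ} {i : Fin 2} {t : L2Vec K.carrier}
    (h : ∀ φ, IsTest φ → ∫ x in K.carrier,
      (polyEval (p - rigid a m i) x * φ x + inner ℝ (t x) (grad φ x)) = 0) :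
    ∫ x in K.carrier, (polyEval (p - rigid a m i) x * polyEval p x +
      inner ℝ (t x) (skewRow a i)) =
      ∫ x in K.carrier, polyEval (p - rigid a m i) x * polyEval (p - rigid a m i) x := by
  set F := p - rigid a m i
  have hrigid : ∫ x in K.carrier,
      (polyEval F x * polyEval (rigid a m i) x + inner ℝ (t x) (skewRow a i)) = 0 := by
    simpa only [zero_mul, edgeIntegral_zero, Finset.sum_const_zero] using
      integral_mul_rigid_add_inner_skewRow (q := fun _ _ => 0)
        (by simpa only [zero_mul, edgeIntegral_zero, Finset.sum_const_zero] using h) a m i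
  have hp : ∀ x, polyEval p x = polyEval F x + polyEval (rigid a m i) x := fun x => by
    rw [← polyEval_add, sub_add_cancel]
  have hint : IntegrableOn (fun x => polyEval F x * polyEval (rigid a m i) x +
      inner ℝ (t x) (skewRow a i)) K.carrier :=
    (integrableOn_mul_of_isBounded K.isBounded (continuous_polyEval _)
      (continuous_polyEval _)).add <| by
      simpa only [polyEval_C] using integrableOn_inner_skewRow t (MvPolynomial.C a) i
  simp only [hp, mul_add, add_assoc]
  rw [integral_add (integrableOn_mul_of_isBounded K.isBounded (continuous_polyEval _)
    (continuous_polyEval _)) hint, hrigid, add_zero]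

end SimplePolygon

section Annihilator

variable {Ω Γσ : Set Pt} {k : ℕ} {T : PolygonalMesh Ω}

/-- The components of `u` are given by the polynomials `p` and `r` is the skew field with upper
right entry `ρ`, cell by cell. -/
structure IsPiecewise (T : PolygonalMesh Ω) (p : Fin T.N → Fin 2 → MvPolynomial (Fin 2) ℝ)
    (ρ : Fin T.N → MvPolynomial (Fin 2) ℝ) (u : L2Vec Ω) (r : L2Ten Ω) : Prop where
  vec : ∀ K, ∀ᵐ x ∂(volume.restrict (T.cell K).carrier), ∀ i, u x i = polyEval (p K i) x
  skew : ∀ K, ∀ᵐ x ∂(volume.restrict (T.cell K).carrier), ∀ i,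
    row i (r x) = skewRow (polyEval (ρ K) x) i

/-- The pair `(u, r)` lies in the kernel of the transposed constraint operator: it is orthogonal
to `(div τ, τ)` for all discrete stresses `τ`. -/
def AnnihilatesStress (k : ℕ) (T : PolygonalMesh Ω) (Γσ : Set Pt) (u : L2Vec Ω)
    (r : L2Ten Ω) : Prop :=
  ∀ τ ∈ stressSpace k T Γσ, inner ℝ (divergence τ) u + inner ℝ τ r = 0

theorem exists_isPiecewise {u : L2Vec Ω} {r : L2Ten Ω} (hu : u ∈ velocitySpace k T)
    (hr : r ∈ rotationSpace k T) :
    ∃ p ρ, IsPiecewise T p ρ u r ∧ (∀ K i, p K i ∈ Poly k) ∧ ∀ K, ρ K ∈ Poly k := by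
  choose p hp hpu using hu
  obtain ⟨hskew, hpoly⟩ := hr
  choose s hs hsr using hpoly
  refine ⟨p, fun K => s K (0, 1), ⟨hpu, fun K => ?_⟩, fun K i => mem_Poly_iff.2 (hp K i),
    fun K => mem_Poly_iff.2 (hs K _)⟩
  filter_upwards [hsr K, ae_mono (T.restrict_cell_le K) hskew] with x hx hxskew i
  have hdiag : ∀ i, r x (i, i) = 0 := fun i => self_eq_neg.1 (hxskew i i)
  ext j
  rw [row_apply, ← hx]
  fin_cases i <;> fin_cases j
  exacts [hdiag 0, rfl, hxskew 1 0, hdiag 1]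

theorem eq_zero_of_sum_sum_eq_zero {ι κ M : Type*} [Fintype ι] [Fintype κ] [AddCommMonoid M]
    [PartialOrder M] [IsOrderedAddMonoid M] {g : ι → κ → M} (hg : ∀ a b, 0 ≤ g a b)
    (h : ∑ a, ∑ b, g a b = 0) (a : ι) (b : κ) : g a b = 0 :=
  (Finset.sum_eq_zero_iff_of_nonneg fun b _ => hg a b).1
    ((Finset.sum_eq_zero_iff_of_nonneg fun a _ => Finset.sum_nonneg fun b _ => hg a b).1 h a
      (Finset.mem_univ a)) b (Finset.mem_univ b)

theorem StressData.mem_conforming_of_trace_eq_zero (c : Fin T.N → Fin 2 → Poly (k - 1))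
    (f : Fin T.N → Fin 2 → Poly k) : ((c, f, 0) : StressData k T) ∈ conforming k T Γσ := by
  intro φ hφ i
  change ∑ K : Fin T.N, ∑ e : Fin (T.cell K).n,
    SimplePolygon.edgePairing (K := T.cell K) e hφ.1.1.continuous 0 = 0
  simp only [map_zero, Finset.sum_const_zero]

namespace IsPiecewise

variable {p : Fin T.N → Fin 2 → MvPolynomial (Fin 2) ℝ} {ρ : Fin T.N → MvPolynomial (Fin 2) ℝ}
  {u : L2Vec Ω} {r : L2Ten Ω}

theorem inner_add_inner_eq_sum (h : IsPiecewise T p ρ u r) {τ : L2Ten Ω} {v : L2Vec Ω}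
    {t : (K : Fin T.N) → Fin 2 → L2Vec (T.cell K).carrier}
    {f : Fin T.N → Fin 2 → MvPolynomial (Fin 2) ℝ}
    (hτ : ∀ K, ∀ᵐ x ∂(volume.restrict (T.cell K).carrier), ∀ i, row i (τ x) = t K i x)
    (hv : ∀ K, v =ᵐ[volume.restrict (T.cell K).carrier] polyField (f K)) :
    inner ℝ v u + inner ℝ τ r = ∑ K, ∑ i, ∫ x in (T.cell K).carrier,
      (polyEval (f K i) x * polyEval (p K i) x +
        inner ℝ (t K i x) (skewRow (polyEval (ρ K) x) i)) := by
  have hvu := L2.integrable_inner (𝕜 := ℝ) v u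
  have hτr := L2.integrable_inner (𝕜 := ℝ) τ r
  rw [L2.inner_def, L2.inner_def, ← integral_add hvu hτr,
    T.setIntegral_eq_sum (f := fun x => inner ℝ (v x) (u x) + inner ℝ (τ x) (r x))
      fun K => (hvu.add hτr).mono_measure (T.restrict_cell_le K)]
  refine Finset.sum_congr rfl fun K _ => ?_
  have hcell : ∀ i ∈ Finset.univ, IntegrableOn (fun x => polyEval (f K i) x * polyEval (p K i) x +
      inner ℝ (t K i x) (skewRow (polyEval (ρ K) x) i)) (T.cell K).carrier := fun i _ =>
    (integrableOn_mul_of_isBounded (T.cell K).isBounded (continuous_polyEval _)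
      (continuous_polyEval _)).add (SimplePolygon.integrableOn_inner_skewRow _ _ _)
  rw [← integral_finsetSum _ hcell]
  refine integral_congr_ae ?_
  filter_upwards [h.vec K, h.skew K, hτ K, hv K] with x hu hr hτ hv
  simp only [inner_eq_sum_inner_row, hτ, hr, Finset.sum_add_distrib]
  simp only [hv, PiLp.inner_apply, hu, polyField_apply, RCLike.inner_apply, conj_trivial, mul_comm]

theorem sum_pairing_eq_zero (h : IsPiecewise T p ρ u r) (hΩ : IsOpen Ω)
    (hann : AnnihilatesStress k T Γσ u r) {d : StressData k T}
    (hd : d ∈ StressData.conforming k T Γσ) (t : (K : Fin T.N) → Fin 2 → L2Vec (T.cell K).carrier)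
    (hcurl : ∀ K, ∀ φ ∈ testSpaceIn (T.cell K).carrier, ∀ i,
      ∫ x in (T.cell K).carrier, inner ℝ (t K i x) (rot φ x) =
        -∫ x in (T.cell K).carrier, polyEval (d.curl K i) x * φ x)
    (hnormal : ∀ K, ∀ φ, IsTest φ → ∀ i,
      ∫ x in (T.cell K).carrier, (polyEval (d.div K i) x * φ x + inner ℝ (t K i x) (grad φ x)) =
        ∑ e, (T.cell K).edgeIntegral e (fun x => polyEval (d.trace K e i) x * φ x)) :
    ∑ K, ∑ i, ∫ x in (T.cell K).carrier, (polyEval (d.div K i) x * polyEval (p K i) x +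
      inner ℝ (t K i x) (skewRow (polyEval (ρ K) x) i)) = 0 := by
  obtain ⟨τ, hτ, hcell⟩ := exists_mem_stressSpace hΩ hd t hcurl hnormal
  rw [← hann τ hτ, h.inner_add_inner_eq_sum (fun K => (hcell K).1) fun K => (hcell K).2]

theorem sum_pairing_eq_zero_of_normal_eq_zero (h : IsPiecewise T p ρ u r) (hΩ : IsOpen Ω)
    (hann : AnnihilatesStress k T Γσ u r) (c : Fin T.N → Fin 2 → Poly (k - 1))
    (f : Fin T.N → Fin 2 → Poly k) (t : (K : Fin T.N) → Fin 2 → L2Vec (T.cell K).carrier)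
    (hcurl : ∀ K, ∀ φ ∈ testSpaceIn (T.cell K).carrier, ∀ i,
      ∫ x in (T.cell K).carrier, inner ℝ (t K i x) (rot φ x) =
        -∫ x in (T.cell K).carrier, polyEval (c K i) x * φ x)
    (hnormal : ∀ K, ∀ φ, IsTest φ → ∀ i,
      ∫ x in (T.cell K).carrier, (polyEval (f K i) x * φ x + inner ℝ (t K i x) (grad φ x)) = 0) :
    ∑ K, ∑ i, ∫ x in (T.cell K).carrier, (polyEval (f K i) x * polyEval (p K i) x +
      inner ℝ (t K i x) (skewRow (polyEval (ρ K) x) i)) = 0 :=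
  h.sum_pairing_eq_zero hΩ hann (StressData.mem_conforming_of_trace_eq_zero c f) t hcurl
    fun K φ hφ i => (hnormal K φ hφ i).trans <| Eq.symm <| Finset.sum_eq_zero fun e _ =>
      map_zero (SimplePolygon.edgePairing e hφ.1.continuous)

/-- The test field is, row by row, the orthogonal projection of the rotation to the rotated
gradients of test functions. -/
theorem exists_rotation_const (h : IsPiecewise T p ρ u r) (hΩ : IsOpen Ω)
    (hann : AnnihilatesStress k T Γσ u r) (hρ : ∀ K, ρ K ∈ Poly k) :
    ∃ a : Fin T.N → ℝ, IsPiecewise T p (fun K => MvPolynomial.C (a K)) u r := by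
  choose t hgrad hrot hnorm using fun K i =>
    (T.cell K).exists_divFree_field_skewRow (ρ K) i
  have hsum := h.sum_pairing_eq_zero_of_normal_eq_zero hΩ hann
    (fun K i => ⟨MvPolynomial.pderiv i (ρ K),
      mem_Poly_iff.2 (totalDegree_pderiv_le (mem_Poly_iff.1 (hρ K)) i)⟩) 0 t
    (fun K φ hφ i => (hrot K i φ hφ).trans (setIntegral_polyEval_mul_pderiv _ _ hφ.1 hφ.2))
    (fun K φ hφ i => by
      simpa only [Pi.zero_apply, ZeroMemClass.coe_zero, polyEval_zero, zero_mul, zero_add]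
        using hgrad K i φ hφ)
  have hsq : ∑ K, ∑ i, ‖t K i‖ ^ 2 = 0 := by
    simpa only [Pi.zero_apply, ZeroMemClass.coe_zero, polyEval_zero, zero_mul, zero_add, hnorm]
      using hsum
  have ht : ∀ K i, t K i = 0 := fun K i => norm_eq_zero.1 <| pow_eq_zero_iff two_ne_zero |>.1 <|
    eq_zero_of_sum_sum_eq_zero (fun K i => sq_nonneg ‖t K i‖) hsq K i
  choose a ha using fun K => (T.cell K).exists_polyEval_eq_const (ρ K) fun i φ hφ hs => by
    rw [← hrot K i φ ⟨hφ, hs⟩, ht K i, ← inner_rotL2 _ ⟨φ, hφ, hs⟩, inner_zero_left]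
  refine ⟨a, h.vec, fun K => ?_⟩
  filter_upwards [h.skew K, ae_restrict_mem (T.cell K).measurableSet] with x hx hxK i
  rw [hx, ha K x hxK, polyEval_C]

/-- The test field is curl free and its divergence on each cell is the difference `F` of `u` and
the rigid motion with the same mean value. -/
theorem exists_rigid {a : Fin T.N → ℝ}
    (h : IsPiecewise T p (fun K => MvPolynomial.C (a K)) u r) (hΩ : IsOpen Ω)
    (hT : T.IsStarMesh) (hann : AnnihilatesStress k T Γσ u r) (hk : 1 ≤ k)
    (hp : ∀ K i, p K i ∈ Poly k) : ∃ m : Fin T.N → Fin 2 → ℝ,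
      IsPiecewise T (fun K => rigid (a K) (m K)) (fun K => MvPolynomial.C (a K)) u r := by
  choose m hm using fun K => (T.cell K).exists_integral_sub_rigid_eq_zero (p K) (a K)
  set F : Fin T.N → Fin 2 → Poly k := fun K i =>
    ⟨p K i - rigid (a K) (m K) i, sub_mem (hp K i) (rigid_mem_Poly hk _ _ _)⟩
  choose c hc using hT
  choose t hnormal hcurl using fun K i =>
    SimplePolygon.exists_field_meanZero (hc K) (continuous_polyEval (F K i)) (hm K i)
  have hsum := h.sum_pairing_eq_zero_of_normal_eq_zero hΩ hann 0 F t
    (fun K φ hφ i => by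
      simpa only [Pi.zero_apply, ZeroMemClass.coe_zero, polyEval_zero, zero_mul, integral_zero,
        neg_zero] using hcurl K i φ hφ.1 hφ.2)
    (fun K φ hφ i => hnormal K i φ hφ)
  have hcell : ∀ K i, ∫ x in (T.cell K).carrier, (polyEval (F K i) x * polyEval (p K i) x +
      inner ℝ (t K i x) (skewRow (polyEval (MvPolynomial.C (a K)) x) i)) =
      ∫ x in (T.cell K).carrier, polyEval (F K i) x * polyEval (F K i) x := fun K i => by
    simp only [polyEval_C]
    exact SimplePolygon.integral_sub_rigid_mul_add_inner_skewRow (hnormal K i)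
  simp only [hcell] at hsum
  have hF : ∀ K i, EqOn (polyEval (F K i)) 0 (T.cell K).carrier := fun K i =>
    SimplePolygon.eqOn_zero_of_integral_sq_eq_zero (continuous_polyEval _) <|
      eq_zero_of_sum_sum_eq_zero (fun K i => integral_nonneg fun x => mul_self_nonneg _) hsum K i
  refine ⟨m, fun K => ?_, h.skew⟩
  filter_upwards [h.vec K, ae_restrict_mem (T.cell K).measurableSet] with x hx hxK i
  rw [hx, ← sub_eq_zero, ← polyEval_sub]
  exact hF K i hxK

theorem sum_edgeIntegral_mul_rigid_eq_zero {a : Fin T.N → ℝ} {m : Fin T.N → Fin 2 → ℝ}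
    (h : IsPiecewise T (fun K => rigid (a K) (m K)) (fun K => MvPolynomial.C (a K)) u r)
    (hΩ : IsOpen Ω) (hT : T.IsStarMesh) (hann : AnnihilatesStress k T Γσ u r)
    {d : StressData k T} (hd : d ∈ StressData.conforming k T Γσ) :
    ∑ i, StressData.traceSum (fun K => continuous_polyEval (rigid (a K) (m K) i)) i d = 0 := by
  choose c hc using hT
  choose b t hnormal hcurl using fun K i => SimplePolygon.exists_field_edges (hc K)
    (q := fun e => polyEval (d.trace K e i)) fun e => continuous_polyEval _
  set f : Fin T.N → Fin 2 → Poly k := fun K i => ⟨MvPolynomial.C (b K i), mem_Poly_iff.2 (by simp)⟩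
  have hsum := h.sum_pairing_eq_zero hΩ hann (d := (0, f, d.2.2)) hd t
    (fun K φ hφ i => by
      simpa only [StressData.curl, Pi.zero_apply, ZeroMemClass.coe_zero, polyEval_zero, zero_mul,
        integral_zero, neg_zero] using hcurl K i φ hφ.1 hφ.2)
    (fun K φ hφ i => by simpa only [f, StressData.div, polyEval_C] using hnormal K i φ hφ)
  rw [Finset.sum_comm] at hsum
  refine (Finset.sum_congr rfl fun i _ => Finset.sum_congr rfl fun K _ => ?_).trans hsum
  refine (SimplePolygon.integral_mul_rigid_add_inner_skewRow (hnormal K i) (a K) (m K) i).symm.trans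
    ?_
  simp only [f, StressData.div, polyEval_C]

end IsPiecewise

end Annihilator

/-! ### Uniqueness of the multipliers -/

section Multipliers

variable {Ω Γu Γσ : Set Pt} {k : ℕ} {T : PolygonalMesh Ω}

namespace StressData

/-- The data of a divergence free and curl free stress whose normal trace is `q` on the edge `e` of
the cell `K`, seen from inside of `K`, and vanishes on all other edges. -/
def singleTrace (K : Fin T.N) (e : Fin (T.cell K).n) (q : Fin 2 → Poly k) : StressData k T :=
  (0, 0, Pi.single K (Pi.single e q))

theorem traceSum_singleTrace (K : Fin T.N) (e : Fin (T.cell K).n) (q : Fin 2 → Poly k)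
    {φ : Fin T.N → Pt → ℝ} (hφ : ∀ K, Continuous (φ K)) (i : Fin 2) :
    traceSum hφ i (singleTrace K e q) =
      (T.cell K).edgeIntegral e (fun x => polyEval (q i) x * φ K x) := by
  have hself : (singleTrace K e q).trace K e i = q i := by
    simp only [trace, singleTrace, Pi.single_eq_same]
  have hedge : ∀ e' ≠ e, (singleTrace K e q).trace K e' i = 0 := fun e' he' => by
    simp only [trace, singleTrace, Pi.single_eq_same, Pi.single_eq_of_ne he', Pi.zero_apply,
      ZeroMemClass.coe_zero]
  have hcell : ∀ L ≠ K, ∀ e', (singleTrace K e q).trace L e' i = 0 := fun L hL e' => by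
    simp only [trace, singleTrace, Pi.single_eq_of_ne hL, Pi.zero_apply, ZeroMemClass.coe_zero]
  change ∑ L : Fin T.N, ∑ e' : Fin (T.cell L).n, SimplePolygon.edgePairing (K := T.cell L) e' (hφ L)
    ((singleTrace K e q).trace L e' i) = _
  rw [Fintype.sum_eq_single K fun L hL => Finset.sum_eq_zero fun e' _ => by
      rw [hcell L hL, map_zero], Fintype.sum_eq_single e fun e' he' => by
      rw [hedge e' he', map_zero], hself]
  rfl

end StressData

variable {a : Fin T.N → ℝ} {m : Fin T.N → Fin 2 → ℝ}

/-- Test with the jump of the rigid motions, as trace on the common edge with opposite signs from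
the two sides. -/
theorem rigid_eq_of_edge_eq (hk : 1 ≤ k)
    (h : ∀ d ∈ StressData.conforming k T Γσ,
      ∑ i, StressData.traceSum (fun K => continuous_polyEval (rigid (a K) (m K) i)) i d = 0)
    {K L : Fin T.N} {e : Fin (T.cell K).n} {e' : Fin (T.cell L).n}
    (he : (T.cell L).edge e' = (T.cell K).edge e) : a K = a L ∧ m K = m L := by
  set q : Fin 2 → Poly k := fun i =>
    ⟨rigid (a K - a L) (m K - m L) i, rigid_mem_Poly hk _ _ _⟩
  have hsum := h (StressData.singleTrace K e q - StressData.singleTrace L e' q) fun φ hφ i => by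
    rw [map_sub, StressData.traceSum_singleTrace, StressData.traceSum_singleTrace,
      SimplePolygon.edgeIntegral_eq_of_edge_eq he, sub_self]
  have hjump : ∀ i, StressData.traceSum (fun K => continuous_polyEval (rigid (a K) (m K) i)) i
      (StressData.singleTrace K e q - StressData.singleTrace L e' q) =
      (T.cell K).edgeIntegral e (fun x => polyEval (q i) x * polyEval (q i) x) := fun i => by
    rw [map_sub, StressData.traceSum_singleTrace, StressData.traceSum_singleTrace,
      SimplePolygon.edgeIntegral_eq_of_edge_eq he]
    have hsub := map_sub ((T.cell K).edgePairing e (continuous_polyEval (q i)))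
      (rigid (a K) (m K) i) (rigid (a L) (m L) i)
    rw [rigid_sub] at hsub
    simp only [mul_comm (polyEval (q i) _)]
    exact hsub.symm
  simp only [hjump] at hsum
  obtain ⟨ha, hm⟩ := SimplePolygon.rigid_eq_zero_of_sum_edgeIntegral_sq hsum
  exact ⟨sub_eq_zero.1 ha, sub_eq_zero.1 hm⟩

theorem rigid_eq_zero_of_edge_subset (hk : 1 ≤ k) (hΓ : IsBoundaryPartition Ω Γu Γσ)
    (h : ∀ d ∈ StressData.conforming k T Γσ,
      ∑ i, StressData.traceSum (fun K => continuous_polyEval (rigid (a K) (m K) i)) i d = 0)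
    {K : Fin T.N} {e : Fin (T.cell K).n} (he : (T.cell K).edge e ⊆ closure Γu) :
    a K = 0 ∧ m K = 0 := by
  have hsum := h (StressData.singleTrace K e fun i => ⟨_, rigid_mem_Poly hk (a K) (m K) i⟩)
    fun φ hφ i => by
      have hzero : EqOn φ 0 ((T.cell K).edge e) := fun x hx => by
        by_contra hxφ
        have hxf : x ∈ frontier Ω := hΓ.cover ▸ Or.inl (he hx)
        exact hΓ.disjoint_closure_u.notMem_of_mem_left (hφ.2 ⟨subset_tsupport φ hxφ, hxf⟩) (he hx)
      rw [StressData.traceSum_singleTrace, SimplePolygon.edgeIntegral_congr (g' := fun _ => 0)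
        fun x hx => by simp only [hzero hx, Pi.zero_apply, mul_zero],
        SimplePolygon.edgeIntegral_zero]
  simp only [StressData.traceSum_singleTrace] at hsum
  exact SimplePolygon.rigid_eq_zero_of_sum_edgeIntegral_sq hsum

theorem IsPiecewise.eq_zero {u : L2Vec Ω} {r : L2Ten Ω}
    (h : IsPiecewise T (fun _ => rigid 0 0) (fun _ => MvPolynomial.C 0) u r) : u = 0 ∧ r = 0 := by
  refine ⟨PolygonalMesh.ext_of_cells T fun K => ?_, PolygonalMesh.ext_of_cells T fun K => ?_⟩
  · filter_upwards [h.vec K, ae_mono (T.restrict_cell_le K)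
      (Lp.coeFn_zero Pt 2 (volume.restrict Ω))] with x hx hzero
    rw [hzero]
    ext i
    rw [hx, polyEval_rigid]
    fin_cases i <;> simp
  · filter_upwards [h.skew K, ae_mono (T.restrict_cell_le K)
      (Lp.coeFn_zero Ten 2 (volume.restrict Ω))] with x hx hzero
    rw [hzero]
    ext ⟨i, j⟩
    rw [← row_apply, hx, polyEval_C]
    fin_cases i <;> fin_cases j <;> simp [skewRow]

/-- The discrete inf-sup condition, in qualitative form. -/
theorem AnnihilatesStress.eq_zero {u : L2Vec Ω} {r : L2Ten Ω} (h : AnnihilatesStress k T Γσ u r)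
    (hu : u ∈ velocitySpace k T) (hr : r ∈ rotationSpace k T) (hΩ : interior (closure Ω) = Ω)
    (hc : IsPreconnected Ω) (hΓ : IsBoundaryPartition Ω Γu Γσ) (hF : T.Fits Γu Γσ)
    (hT : T.IsStarMesh) (hk : 1 ≤ k) : u = 0 ∧ r = 0 := by
  have hΩo : IsOpen Ω := hΩ ▸ isOpen_interior
  obtain ⟨p, ρ, hpρ, hp, hρ⟩ := exists_isPiecewise hu hr
  obtain ⟨a, ha⟩ := hpρ.exists_rotation_const hΩo h hρ
  obtain ⟨m, hm⟩ := ha.exists_rigid hΩo hT h hk hp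
  have hsum : ∀ d ∈ StressData.conforming k T Γσ,
      ∑ i, StressData.traceSum (fun K => continuous_polyEval (rigid (a K) (m K) i)) i d = 0 :=
    fun d hd => hm.sum_edgeIntegral_mul_rigid_eq_zero hΩo hT h hd
  obtain ⟨K, e, he⟩ := hT.exists_edge_subset hΩ hΓ hF
  have hall : {K | a K = 0 ∧ m K = 0} = univ :=
    hT.eq_univ_of_isClosedUnderNeighbours hΩo hc ⟨K, rigid_eq_zero_of_edge_subset hk hΓ hsum he⟩
      fun K hK L _ e e' he => by
        obtain ⟨haKL, hmKL⟩ := rigid_eq_of_edge_eq hk hsum he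
        exact ⟨haKL ▸ hK.1, hmKL ▸ hK.2⟩
  obtain rfl : a = 0 := funext fun K => (eq_univ_iff_forall.1 hall K).1
  obtain rfl : m = 0 := funext fun K => (eq_univ_iff_forall.1 hall K).2
  exact hm.eq_zero

end Multipliers

/-! ### The divergence as a bounded operator -/

section Divergence

variable {Ω : Set Pt}

/-- The linear functional `f ↦ ∫ fᵢ φ` on `L²(Ω)`. -/
def componentPairing (Ω : Set Pt) (i : Fin 2) {φ : Pt → ℝ} (hφ : MemLp φ 2 (volume.restrict Ω)) :
    L2Vec Ω →L[ℝ] ℝ :=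
  innerSL ℝ hφ.toLp ∘L
    (EuclideanSpace.proj i : Pt →L[ℝ] ℝ).compLpL 2 (volume.restrict Ω)

theorem componentPairing_apply (i : Fin 2) {φ : Pt → ℝ} (hφ : MemLp φ 2 (volume.restrict Ω))
    (f : L2Vec Ω) : componentPairing Ω i hφ f = ∫ x in Ω, f x i * φ x :=
  inner_L2_eq_integral _ _ hφ.coeFn_toLp
    ((EuclideanSpace.proj i : Pt →L[ℝ] ℝ).coeFn_compLp f)

/-- The graph of the weak divergence, cut out by the equations `∫ fᵢ φ + ∫ τᵢ · grad φ = 0` for all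
test functions `φ` in `Ω`. -/
def weakDivGraph (hΩ : IsOpen Ω) : Submodule ℝ (L2Ten Ω × L2Vec Ω) :=
  ⨅ (φ : testSpaceIn Ω) (i : Fin 2), LinearMap.ker
    ((rowPairing Ω i hΩ.measurableSet (IsTest.memLp_grad φ.2.1)).coprod
      (componentPairing Ω i ((IsTest.memLp φ.2.1).restrict Ω))).toLinearMap

theorem isClosed_weakDivGraph (hΩ : IsOpen Ω) :
    IsClosed (weakDivGraph hΩ : Set (L2Ten Ω × L2Vec Ω)) := by
  simp only [weakDivGraph, Submodule.coe_iInf]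
  exact isClosed_iInter fun φ => isClosed_iInter fun i => ContinuousLinearMap.isClosed_ker _

theorem mem_weakDivGraph_iff (hΩ : IsOpen Ω) {τ : L2Ten Ω} {f : L2Vec Ω} :
    (τ, f) ∈ weakDivGraph hΩ ↔ IsWeakDiv Ω τ f := by
  rw [isWeakDiv_iff_normalPairing subset_rfl τ fun φ hφ i => integrableOn_apply_mul hφ f i]
  have hpair : ∀ φ (hφ : IsTest φ) i, normalPairing Ω τ f φ i =
      rowPairing Ω i hΩ.measurableSet hφ.memLp_grad τ +
        componentPairing Ω i (hφ.memLp.restrict Ω) f := fun φ hφ i => by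
    rw [rowPairing_apply subset_rfl, componentPairing_apply, add_comm,
      normalPairing_eq_add subset_rfl hφ τ (integrableOn_apply_mul hφ f i)]
  simp only [weakDivGraph, Submodule.mem_iInf, LinearMap.mem_ker, Subtype.forall]
  exact ⟨fun h φ hφ hs i => (hpair φ hφ i).trans (h φ ⟨hφ, hs⟩ i),
    fun h φ hφ i => (hpair φ hφ.1 i).symm.trans (h φ hφ.1 hφ.2 i)⟩

theorem divergence_eq_iff_mem_weakDivGraph (hΩ : IsOpen Ω) {τ : L2Ten Ω} (hτ : τ ∈ HDiv Ω)
    {f : L2Vec Ω} : divergence τ = f ↔ (τ, f) ∈ weakDivGraph hΩ := by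
  rw [mem_weakDivGraph_iff]
  exact ⟨fun h => h ▸ isWeakDiv_divergence hτ, divergence_eq hΩ⟩

theorem mk_divergence_mem_weakDivGraph (hΩ : IsOpen Ω) {τ : L2Ten Ω} (hτ : τ ∈ HDiv Ω) :
    (τ, divergence τ) ∈ weakDivGraph hΩ :=
  (mem_weakDivGraph_iff hΩ).2 (isWeakDiv_divergence hτ)

/-- The weak divergence as a linear map on a subspace of `H(div, Ω)`. -/
def divergenceₗ (hΩ : IsOpen Ω) (S : Submodule ℝ (L2Ten Ω)) (hS : ∀ τ ∈ S, τ ∈ HDiv Ω) :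
    S →ₗ[ℝ] L2Vec Ω where
  toFun τ := divergence τ.1
  map_add' τ τ' := divergence_eq hΩ <| (mem_weakDivGraph_iff hΩ).1 <|
    add_mem (mk_divergence_mem_weakDivGraph hΩ (hS τ τ.2))
      (mk_divergence_mem_weakDivGraph hΩ (hS τ' τ'.2))
  map_smul' a τ := divergence_eq hΩ <| (mem_weakDivGraph_iff hΩ).1 <|
    Submodule.smul_mem _ a (mk_divergence_mem_weakDivGraph hΩ (hS τ τ.2))

theorem isClosed_graph_divergenceₗ (hΩ : IsOpen Ω) (S : Submodule ℝ (L2Ten Ω))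
    (hS : ∀ τ ∈ S, τ ∈ HDiv Ω) : IsClosed ((divergenceₗ hΩ S hS).graph : Set (S × L2Vec Ω)) := by
  have hgraph : ((divergenceₗ hΩ S hS).graph : Set (S × L2Vec Ω)) =
      Prod.map Subtype.val id ⁻¹' (weakDivGraph hΩ : Set (L2Ten Ω × L2Vec Ω)) := by
    ext ⟨τ, f⟩
    exact eq_comm.trans (divergence_eq_iff_mem_weakDivGraph hΩ (hS τ τ.2))
  rw [hgraph]
  exact (isClosed_weakDivGraph hΩ).preimage (continuous_subtype_val.prodMap continuous_id)

/-- The weak divergence as a bounded operator on a complete subspace of `H(div, Ω)`, by the closed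
graph theorem. -/
def divergenceL (hΩ : IsOpen Ω) (S : Submodule ℝ (L2Ten Ω)) [CompleteSpace S]
    (hS : ∀ τ ∈ S, τ ∈ HDiv Ω) : S →L[ℝ] L2Vec Ω :=
  ContinuousLinearMap.ofIsClosedGraph (isClosed_graph_divergenceₗ hΩ S hS)

end Divergence

/-! ### Saddle point problems with two stresses -/

section Saddle

theorem exists_inner_map_eq {Q H : Type*} [AddCommGroup Q] [Module ℝ Q] [FiniteDimensional ℝ Q]
    [NormedAddCommGroup H] [InnerProductSpace ℝ H] {R : Q →ₗ[ℝ] H} (hR : Function.Injective R)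
    (l : Q →ₗ[ℝ] ℝ) : ∃ q, ∀ q', inner ℝ (R q') (R q) = l q' := by
  let A : Q →ₗ[ℝ] Module.Dual ℝ Q := (innerₗ H).flip.compl₁₂ R R
  have hA : Function.Injective A := by
    refine (injective_iff_map_eq_zero A).2 fun q hq => ?_
    have hself : inner ℝ (R q) (R q) = 0 := LinearMap.congr_fun hq q
    exact (injective_iff_map_eq_zero R).1 hR q (inner_self_eq_zero.1 hself)
  obtain ⟨q, hq⟩ := (LinearMap.injective_iff_surjective_of_finrank_eq_finrank
    Subspace.dual_finrank_eq.symm).1 hA l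
  exact ⟨q, fun q' => LinearMap.congr_fun hq q'⟩

/-- Eliminating both stresses leaves `2 (R q', R q) = (R q', y₀ + y₁) - l q'` for the multiplier. -/
theorem existsUnique_two_stress_saddle {Q H : Type*} [AddCommGroup Q] [Module ℝ Q]
    [FiniteDimensional ℝ Q] [NormedAddCommGroup H] [InnerProductSpace ℝ H] {R : Q →ₗ[ℝ] H}
    (hR : Function.Injective R) (l : Q →ₗ[ℝ] ℝ) (y₀ y₁ : H) :
    ∃! s : H × H × Q, s.1 + R s.2.2 = y₀ ∧ s.2.1 + R s.2.2 = y₁ ∧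
      ∀ q, inner ℝ (R q) (s.1 + s.2.1) = l q := by
  have helim : ∀ q q', inner ℝ (R q') (y₀ - R q + (y₁ - R q)) =
      inner ℝ (y₀ + y₁) (R q') - 2 * inner ℝ (R q') (R q) := fun q q' => by
    rw [inner_add_right, inner_sub_right, inner_sub_right, inner_add_left, real_inner_comm,
      real_inner_comm (R q') y₁]
    ring
  obtain ⟨q, hq⟩ := exists_inner_map_eq hR
    ((1 / 2 : ℝ) • ((innerSL ℝ (y₀ + y₁)).toLinearMap ∘ₗ R - l))
  have hq' : ∀ q', 2 * inner ℝ (R q') (R q) = inner ℝ (y₀ + y₁) (R q') - l q' := fun q' => by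
    have hhalf : inner ℝ (R q') (R q) = (1 / 2 : ℝ) * (inner ℝ (y₀ + y₁) (R q') - l q') := hq q'
    rw [hhalf]
    ring
  refine ⟨(y₀ - R q, y₁ - R q, q), ⟨sub_add_cancel _ _, sub_add_cancel _ _, fun q' => ?_⟩, ?_⟩
  · rw [helim, hq', sub_sub_cancel]
  · rintro ⟨s₀, s₁, p⟩ ⟨h₀, h₁, hs⟩
    obtain rfl : s₀ = y₀ - R p := eq_sub_of_add_eq h₀
    obtain rfl : s₁ = y₁ - R p := eq_sub_of_add_eq h₁
    have horth : inner ℝ (R (p - q)) (R (p - q)) = 0 := by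
      have hp := hs (p - q)
      rw [helim] at hp
      rw [map_sub R p q, inner_sub_right, ← map_sub]
      linarith [hq' (p - q)]
    obtain rfl : p = q :=
      sub_eq_zero.1 ((injective_iff_map_eq_zero R).1 hR _ (inner_self_eq_zero.1 horth))
    rfl

variable {G H : Type*} [NormedAddCommGroup G] [InnerProductSpace ℝ G] [CompleteSpace G]
  [NormedAddCommGroup H] [InnerProductSpace ℝ H] {S : Submodule ℝ H} [CompleteSpace S]

/-- The Riesz representative in `S` of the functional `τ ↦ (D τ, u) + (τ, r)`, as a linear function
of the multipliers `(u, r)`. -/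
def multiplierStress (D : S →L[ℝ] G) : G × H →L[ℝ] S :=
  (ContinuousLinearMap.adjoint D).coprod S.orthogonalProjectionOnto

theorem inner_multiplierStress (D : S →L[ℝ] G) (p : G × H) (τ : S) :
    inner ℝ (multiplierStress D p) τ = inner ℝ (D τ) p.1 + inner ℝ (τ : H) p.2 := by
  rw [multiplierStress, ContinuousLinearMap.coprod_apply, inner_add_left,
    ContinuousLinearMap.adjoint_inner_left,
    Submodule.inner_orthogonalProjectionOnto_eq_of_mem_right, real_inner_comm, real_inner_comm p.2]

theorem forall_stress_eq_zero_iff (D : S →L[ℝ] G) (σ : H) (u : G) (r : H) (s : S) (p : G × H) :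
    (∀ τ : S, inner ℝ ((s : H) - σ) (τ : H) + inner ℝ (D τ) (p.1 - u) +
      inner ℝ (τ : H) (p.2 - r) = 0) ↔
    s + multiplierStress D p = S.orthogonalProjectionOnto σ + multiplierStress D (u, r) := by
  have hriesz : ∀ τ : S, inner ℝ ((s : H) - σ) (τ : H) + inner ℝ (D τ) (p.1 - u) +
      inner ℝ (τ : H) (p.2 - r) = inner ℝ (s + multiplierStress D p) τ -
        inner ℝ (S.orthogonalProjectionOnto σ + multiplierStress D (u, r)) τ := fun τ => by
    rw [inner_add_left, inner_add_left, inner_multiplierStress, inner_multiplierStress,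
      Submodule.inner_orthogonalProjectionOnto_eq_of_mem_right, inner_sub_left, inner_sub_right,
      inner_sub_right, Submodule.coe_inner]
    ring
  simp only [hriesz, sub_eq_zero]
  exact ⟨ext_inner_right ℝ, fun h τ => by rw [h]⟩

theorem forall_constraint_eq_zero_iff (D : S →L[ℝ] G) (V : Submodule ℝ G) (Z : Submodule ℝ H)
    (f : G) (σ : H) (s : S) :
    ((∀ w ∈ V, inner ℝ (D s - f) w = 0) ∧ ∀ ζ ∈ Z, inner ℝ ((s : H) - σ) ζ = 0) ↔
      ∀ q ∈ V.prod Z, inner ℝ (multiplierStress D q) s = inner ℝ f q.1 + inner ℝ σ q.2 := by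
  simp only [inner_multiplierStress, inner_sub_left, sub_eq_zero]
  refine ⟨fun h q hq => congrArg₂ (· + ·) (h.1 _ hq.1) (h.2 _ hq.2), fun h => ⟨fun w hw => ?_,
    fun ζ hζ => ?_⟩⟩
  · simpa only [inner_zero_right, add_zero] using h (w, 0) ⟨hw, Z.zero_mem⟩
  · simpa only [inner_zero_right, zero_add] using h (0, ζ) ⟨V.zero_mem, hζ⟩

end Saddle

/-! ### The projection as a saddle point problem -/

section Projection

variable {Ω Γu Γσ : Set Pt} {k : ℕ} {T : PolygonalMesh Ω}

/-- The space `L2Skew Ω` of skew tensor fields as a subspace of `L²(Ω)`. -/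
def skewSubmodule (Ω : Set Pt) : Submodule ℝ (L2Ten Ω) where
  carrier := L2Skew Ω
  add_mem' {η η'} hη hη' := by
    filter_upwards [hη, hη', Lp.coeFn_add η η'] with x hx hx' hadd i j
    rw [hadd, Pi.add_apply, PiLp.add_apply, PiLp.add_apply, hx i j, hx' i j, neg_add]
  zero_mem' := by
    filter_upwards [Lp.coeFn_zero Ten 2 (volume.restrict Ω)] with x hzero i j
    rw [hzero, Pi.zero_apply, PiLp.zero_apply, PiLp.zero_apply, neg_zero]
  smul_mem' a η hη := by
    filter_upwards [hη, Lp.coeFn_smul a η] with x hx hsmul i j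
    rw [hsmul, Pi.smul_apply, PiLp.smul_apply, PiLp.smul_apply, hx i j, smul_neg]

/-- The space `V_h × K_h` of the multipliers as a subspace of `L²(Ω)`. -/
def multiplierSubmodule (k : ℕ) (T : PolygonalMesh Ω) : Submodule ℝ (L2Vec Ω × L2Ten Ω) :=
  (T.piecewisePoly k (Fin 2)).prod (skewSubmodule Ω ⊓ T.piecewisePoly k (Fin 2 × Fin 2))

theorem mem_multiplierSubmodule_iff {p : L2Vec Ω × L2Ten Ω} :
    p ∈ multiplierSubmodule k T ↔ p.1 ∈ velocitySpace k T ∧ p.2 ∈ rotationSpace k T :=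
  and_congr T.mem_piecewisePoly_iff (and_congr_right fun _ => T.mem_piecewisePoly_iff)

instance finiteDimensional_multiplierSubmodule : FiniteDimensional ℝ (multiplierSubmodule k T) :=
  Module.Finite.iff_fg.2 ((Module.Finite.iff_fg.1 inferInstance).prod
    (Module.Finite.iff_fg.1 inferInstance))

instance completeSpace_stressSubmodule : CompleteSpace (stressSubmodule k T Γσ) :=
  (isClosed_stressSubmodule k T Γσ).completeSpace_coe

/-- The divergence on the discrete stress space. -/
def stressDivergence (k : ℕ) (T : PolygonalMesh Ω) (Γσ : Set Pt) (hΩ : IsOpen Ω) :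
    stressSubmodule k T Γσ →L[ℝ] L2Vec Ω :=
  divergenceL hΩ _ fun _ hτ => ((mem_stressSubmodule_iff hΩ).1 hτ).1.1

theorem forall_mem_stressSpace_iff (hΩ : IsOpen Ω) {P : L2Ten Ω → L2Vec Ω → Prop} :
    (∀ τ ∈ stressSpace k T Γσ, P τ (divergence τ)) ↔
      ∀ τ : stressSubmodule k T Γσ, P τ (stressDivergence k T Γσ hΩ τ) := by
  simp only [Subtype.forall, ← mem_stressSubmodule_iff hΩ]
  rfl

/-- The discrete stress which represents the functional `τ ↦ (div τ, u) + (τ, r)` of the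
multipliers `(u, r)`. -/
abbrev discreteMultiplierStress (k : ℕ) (T : PolygonalMesh Ω) (Γσ : Set Pt) (hΩ : IsOpen Ω) :
    L2Vec Ω × L2Ten Ω →L[ℝ] stressSubmodule k T Γσ :=
  multiplierStress (stressDivergence k T Γσ hΩ)

theorem divergence_sub_sub (hΩ : IsOpen Ω) {σ₀ σ₁ : L2Ten Ω} (hσ₀ : σ₀ ∈ HDiv Ω)
    (hσ₁ : σ₁ ∈ HDiv Ω) (t : stressSubmodule k T Γσ) :
    divergence ((t : L2Ten Ω) - σ₀ - σ₁) =
      stressDivergence k T Γσ hΩ t - (divergence σ₀ + divergence σ₁) := by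
  have ht : (t : L2Ten Ω) ∈ HDiv Ω := ((mem_stressSubmodule_iff hΩ).1 t.2).1.1
  rw [← sub_sub]
  exact divergence_eq hΩ <| (mem_weakDivGraph_iff hΩ).1 <|
    sub_mem (sub_mem (mk_divergence_mem_weakDivGraph hΩ ht)
      (mk_divergence_mem_weakDivGraph hΩ hσ₀)) (mk_divergence_mem_weakDivGraph hΩ hσ₁)

theorem injective_discreteMultiplierStress (hΩ : interior (closure Ω) = Ω) (hc : IsPreconnected Ω)
    (hΓ : IsBoundaryPartition Ω Γu Γσ) (hF : T.Fits Γu Γσ) (hT : T.IsStarMesh) (hk : 1 ≤ k)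
    (hΩo : IsOpen Ω) : Function.Injective
      ((discreteMultiplierStress k T Γσ hΩo).toLinearMap.domRestrict
        (multiplierSubmodule k T)) := by
  refine (injective_iff_map_eq_zero _).2 fun q hq => ?_
  obtain ⟨hu, hr⟩ := mem_multiplierSubmodule_iff.1 q.2
  have hann : AnnihilatesStress k T Γσ q.1.1 q.1.2 :=
    (forall_mem_stressSpace_iff hΩo (P := fun τ f => inner ℝ f q.1.1 + inner ℝ τ q.1.2 = 0)).2
      fun τ => (inner_multiplierStress _ q.1 τ).symm.trans
        ((congrArg (inner ℝ · τ) hq).trans (inner_zero_left τ))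
  obtain ⟨hu0, hr0⟩ := hann.eq_zero hu hr hΩ hc hΓ hF hT hk
  exact Subtype.ext (Prod.ext hu0 hr0)

theorem forall_mem_stressSpace_eq_zero_iff (hΩ : IsOpen Ω) (σ : L2Ten Ω) (u : L2Vec Ω)
    (r : L2Ten Ω) (t : stressSubmodule k T Γσ) (p : L2Vec Ω × L2Ten Ω) :
    (∀ τ ∈ stressSpace k T Γσ, inner ℝ ((t : L2Ten Ω) - σ) τ +
        inner ℝ (divergence τ) (p.1 - u) + inner ℝ τ (p.2 - r) = 0) ↔
      t + discreteMultiplierStress k T Γσ hΩ p =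
        (stressSubmodule k T Γσ).orthogonalProjectionOnto σ +
          discreteMultiplierStress k T Γσ hΩ (u, r) :=
  (forall_mem_stressSpace_iff hΩ (P := fun τ f => inner ℝ ((t : L2Ten Ω) - σ) τ +
    inner ℝ f (p.1 - u) + inner ℝ τ (p.2 - r) = 0)).trans
    (forall_stress_eq_zero_iff _ σ u r t p)

theorem forall_mem_velocitySpace_rotationSpace_eq_zero_iff (hΩ : IsOpen Ω) {σ₀ σ₁ : L2Ten Ω}
    (hσ₀ : σ₀ ∈ HDiv Ω) (hσ₁ : σ₁ ∈ HDiv Ω) (t : stressSubmodule k T Γσ) :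
    ((∀ w ∈ velocitySpace k T, inner ℝ (divergence ((t : L2Ten Ω) - σ₀ - σ₁)) w = 0) ∧
      ∀ ζ ∈ rotationSpace k T, inner ℝ ((t : L2Ten Ω) - σ₀ - σ₁) ζ = 0) ↔
      ∀ q ∈ multiplierSubmodule k T, inner ℝ (discreteMultiplierStress k T Γσ hΩ q) t =
        inner ℝ (divergence σ₀ + divergence σ₁) q.1 + inner ℝ (σ₀ + σ₁) q.2 := by
  refine Iff.trans ?_ (forall_constraint_eq_zero_iff _ _ _ _ _ _)
  rw [← divergence_sub_sub hΩ hσ₀ hσ₁, ← sub_sub]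
  exact and_congr (forall_congr' fun w => imp_congr_left T.mem_piecewisePoly_iff.symm)
    (forall_congr' fun ζ => imp_congr_left
      (and_congr_right fun _ => T.mem_piecewisePoly_iff.symm))

theorem isProjection_iff (hΩ : IsOpen Ω) {σ₀ σ₁ : L2Ten Ω} (hσ₀ : σ₀ ∈ HDiv Ω)
    (hσ₁ : σ₁ ∈ HDiv Ω) (u : L2Vec Ω) (r : L2Ten Ω) (t₀ t₁ : stressSubmodule k T Γσ)
    (p : multiplierSubmodule k T) :
    IsProjection k T Γσ σ₀ σ₁ u r t₀ t₁ p.1.1 p.1.2 ↔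
      t₀ + discreteMultiplierStress k T Γσ hΩ p =
        (stressSubmodule k T Γσ).orthogonalProjectionOnto σ₀ +
          discreteMultiplierStress k T Γσ hΩ (u, r) ∧
      t₁ + discreteMultiplierStress k T Γσ hΩ p =
        (stressSubmodule k T Γσ).orthogonalProjectionOnto σ₁ +
          discreteMultiplierStress k T Γσ hΩ (u, r) ∧
      ∀ q ∈ multiplierSubmodule k T, inner ℝ (discreteMultiplierStress k T Γσ hΩ q) (t₀ + t₁) =
        inner ℝ (divergence σ₀ + divergence σ₁) q.1 + inner ℝ (σ₀ + σ₁) q.2 := by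
  rw [← forall_mem_stressSpace_eq_zero_iff, ← forall_mem_stressSpace_eq_zero_iff,
    ← forall_mem_velocitySpace_rotationSpace_eq_zero_iff hΩ hσ₀ hσ₁]
  obtain ⟨hp₁, hp₂⟩ := mem_multiplierSubmodule_iff.1 p.2
  exact ⟨fun h => ⟨h.eq₀, h.eq₁, h.eq_div, h.eq_skew⟩, fun ⟨h₀, h₁, hdiv, hskew⟩ =>
    ⟨(mem_stressSubmodule_iff hΩ).1 t₀.2, (mem_stressSubmodule_iff hΩ).1 t₁.2, hp₁, hp₂,
      h₀, h₁, hdiv, hskew⟩⟩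

theorem existsUnique_isProjection_submodule (hΩ : interior (closure Ω) = Ω)
    (hc : IsPreconnected Ω) (hΓ : IsBoundaryPartition Ω Γu Γσ) (hF : T.Fits Γu Γσ)
    (hT : T.IsStarMesh) (hk : 1 ≤ k) {σ₀ σ₁ : L2Ten Ω} (hσ₀ : σ₀ ∈ HDiv Ω) (hσ₁ : σ₁ ∈ HDiv Ω)
    (u : L2Vec Ω) (r : L2Ten Ω) :
    ∃! s : stressSubmodule k T Γσ × stressSubmodule k T Γσ × multiplierSubmodule k T,
      IsProjection k T Γσ σ₀ σ₁ u r s.1 s.2.1 s.2.2.1.1 s.2.2.1.2 := by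
  have hΩo : IsOpen Ω := hΩ ▸ isOpen_interior
  have hinj := injective_discreteMultiplierStress hΩ hc hΓ hF hT hk hΩo
  let constraint := ((innerSL ℝ (divergence σ₀ + divergence σ₁)).coprod
    (innerSL ℝ (σ₀ + σ₁))).toLinearMap.domRestrict (multiplierSubmodule k T)
  refine (existsUnique_congr fun s => ?_).1 (existsUnique_two_stress_saddle hinj constraint
    ((stressSubmodule k T Γσ).orthogonalProjectionOnto σ₀ +
      discreteMultiplierStress k T Γσ hΩo (u, r))
    ((stressSubmodule k T Γσ).orthogonalProjectionOnto σ₁ +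
      discreteMultiplierStress k T Γσ hΩo (u, r)))
  rw [isProjection_iff hΩo hσ₀ hσ₁]
  exact and_congr_right fun _ => and_congr_right fun _ => Subtype.forall

end Projection

end WeakSymVEM

end

open WeakSymVEM in
theorem mainTheorem8_general (Ω Γu Γσ : Set Pt) (hΩ : interior (closure Ω) = Ω)
    (hc : IsPreconnected Ω) (hΓ : IsBoundaryPartition Ω Γu Γσ) (T : PolygonalMesh Ω)
    (hT : T.Fits Γu Γσ) (hstar : T.IsStarMesh) (k : ℕ) (hk : 1 ≤ k) (σ₀ σ₁ : L2Ten Ω) (u : L2Vec Ω)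
    (r : L2Ten Ω) (hσ₀ : σ₀ ∈ WeakSymVEM.HDiv Ω) (hσ₁ : σ₁ ∈ WeakSymVEM.HDiv Ω) :
    ∃! s : L2Ten Ω × L2Ten Ω × L2Vec Ω × L2Ten Ω,
      IsProjection k T Γσ σ₀ σ₁ u r s.1 s.2.1 s.2.2.1 s.2.2.2 := by
  have hΩo : IsOpen Ω := hΩ ▸ isOpen_interior
  obtain ⟨⟨t₀, t₁, p⟩, ht, huniq⟩ :=
    existsUnique_isProjection_submodule hΩ hc hΓ hT hstar hk hσ₀ hσ₁ u r
  refine ⟨(t₀, t₁, p.1.1, p.1.2), ht, fun ⟨s₀, s₁, v, η⟩ hs => ?_⟩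
  have heq := huniq (⟨s₀, (mem_stressSubmodule_iff hΩo).2 hs.mem_stress₀⟩,
    ⟨s₁, (mem_stressSubmodule_iff hΩo).2 hs.mem_stress₁⟩,
    ⟨(v, η), mem_multiplierSubmodule_iff.2 ⟨hs.mem_velocity, hs.mem_rotation⟩⟩) hs
  exact congrArg (fun s => (s.1.1, s.2.1.1, s.2.2.1.1, s.2.2.1.2)) heq

theorem mainTheorem8 (Ω Γu Γσ : Set WeakSymVEM.Pt)
    (hΩ : WeakSymVEM.IsPolygonalDomain Ω) (hΓ : WeakSymVEM.IsBoundaryPartition Ω Γu Γσ)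
    (T : WeakSymVEM.PolygonalMesh Ω) (hT : T.Fits Γu Γσ)
    (η₁ η₂ : ℝ) (hη₁ : 0 < η₁) (hη₂ : 0 < η₂) (hreg : T.ShapeRegular η₁ η₂)
    (k : ℕ) (hk : 1 ≤ k)
    (σ₀ σ₁ : WeakSymVEM.L2Ten Ω) (u : WeakSymVEM.L2Vec Ω) (r : WeakSymVEM.L2Ten Ω)
    (hσ₀ : σ₀ ∈ WeakSymVEM.HDivStar Ω Γσ) (hσ₁ : σ₁ ∈ WeakSymVEM.HDivStar Ω Γσ)
    (hr : r ∈ WeakSymVEM.L2Skew Ω) :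
    ∃! s : WeakSymVEM.L2Ten Ω × WeakSymVEM.L2Ten Ω × WeakSymVEM.L2Vec Ω × WeakSymVEM.L2Ten Ω,
      WeakSymVEM.IsProjection k T Γσ σ₀ σ₁ u r s.1 s.2.1 s.2.2.1 s.2.2.2 :=
  mainTheorem8_general Ω Γu Γσ hΩ.interior_closure hΩ.isConnected.isPreconnected hΓ T hT
    (hreg.isStarMesh hη₁) k hk σ₀ σ₁ u r hσ₀.1 hσ₁.1
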